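/- Throughout, $\mathbf x=(x_1,\dots,x_\ell)$, $s_i$ swaps $x_i,x_{i+1}$, and $\pi_i(f)=\frac{x_if-x_{i+1}s_i(f)}{x_i-x_{i+1}}$ $(1\le i<\ell)$ are the Demazure operators. Let $\mathcal H_\ell$ be the 0-Hecke monoid of $S_\ell$, with generators $\mathsf s_1,\dots,\mathsf s_{\ell-1}$, the braid and commutation relations, and $\mathsf s_i^2=\mathsf s_i$; put $\pi_w=\pi_{i_1}\cdots\pi_{i_k}$ for $w=\mathsf s_{i_1}\cdots\mathsf s_{i_k}\in\mathcal H_\ell$. $\mathcal H_\ell$ acts on $\mathbb Z^\ell$ by: $\mathsf s_i\alpha$ is $\alpha$ with its $i$-th and $(i+1)$-st entries exchanged if $\alpha_i\ge\alpha_{i+1}$, and $\mathsf s_i\alpha=\alpha$ otherwise. Let $\alpha^+$ be the weakly decreasing rearrangement of $\alpha$. *Key polynomials and truncation.* For $\alpha\in\mathbb Z^\ell$ put $\kappa_\alpha=\pi_z\mathbf x^{\alpha^+}$ with $z\in\mathcal H_\ell$ the shortest element such that $z\alpha^+=\alpha$; these form a basis of $\mathbb Z[x_1^{\pm1},\dots,x_\ell^{\pm1}]$.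 Let $\mathrm{poly}$ be the linear operator with $\mathrm{poly}(\kappa_\alpha)=\kappa_\alpha$ if $\alpha\in\mathbb Z_{\ge0}^\ell$ and $\mathrm{poly}(\kappa_\alpha)=0$ otherwise, extended coefficientwise to power series in $q$. *Nonsymmetric Catalan functions.* A root ideal is a subset $\Psi\subset\Delta^+_\ell=\{(i,j):1\le i<j\le\ell\}$ such that $(i,j)\in\Psi$, $i'\le i$, $j\le j'\le\ell$ imply $(i',j')\in\Psi$. For a root ideal $\Psi$, $\gamma\in\mathbb Z^\ell$ and $w\in\mathcal H_\ell$ let $$H(\Psi;\gamma;w)(\mathbf x;q)=\pi_w\Big(\mathrm{poly}\Big(\prod_{(i,j)\in\Psi}(1-qx_i/x_j)^{-1}\,\mathbf x^\gamma\Big)\Big).$$ Put $n_i(\Psi)=\#\{j\in\{i,\dots,\ell\}:(i,j)\notin\Psi\}$. The triple $(\Psi,\gamma,w)$ is tame if $w\mathsf s_i=w$ for all $i$ with $n_1(\Psi)+1\le i\le\ell-1$. *The root ideals $\Delta'$.* For a partition $\eta=(\eta_1,\dots,\eta_k)$ of $m\le\ell$, let $\Delta'(\eta)\subset\Delta^+_m$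 be the root ideal with $(n_1,\dots,n_{m-1})$ equal to $$\big((\eta_1)^{\eta_2},\eta_1,\eta_1-1,\dots,\eta_2+1,\ (\eta_2)^{\eta_3},\eta_2,\eta_2-1,\dots,\eta_3+1,\ \dots,\ (\eta_{k-1})^{\eta_k},\eta_{k-1},\dots,\eta_k+1,\ \eta_k,\eta_k-1,\dots,2\big),$$ where $(a)^b$ means $a$ repeated $b$ times, and let $\Delta'_\ell(\eta)=\Delta'(\eta)\sqcup\{(i,j)\in\Delta^+_\ell:j>m\}$. *Macdonald polynomials.* Let $\Phi$ be the $\mathbb Z[q]$-algebra endomorphism of $\mathbb Z[q][\mathbf x]$ with $\Phi(x_i)=x_{i+1}$ for $i<\ell$ and $\Phi(x_\ell)=qx_1$. The renormalized $t=0$ nonsymmetric Macdonald polynomials $\tilde E_\alpha\in\mathbb Z[q][\mathbf x]$ $(\alpha\in\mathbb Z_{\ge0}^\ell)$ are the family determined by the $t=0$ Knop–Sahi recurrence $$\tilde E_{(0,\dots,0)}=1,\qquad \tilde E_{\mathsf s_i\alpha}=\pi_i(\tilde E_\alpha)\ (1\le i<\ell),\qquad \tilde E_{(\alpha_\ell+1,\alpha_1,\dots,\alpha_{\ell-1})}=x_1\Phi(\tilde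 E_\alpha)\ (\ell\ge1).$$ **Theorem.** There is exactly one family $(\tilde E_\alpha)_{\alpha\in\mathbb Z_{\ge0}^\ell}$ satisfying this recurrence, and the following holds for every $\alpha\in\mathbb Z_{\ge0}^\ell$. Set $\eta=(\alpha^+)'$ (the conjugate partition) and $m=|\alpha|$, and for $\beta\in\mathbb Z_{\ge0}^n$ let $\mathsf z(\beta)\in\mathcal H_n$ be the longest element with $\mathsf z(\beta)\beta^+=\beta$ (it exists and is unique for the $\beta$ used below). (i) If $m\le\ell$, then $(\Delta'_\ell(\eta),1^m0^{\ell-m},\mathsf z(\alpha))$ is tame and $$\tilde E_\alpha(x_1,\dots,x_\ell;q)=H(\Delta'_\ell(\eta);1^m0^{\ell-m};\mathsf z(\alpha))(x_1,\dots,x_\ell;q).$$ (ii) If $m>\ell$, then $(\Delta'(\eta),1^m,\mathsf z(\alpha,0^{m-\ell}))$ is tame, $H(\Delta'(\eta);1^m;\mathsf z(\alpha,0^{m-\ell}))$ is a polynomial in $\mathbb Z[q][x_1,\dots,x_m]$, and $$\tilde E_\alpha(x_1,\dots,x_\ell;q)=H(\Delta'(\eta);1^m;\mathsf z(\alpha,0^{m-\ell}))(x_1,\dots,x_m;q)\big|_{x_{\ell+1}=\cdots=x_m=0}.$$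 -/

import Mathlib

namespace NSMacdonald

noncomputable section

/-! Indices are 0-based: `x_1, …, x_ℓ` are indexed by `Fin ℓ`, and the simple generators
`s_1, …, s_{ℓ-1}` by `Fin (ℓ - 1)`, the `i`-th one exchanging the positions `lo i` and `hi i`. -/

/-- The position `i` (0-based) of the pair exchanged by the `i`-th simple transposition. -/
def lo {ℓ : ℕ} (i : Fin (ℓ - 1)) : Fin ℓ := ⟨i.1, by have := i.2; omega⟩

/-- The position `i + 1` (0-based) of the pair exchanged by the `i`-th simple transposition. -/
def hi {ℓ : ℕ} (i : Fin (ℓ - 1)) : Fin ℓ := ⟨i.1 + 1, by have := i.2; omega⟩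

lemma lo_ne_hi {ℓ : ℕ} (i : Fin (ℓ - 1)) : lo i ≠ hi i := by
  simp [lo, hi, Fin.ext_iff]

/-! ### The 0-Hecke monoid -/

/-- Defining relations of the 0-Hecke monoid of the symmetric group `S_ℓ`. -/
inductive ZeroHeckeRel (ℓ : ℕ) : FreeMonoid (Fin (ℓ - 1)) → FreeMonoid (Fin (ℓ - 1)) → Prop
  | idem (i : Fin (ℓ - 1)) :
      ZeroHeckeRel ℓ (FreeMonoid.of i * FreeMonoid.of i) (FreeMonoid.of i)
  | braid (i j : Fin (ℓ - 1)) (h : i.1 + 1 = j.1) :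
      ZeroHeckeRel ℓ (FreeMonoid.of i * FreeMonoid.of j * FreeMonoid.of i)
        (FreeMonoid.of j * FreeMonoid.of i * FreeMonoid.of j)
  | comm (i j : Fin (ℓ - 1)) (h : i.1 + 1 < j.1) :
      ZeroHeckeRel ℓ (FreeMonoid.of i * FreeMonoid.of j) (FreeMonoid.of j * FreeMonoid.of i)

/-- The 0-Hecke monoid of `S_ℓ`. -/
abbrev ZeroHecke (ℓ : ℕ) : Type := PresentedMonoid (ZeroHeckeRel ℓ)

/-- The `i`-th generator of the 0-Hecke monoid. -/
def gen {ℓ : ℕ} (i : Fin (ℓ - 1)) : ZeroHecke ℓ := PresentedMonoid.of (ZeroHeckeRel ℓ) i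

/-- The length of an element of the 0-Hecke monoid: the least length of a word representing it. -/
def len {ℓ : ℕ} (w : ZeroHecke ℓ) : ℕ :=
  sInf {n : ℕ | ∃ u : List (Fin (ℓ - 1)), u.length = n ∧ (u.map gen).prod = w}

/-- A map from the generators satisfying the 0-Hecke relations extends to the 0-Hecke monoid. -/
def zeroHeckeLift {ℓ : ℕ} {M : Type*} [Monoid M] (f : Fin (ℓ - 1) → M)
    (hidem : ∀ i, f i * f i = f i)
    (hbraid : ∀ i j : Fin (ℓ - 1), i.1 + 1 = j.1 → f i * f j * f i = f j * f i * f j)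
    (hcomm : ∀ i j : Fin (ℓ - 1), i.1 + 1 < j.1 → f i * f j = f j * f i) :
    ZeroHecke ℓ →* M :=
  PresentedMonoid.lift f (by
    intro a b h
    cases h with
    | idem i => simpa using hidem i
    | braid i j h => simpa using hbraid i j h
    | comm i j h => simpa using hcomm i j h)

/-! ### The action of the 0-Hecke monoid on weights -/

/-- The action of a generator on a weight: exchange the entries in positions `lo i`, `hi i` when
the first is at least the second, and do nothing otherwise. -/
def heckeStep {ℓ : ℕ} {T : Type*} [LinearOrder T] (i : Fin (ℓ - 1)) (α : Fin ℓ → T) : Fin ℓ → T :=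
  if α (hi i) ≤ α (lo i) then α ∘ Equiv.swap (lo i) (hi i) else α

lemma heckeStep_apply {ℓ : ℕ} {T : Type*} [LinearOrder T] (i : Fin (ℓ - 1)) (α : Fin ℓ → T)
    (k : Fin ℓ) : heckeStep i α k =
      if k.1 = i.1 then min (α (lo i)) (α (hi i))
      else if k.1 = i.1 + 1 then max (α (lo i)) (α (hi i)) else α k := by
  have hlo : k.1 = i.1 ↔ k = lo i := by simp [lo, Fin.ext_iff]
  have hhi : k.1 = i.1 + 1 ↔ k = hi i := by simp [hi, Fin.ext_iff]
  simp only [hlo, hhi]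
  unfold heckeStep
  by_cases h1 : k = lo i
  · subst h1
    by_cases h : α (hi i) ≤ α (lo i)
    · simp [h]
    · simp [h, le_of_not_ge h]
  · by_cases h2 : k = hi i
    · subst h2
      by_cases h : α (hi i) ≤ α (lo i)
      · simp [h, h1]
      · simp [h, h1, le_of_not_ge h]
    · by_cases h : α (hi i) ≤ α (lo i)
      · simp [h, h1, h2, Equiv.swap_apply_of_ne_of_ne h1 h2]
      · simp [h, h1, h2]

/-- The action of the 0-Hecke monoid on `ℓ`-tuples extending `heckeStep`. -/
def heckeAct (ℓ : ℕ) (T : Type*) [LinearOrder T] :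
    ZeroHecke ℓ →* Function.End (Fin ℓ → T) :=
  zeroHeckeLift (M := Function.End (Fin ℓ → T)) (fun i => heckeStep i)
    (by
      intro i
      funext α
      change heckeStep i (heckeStep i α) = heckeStep i α
      funext k
      simp only [heckeStep_apply, lo, hi]
      grind)
    (by
      intro i j h
      funext α
      change heckeStep i (heckeStep j (heckeStep i α)) = heckeStep j (heckeStep i (heckeStep j α))
      have e : lo j = hi i := by simp [lo, hi, h]
      funext k
      simp only [heckeStep_apply, e]
      simp only [lo, hi, ← h]
      grind)
    (by
      intro i j h
      funext α
      change heckeStep i (heckeStep j α) = heckeStep j (heckeStep i α)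
      funext k
      simp only [heckeStep_apply, lo, hi]
      grind)

/-- The weakly decreasing rearrangement `α⁺` of `α`. -/
def dec {ℓ : ℕ} {T : Type*} [LinearOrder T] (α : Fin ℓ → T) : Fin ℓ → T :=
  fun i => α (Tuple.sort α i.rev)

/-- `z` is a shortest element of the 0-Hecke monoid with `z · α⁺ = α`. -/
def IsShortestTo {ℓ : ℕ} {T : Type*} [LinearOrder T] (α : Fin ℓ → T) (z : ZeroHecke ℓ) : Prop :=
  heckeAct ℓ T z (dec α) = α ∧ ∀ z', heckeAct ℓ T z' (dec α) = α → len z ≤ len z'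

/-- `z` is a longest element of the 0-Hecke monoid with `z · α⁺ = α`. -/
def IsLongestTo {ℓ : ℕ} {T : Type*} [LinearOrder T] (α : Fin ℓ → T) (z : ZeroHecke ℓ) : Prop :=
  heckeAct ℓ T z (dec α) = α ∧ ∀ z', heckeAct ℓ T z' (dec α) = α → len z' ≤ len z

/-- The shortest element `z` of the 0-Hecke monoid with `z · α⁺ = α`. -/
def shortestTo {ℓ : ℕ} {T : Type*} [LinearOrder T] (α : Fin ℓ → T) : ZeroHecke ℓ :=
  Classical.epsilon (IsShortestTo α)

/-! ### Demazure operators -/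

open Classical in
/-- The quotient `a / b` when `b` divides `a` (unique in a domain for `b ≠ 0`). -/
def exactDiv {A : Type*} [CommRing A] (a b : A) : A := if h : b ∣ a then h.choose else 0

lemma mul_exactDiv {A : Type*} [CommRing A] {a b : A} (h : b ∣ a) : b * exactDiv a b = a := by
  unfold exactDiv
  rw [dif_pos h]
  exact h.choose_spec.symm

/-- The Demazure operator `f ↦ (x f - y s(f)) / (x - y)`. -/
def demazureOp {A : Type*} [CommRing A] (s : A →+* A) (x y f : A) : A :=
  exactDiv (x * f - y * s f) (x - y)

lemma demazureOp_spec {A : Type*} [CommRing A] {s : A →+* A} {x y : A}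
    (h : ∀ f, x - y ∣ f - s f) (f : A) :
    (x - y) * demazureOp s x y f = x * f - y * s f := by
  apply mul_exactDiv
  have : x * f - y * s f = (x - y) * f + y * (f - s f) := by ring
  rw [this]
  exact dvd_add (dvd_mul_right _ _) ((h f).mul_left _)

lemma demazureOp_idem {A : Type*} [CommRing A] [IsDomain A] {s : A →+* A} {x y : A}
    (hs : ∀ f, s (s f) = f) (hx : s x = y) (hy : s y = x) (hxy : x ≠ y)
    (h : ∀ f, x - y ∣ f - s f) (f : A) :
    demazureOp s x y (demazureOp s x y f) = demazureOp s x y f := by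
  have e1 := demazureOp_spec h f
  have e2 := demazureOp_spec h (demazureOp s x y f)
  set g := demazureOp s x y f
  have e3 := congrArg s e1
  simp only [map_mul, map_sub, hs, hx, hy] at e3
  have hD : x - y ≠ 0 := sub_ne_zero.2 hxy
  have hg : s g = g := by
    apply mul_left_cancel₀ hD
    linear_combination -e3 - e1
  apply mul_left_cancel₀ hD
  rw [e2, hg]
  ring

lemma demazureOp_comm {A : Type*} [CommRing A] [IsDomain A] {s t : A →+* A} {x y z u : A}
    (hst : ∀ f, s (t f) = t (s f)) (hz : s z = z) (hu : s u = u) (hx : t x = x) (hy : t y = y)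
    (hxy : x ≠ y) (hzu : z ≠ u)
    (h : ∀ f, x - y ∣ f - s f) (h' : ∀ f, z - u ∣ f - t f) (f : A) :
    demazureOp s x y (demazureOp t z u f) = demazureOp t z u (demazureOp s x y f) := by
  have a1 := demazureOp_spec h' f
  have a2 := demazureOp_spec h (demazureOp t z u f)
  have b1 := demazureOp_spec h f
  have b2 := demazureOp_spec h' (demazureOp s x y f)
  set g := demazureOp t z u f
  set g' := demazureOp s x y f
  have a3 := congrArg s a1
  have b3 := congrArg t b1
  simp only [map_mul, map_sub, hz, hu, hx, hy] at a3 b3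
  rw [hst] at a3
  apply mul_left_cancel₀ (sub_ne_zero.2 hxy)
  apply mul_left_cancel₀ (sub_ne_zero.2 hzu)
  linear_combination (z - u) * a2 + x * a1 - y * a3 - (x - y) * b2 - z * b1 + u * b3

lemma demazureOp_braid {A : Type*} [CommRing A] [IsDomain A] {s t : A →+* A} {x y z : A}
    (hst : ∀ f, s (t (s f)) = t (s (t f)))
    (sx : s x = y) (sy : s y = x) (sz : s z = z) (tx : t x = x) (ty : t y = z) (tz : t z = y)
    (hxy : x ≠ y) (hyz : y ≠ z) (hxz : x ≠ z)
    (h : ∀ f, x - y ∣ f - s f) (h' : ∀ f, y - z ∣ f - t f)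
    (hs : ∀ f, s (s f) = f) (ht : ∀ f, t (t f) = f) (f : A) :
    demazureOp s x y (demazureOp t y z (demazureOp s x y f)) =
      demazureOp t y z (demazureOp s x y (demazureOp t y z f)) := by
  have a1 := demazureOp_spec h f
  have a2 := demazureOp_spec h' (demazureOp s x y f)
  have a3 := demazureOp_spec h (demazureOp t y z (demazureOp s x y f))
  have b1 := demazureOp_spec h' f
  have b2 := demazureOp_spec h (demazureOp t y z f)
  have b3 := demazureOp_spec h' (demazureOp s x y (demazureOp t y z f))
  set g := demazureOp s x y f
  set g1 := demazureOp t y z g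
  set k := demazureOp s x y g1
  set p := demazureOp t y z f
  set p1 := demazureOp s x y p
  set l := demazureOp t y z p1
  have a1s := congrArg s a1
  have a1t := congrArg t a1
  have a2s := congrArg s a2
  have a1st := congrArg s a1t
  have b1s := congrArg s b1
  have b1t := congrArg t b1
  have b2t := congrArg t b2
  have b1ts := congrArg t b1s
  simp only [map_mul, map_sub, sx, sy, sz, tx, ty, tz, hs, ht] at a1s a1t a2s a1st b1s b1t b2t b1ts
  rw [hst] at a1st
  have c1 : (x - y) * ((x - y) * (x - z) * (y - z) * k) =
      (x - y) * (x ^ 2 * y * f - x * y ^ 2 * s f - x ^ 2 * z * t f + x * z ^ 2 * t (s f)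
        + y ^ 2 * z * s (t f) - y * z ^ 2 * t (s (t f))) := by
    linear_combination (x - y) * (x - z) * (y - z) * a3 + x * (x - z) * (x - y) * a2
      - y * (y - z) * (x - y) * a2s + x * y * (x - z) * a1 - x * z * (x - y) * a1t
      + x * y * (y - z) * a1s + y * z * (x - y) * a1st
  have c2 : (y - z) * ((x - y) * (x - z) * (y - z) * l) =
      (y - z) * (x ^ 2 * y * f - x * y ^ 2 * s f - x ^ 2 * z * t f + x * z ^ 2 * t (s f)
        + y ^ 2 * z * s (t f) - y * z ^ 2 * t (s (t f))) := by
    linear_combination (y - z) * (x - y) * (x - z) * b3 + y * (x - z) * (y - z) * b2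
      - z * (x - y) * (y - z) * b2t + x * y * (x - z) * b1 - y ^ 2 * (y - z) * b1s
      + z * x * (x - y) * b1t + z ^ 2 * (y - z) * b1ts
  have d1 : x - y ≠ 0 := sub_ne_zero.2 hxy
  have d2 : y - z ≠ 0 := sub_ne_zero.2 hyz
  have d3 : x - z ≠ 0 := sub_ne_zero.2 hxz
  have c := (mul_left_cancel₀ d1 c1).trans (mul_left_cancel₀ d2 c2).symm
  exact mul_left_cancel₀ (mul_ne_zero (mul_ne_zero d1 d3) d2) c

/-! ### Laurent polynomials -/

/-- The ring `ℤ[x_1^{±1}, …, x_ℓ^{±1}]`: the group ring of the weight lattice `ℤ^ℓ`. -/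
abbrev Laurent (ℓ : ℕ) : Type := AddMonoidAlgebra ℤ (Fin ℓ → ℤ)

/-- The Laurent monomial `x^a`. -/
def mono {ℓ : ℕ} (a : Fin ℓ → ℤ) : Laurent ℓ := AddMonoidAlgebra.single a 1

/-- The variable `x_i` as a Laurent polynomial. -/
def xL {ℓ : ℕ} (i : Fin ℓ) : Laurent ℓ := mono (Pi.single i 1)

/-- Permutation of the variables `x_j ↦ x_{σ j}`; on monomials `x^a ↦ x^{a ∘ σ⁻¹}`. -/
def permL {ℓ : ℕ} (σ : Equiv.Perm (Fin ℓ)) : Laurent ℓ →+* Laurent ℓ :=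
  AddMonoidAlgebra.mapDomainRingHom ℤ
    ({ toFun := fun a => a ∘ σ.symm
       map_zero' := rfl
       map_add' := fun _ _ => rfl } : (Fin ℓ → ℤ) →+ (Fin ℓ → ℤ))

lemma permL_mono {ℓ : ℕ} (σ : Equiv.Perm (Fin ℓ)) (a : Fin ℓ → ℤ) :
    permL σ (mono a) = mono (a ∘ σ.symm) := by
  simp [permL, mono]

lemma permL_xL {ℓ : ℕ} (σ : Equiv.Perm (Fin ℓ)) (i : Fin ℓ) : permL σ (xL i) = xL (σ i) := by
  unfold xL
  rw [permL_mono]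
  congr 1
  funext k
  by_cases h : k = σ i
  · subst h; simp
  · have : σ.symm k ≠ i := fun e => h (by rw [← e]; simp)
    simp [Pi.single_eq_of_ne h, Pi.single_eq_of_ne this]

lemma permL_mul {ℓ : ℕ} (σ τ : Equiv.Perm (Fin ℓ)) (f : Laurent ℓ) :
    permL σ (permL τ f) = permL (σ * τ) f := by
  have : (permL σ).comp (permL τ) = permL (σ * τ) := by
    apply AddMonoidAlgebra.ringHom_ext
    · intro r
      simp [permL]
    · intro a
      change permL σ (permL τ (mono a)) = permL (σ * τ) (mono a)
      rw [permL_mono, permL_mono, permL_mono]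
      rfl
  exact congrArg (fun F : Laurent ℓ →+* Laurent ℓ => F f) this

lemma permL_one {ℓ : ℕ} (f : Laurent ℓ) : permL 1 f = f := by
  have : (permL (1 : Equiv.Perm (Fin ℓ))) = RingHom.id _ := by
    apply AddMonoidAlgebra.ringHom_ext
    · intro r
      simp [permL]
    · intro a
      change permL 1 (mono a) = mono a
      rw [permL_mono]
      rfl
  rw [this]
  rfl

lemma xL_injective {ℓ : ℕ} : Function.Injective (xL : Fin ℓ → Laurent ℓ) := by
  intro i j h
  have h1 := AddMonoidAlgebra.single_left_injective (one_ne_zero (α := ℤ)) h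
  by_contra hne
  have := congrFun h1 i
  simp [Pi.single_eq_of_ne hne] at this

lemma mono_add {ℓ : ℕ} (a b : Fin ℓ → ℤ) : mono (a + b) = mono a * mono b := by
  simp [mono, AddMonoidAlgebra.single_mul_single]

lemma dvd_sub_swap {ℓ : ℕ} (i j : Fin ℓ) (f : Laurent ℓ) :
    xL i - xL j ∣ f - permL (Equiv.swap i j) f := by
  let I : Ideal (Laurent ℓ) := Ideal.span {xL i - xL j}
  let q := Ideal.Quotient.mk I
  have hx : ∀ k, q (xL (Equiv.swap i j k)) = q (xL k) := by
    have hij : q (xL i) = q (xL j) :=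
      Ideal.Quotient.eq.2 (Ideal.subset_span (Set.mem_singleton _))
    intro k
    by_cases h1 : k = i
    · subst h1; simp [hij]
    · by_cases h2 : k = j
      · subst h2; simp [hij]
      · rw [Equiv.swap_apply_of_ne_of_ne h1 h2]
  have hadd : ∀ a b : Fin ℓ → ℤ, q (mono a) = q (permL (Equiv.swap i j) (mono a)) →
      q (mono b) = q (permL (Equiv.swap i j) (mono b)) →
      q (mono (a + b)) = q (permL (Equiv.swap i j) (mono (a + b))) := by
    intro a b ha hb
    rw [mono_add, map_mul, map_mul, map_mul, ha, hb]
  have hneg : ∀ a : Fin ℓ → ℤ, q (mono a) = q (permL (Equiv.swap i j) (mono a)) →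
      q (mono (-a)) = q (permL (Equiv.swap i j) (mono (-a))) := by
    intro a ha
    have e : mono a * mono (-a) = (1 : Laurent ℓ) := by
      rw [← mono_add, add_neg_cancel]; rfl
    have e1 : q (mono a) * q (mono (-a)) = 1 := by rw [← map_mul, e, map_one]
    have e2 : q (mono a) * q (permL (Equiv.swap i j) (mono (-a))) = 1 := by
      rw [ha, ← map_mul, ← map_mul, e, map_one, map_one]
    calc q (mono (-a)) = q (mono (-a)) *
          (q (mono a) * q (permL (Equiv.swap i j) (mono (-a)))) := by rw [e2, mul_one]
      _ = (q (mono a) * q (mono (-a))) * q (permL (Equiv.swap i j) (mono (-a))) := by ring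
      _ = _ := by rw [e1, one_mul]
  have hzero : q (mono 0) = q (permL (Equiv.swap i j) (mono 0)) := by
    rw [permL_mono]; rfl
  have hone : ∀ k, q (mono (Pi.single k 1)) = q (permL (Equiv.swap i j) (mono (Pi.single k 1))) := by
    intro k
    have := permL_xL (Equiv.swap i j) k
    change q (xL k) = q (permL (Equiv.swap i j) (xL k))
    rw [this, hx]
  let S : AddSubgroup (Fin ℓ → ℤ) :=
    { carrier := {a | q (mono a) = q (permL (Equiv.swap i j) (mono a))}
      add_mem' := fun {a b} ha hb => hadd a b ha hb
      zero_mem' := hzero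
      neg_mem' := fun {a} ha => hneg a ha }
  have hS : ∀ a, a ∈ S := by
    intro a
    have ha : a = ∑ k, a k • (Pi.single k (1 : ℤ) : Fin ℓ → ℤ) := by
      funext m
      simp [Finset.sum_apply, Pi.single_apply]
    rw [ha]
    exact S.sum_mem fun k _ => S.zsmul_mem (hone k) _
  have key : q = q.comp (permL (Equiv.swap i j)) := by
    apply AddMonoidAlgebra.ringHom_ext
    · intro r
      simp [permL]
    · intro a
      exact hS a
  have := congrArg (fun F : Laurent ℓ →+* _ => F f) key
  exact Ideal.mem_span_singleton.1 (Ideal.Quotient.eq.1 this)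

/-- The Demazure operator `π_i` on Laurent polynomials. -/
def demazureL {ℓ : ℕ} (i : Fin (ℓ - 1)) (f : Laurent ℓ) : Laurent ℓ :=
  demazureOp (permL (Equiv.swap (lo i) (hi i))) (xL (lo i)) (xL (hi i)) f

/-- The Demazure operators `π_w`, for `w` in the 0-Hecke monoid, on Laurent polynomials. -/
def demazureW (ℓ : ℕ) : ZeroHecke ℓ →* Function.End (Laurent ℓ) :=
  zeroHeckeLift (M := Function.End (Laurent ℓ)) (fun i => demazureL i)
    (by
      intro i
      funext f
      exact demazureOp_idem (fun f => by rw [permL_mul, Equiv.swap_mul_self, permL_one])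
        (by rw [permL_xL, Equiv.swap_apply_left]) (by rw [permL_xL, Equiv.swap_apply_right])
        (xL_injective.ne (lo_ne_hi i)) (dvd_sub_swap _ _) f)
    (by
      intro i j h
      funext f
      have e : lo j = hi i := by simp [lo, hi, h]
      have n1 : lo i ≠ hi i := lo_ne_hi i
      have n2 : hi i ≠ hi j := by rw [← e]; exact lo_ne_hi j
      have n3 : lo i ≠ hi j := by
        simp only [lo, hi, ne_eq, Fin.ext_iff]; omega
      change demazureL i (demazureL j (demazureL i f)) = demazureL j (demazureL i (demazureL j f))
      unfold demazureL
      rw [e]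
      refine demazureOp_braid ?_ ?_ ?_ ?_ ?_ ?_ ?_ (xL_injective.ne n1) (xL_injective.ne n2)
        (xL_injective.ne n3) (dvd_sub_swap _ _) (dvd_sub_swap _ _) ?_ ?_ f
      · intro f
        rw [permL_mul, permL_mul, permL_mul, permL_mul]
        congr 2
        ext k
        simp only [Equiv.Perm.mul_apply, Equiv.swap_apply_def]
        grind
      · rw [permL_xL, Equiv.swap_apply_left]
      · rw [permL_xL, Equiv.swap_apply_right]
      · rw [permL_xL, Equiv.swap_apply_of_ne_of_ne n3.symm n2.symm]
      · rw [permL_xL, Equiv.swap_apply_of_ne_of_ne n1 n3]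
      · rw [permL_xL, Equiv.swap_apply_left]
      · rw [permL_xL, Equiv.swap_apply_right]
      · intro f; rw [permL_mul, Equiv.swap_mul_self, permL_one]
      · intro f; rw [permL_mul, Equiv.swap_mul_self, permL_one])
    (by
      intro i j h
      funext f
      have n1 : lo i ≠ lo j := by simp only [lo, ne_eq, Fin.ext_iff]; omega
      have n2 : lo i ≠ hi j := by simp only [lo, hi, ne_eq, Fin.ext_iff]; omega
      have n3 : hi i ≠ lo j := by simp only [lo, hi, ne_eq, Fin.ext_iff]; omega
      have n4 : hi i ≠ hi j := by simp only [hi, ne_eq, Fin.ext_iff]; omega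
      refine demazureOp_comm ?_ ?_ ?_ ?_ ?_ (xL_injective.ne (lo_ne_hi i))
        (xL_injective.ne (lo_ne_hi j)) (dvd_sub_swap _ _) (dvd_sub_swap _ _) f
      · intro f
        rw [permL_mul, permL_mul]
        congr 2
        ext k
        simp only [Equiv.Perm.mul_apply, Equiv.swap_apply_def]
        grind
      · rw [permL_xL, Equiv.swap_apply_of_ne_of_ne n1.symm n3.symm]
      · rw [permL_xL, Equiv.swap_apply_of_ne_of_ne n2.symm n4.symm]
      · rw [permL_xL, Equiv.swap_apply_of_ne_of_ne n1 n2]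
      · rw [permL_xL, Equiv.swap_apply_of_ne_of_ne n3 n4])

/-! ### Key polynomials and polynomial truncation -/

/-- The key polynomial `κ_α = π_z x^{α⁺}`, with `z` shortest such that `z · α⁺ = α`. -/
def key {ℓ : ℕ} (α : Fin ℓ → ℤ) : Laurent ℓ := demazureW ℓ (shortestTo α) (mono (dec α))

/-- `T` is the identity on the key polynomials `κ_α` with `α ≥ 0` and kills the other ones. -/
def IsPolyTruncation {ℓ : ℕ} (T : Laurent ℓ →ₗ[ℤ] Laurent ℓ) : Prop :=
  (∀ α : Fin ℓ → ℤ, 0 ≤ α → T (key α) = key α) ∧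
    ∀ α : Fin ℓ → ℤ, ¬ 0 ≤ α → T (key α) = 0

/-- Polynomial truncation: the linear operator determined by its values on the basis of `Laurent ℓ`
formed by the key polynomials. -/
def poly (ℓ : ℕ) : Laurent ℓ →ₗ[ℤ] Laurent ℓ := Classical.epsilon IsPolyTruncation

/-! ### Root ideals and nonsymmetric Catalan functions -/

/-- A root ideal: an upper order ideal of the poset of pairs `i < j`, where
`(a, b) ≤ (c, d)` when `a ≥ c` and `b ≤ d`. -/
structure RootIdeal (ℓ : ℕ) where
  /-- The underlying set of pairs. -/
  roots : Finset (Fin ℓ × Fin ℓ)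
  lt_of_mem : ∀ p ∈ roots, p.1 < p.2
  upper : ∀ p ∈ roots, ∀ p' : Fin ℓ × Fin ℓ, p'.1 ≤ p.1 → p.2 ≤ p'.2 → p' ∈ roots

/-- `nr(Ψ)_i`, the number of `j ≥ i` such that `(i, j)` is not in `Ψ`. -/
def nr {ℓ : ℕ} (Ψ : RootIdeal ℓ) (i : Fin ℓ) : ℕ :=
  (Finset.univ.filter fun j : Fin ℓ => i ≤ j ∧ (i, j) ∉ Ψ.roots).card

/-- A labeled root ideal `(Ψ, γ, w)` is tame if the right descent set of `w` contains
`nr(Ψ)_1 + 1, …, ℓ - 1` (in 1-based numbering). -/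
def IsTame {ℓ : ℕ} (Ψ : RootIdeal ℓ) (w : ZeroHecke ℓ) : Prop :=
  ∀ i : Fin (ℓ - 1), nr Ψ ⟨0, by have := i.2; omega⟩ + 1 ≤ i.1 + 1 → w * gen i = w

/-- The series `∏_{(i,j) ∈ Ψ} (1 - q x_i / x_j)⁻¹ x^γ` in `ℤ[x^{±1}][[q]]`. -/
def catalanSeries {ℓ : ℕ} (Ψ : RootIdeal ℓ) (γ : Fin ℓ → ℤ) : PowerSeries (Laurent ℓ) :=
  (∏ p ∈ Ψ.roots, PowerSeries.invOfUnit
    (1 - PowerSeries.X * PowerSeries.C (mono (Pi.single p.1 1 - Pi.single p.2 1))) 1) *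
  PowerSeries.C (mono γ)

/-- The nonsymmetric Catalan function `H(Ψ; γ; w)`, as a power series in `q` with Laurent
polynomial coefficients; truncation and Demazure operators act on each coefficient. -/
def catalan {ℓ : ℕ} (Ψ : RootIdeal ℓ) (γ : Fin ℓ → ℤ) (w : ZeroHecke ℓ) :
    PowerSeries (Laurent ℓ) :=
  PowerSeries.mk fun d => demazureW ℓ w (poly ℓ (PowerSeries.coeff d (catalanSeries Ψ γ)))

/-! ### The root ideals `Δ'_ℓ(η)` -/

/-- The sequence
`(η₁)^{η₂}, η₁, η₁-1, …, η₂+1, (η₂)^{η₃}, η₂, …, η₃+1, …, η_k, η_k-1, …, 2`. -/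
def nrSeq : List ℕ → List ℕ
  | [] => []
  | [a] => (List.range (a - 1)).map fun t => a - t
  | a :: b :: l => List.replicate b a ++ (List.range (a - b)).map (fun t => a - t) ++ nrSeq (b :: l)

/-- Beyond its end, `nrSeq η` is continued by `1`. -/
def nrEntry (η : List ℕ) (i : ℕ) : ℕ := (nrSeq η).getD i 1

lemma getD_cons_good {x : ℕ} {l : List ℕ} (hx : x ≤ l.getD 0 1 + 1)
    (hl : ∀ i, l.getD i 1 ≤ l.getD (i + 1) 1 + 1) :
    ∀ i, (x :: l).getD i 1 ≤ (x :: l).getD (i + 1) 1 + 1 := by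
  intro i
  cases i with
  | zero => simpa using hx
  | succ i => simpa using hl i

lemma desc_good {b : ℕ} {l : List ℕ} (hb : b ≤ l.getD 0 1)
    (hl : ∀ i, l.getD i 1 ≤ l.getD (i + 1) 1 + 1) (n : ℕ) :
    (∀ i, ((List.range n).map (fun t => b + n - t) ++ l).getD i 1 ≤
      ((List.range n).map (fun t => b + n - t) ++ l).getD (i + 1) 1 + 1) ∧
    b + n ≤ ((List.range n).map (fun t => b + n - t) ++ l).getD 0 1 := by
  induction n with
  | zero => simpa using ⟨hl, hb⟩
  | succ n ih =>
    have e : (List.range (n + 1)).map (fun t => b + (n + 1) - t) ++ l =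
        (b + (n + 1)) :: ((List.range n).map (fun t => b + n - t) ++ l) := by
      rw [List.range_succ_eq_map]
      simp only [List.map_cons, List.map_map, List.cons_append, Nat.sub_zero, List.cons.injEq,
        true_and]
      congr 1
      apply List.map_congr_left
      intro t _
      simp only [Function.comp_apply]
      omega
    rw [e]
    refine ⟨getD_cons_good ?_ ih.1, by simp⟩
    have := ih.2
    omega

lemma replicate_good {a : ℕ} {l : List ℕ} (ha : a ≤ l.getD 0 1)
    (hl : ∀ i, l.getD i 1 ≤ l.getD (i + 1) 1 + 1) (n : ℕ) :
    (∀ i, (List.replicate n a ++ l).getD i 1 ≤ (List.replicate n a ++ l).getD (i + 1) 1 + 1) ∧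
    a ≤ (List.replicate n a ++ l).getD 0 1 := by
  induction n with
  | zero => simpa using ⟨hl, ha⟩
  | succ n ih =>
    rw [List.replicate_succ, List.cons_append]
    exact ⟨getD_cons_good (by have := ih.2; omega) ih.1, by simp⟩

lemma nrSeq_good (a : ℕ) (l : List ℕ) :
    (∀ i, (nrSeq (a :: l)).getD i 1 ≤ (nrSeq (a :: l)).getD (i + 1) 1 + 1) ∧
      a ≤ (nrSeq (a :: l)).getD 0 1 := by
  induction l generalizing a with
  | nil =>
    cases a with
    | zero => simp [nrSeq]
    | succ n =>
      have := desc_good (b := 1) (l := []) (by simp) (by simp) n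
      simpa [nrSeq, Nat.add_comm] using this
  | cons b l ih =>
    obtain ⟨h1, h2⟩ := ih b
    have h3 : (∀ i, ((List.range (a - b)).map (fun t => a - t) ++ nrSeq (b :: l)).getD i 1 ≤
        ((List.range (a - b)).map (fun t => a - t) ++ nrSeq (b :: l)).getD (i + 1) 1 + 1) ∧
        a ≤ ((List.range (a - b)).map (fun t => a - t) ++ nrSeq (b :: l)).getD 0 1 := by
      rcases le_total b a with h | h
      · obtain ⟨n, rfl⟩ := Nat.exists_eq_add_of_le h
        simpa using desc_good h2 h1 n
      · rw [Nat.sub_eq_zero_of_le h]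
        simpa using ⟨h1, h.trans h2⟩
    have := replicate_good h3.2 h3.1 b
    simpa [nrSeq] using this

lemma nrEntry_mono (η : List ℕ) : Monotone fun i => i + nrEntry η i := by
  apply monotone_nat_of_le_succ
  intro i
  cases η with
  | nil => simp [nrEntry, nrSeq]
  | cons a l =>
    have := (nrSeq_good a l).1 i
    simp only [nrEntry]
    omega

/-- For a partition `η` of `m ≤ ℓ`, the root ideal `Δ'_ℓ(η)`: in 0-based numbering, the pairs
`i < j` with `j ≥ m`, and the pairs `i < j < m` with `j ≥ i + n_i`, where `n = nrSeq η`. -/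
def deltaPrime (ℓ : ℕ) (η : List ℕ) : RootIdeal ℓ where
  roots := Finset.univ.filter fun p : Fin ℓ × Fin ℓ =>
    p.1 < p.2 ∧ (η.sum ≤ p.2.1 ∨ p.1.1 + nrEntry η p.1.1 ≤ p.2.1)
  lt_of_mem := by
    intro p hp
    exact (Finset.mem_filter.1 hp).2.1
  upper := by
    intro p hp p' h1 h2
    obtain ⟨-, h3, h4⟩ := Finset.mem_filter.1 hp
    refine Finset.mem_filter.2 ⟨Finset.mem_univ _, (h1.trans_lt h3).trans_le h2, ?_⟩
    have h2' : p.2.1 ≤ p'.2.1 := h2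
    rcases h4 with h4 | h4
    · exact Or.inl (h4.trans h2')
    · exact Or.inr (((nrEntry_mono η h1).trans h4).trans h2')

/-- The conjugate `(α⁺)'` of the partition `α⁺`, as the list of its nonzero parts. -/
def conj {ℓ : ℕ} (α : Fin ℓ → ℕ) : List ℕ :=
  (List.range (Finset.univ.sup (dec α))).map fun j =>
    (Finset.univ.filter fun i : Fin ℓ => j < dec α i).card

/-! ### The renormalized nonsymmetric Macdonald polynomials at `t = 0` -/

/-- The ring `ℤ[q][x_1, …, x_ℓ]`. -/
abbrev PolyRing (ℓ : ℕ) : Type := MvPolynomial (Fin ℓ) (Polynomial ℤ)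

/-- The Demazure operator `π_i` on `ℤ[q][x]`. -/
def demazureP {ℓ : ℕ} (i : Fin (ℓ - 1)) (f : PolyRing ℓ) : PolyRing ℓ :=
  demazureOp (MvPolynomial.rename (Equiv.swap (lo i) (hi i))).toRingHom
    (MvPolynomial.X (lo i)) (MvPolynomial.X (hi i)) f

/-- The `ℤ[q]`-algebra endomorphism `Φ`: `x_i ↦ x_{i+1}` for `i < ℓ` and `x_ℓ ↦ q x_1`. -/
def Phi (ℓ : ℕ) : PolyRing ℓ →ₐ[Polynomial ℤ] PolyRing ℓ :=
  MvPolynomial.aeval fun i : Fin ℓ =>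
    if h : i.1 + 1 < ℓ then MvPolynomial.X ⟨i.1 + 1, h⟩
    else MvPolynomial.C Polynomial.X * MvPolynomial.X ⟨0, by have := i.2; omega⟩

/-- `(α_1, …, α_ℓ) ↦ (α_ℓ + 1, α_1, …, α_{ℓ-1})`. -/
def rotate {ℓ : ℕ} (α : Fin ℓ → ℕ) : Fin ℓ → ℕ := fun i =>
  if i.1 = 0 then α ⟨ℓ - 1, by have := i.2; omega⟩ + 1 else α ⟨i.1 - 1, by have := i.2; omega⟩

/-- `(α_1, …, α_ℓ) ↦ (α_2, …, α_ℓ, α_1 - 1)`, the inverse of `rotate` on tuples with `α_1 > 0`. -/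
def unrotate {ℓ : ℕ} (α : Fin ℓ → ℕ) : Fin ℓ → ℕ := fun i =>
  if h : i.1 + 1 < ℓ then α ⟨i.1 + 1, h⟩ else α ⟨0, by have := i.2; omega⟩ - 1

lemma sum_unrotate_lt {ℓ : ℕ} {α : Fin ℓ → ℕ} (h : 0 < ℓ) (h0 : α ⟨0, h⟩ ≠ 0) :
    ∑ k, unrotate α k < ∑ k, α k := by
  obtain ⟨n, rfl⟩ : ∃ n, ℓ = n + 1 := ⟨ℓ - 1, by omega⟩
  rw [Fin.sum_univ_castSucc, Fin.sum_univ_succ α]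
  have e1 : ∀ i : Fin n, unrotate α i.castSucc = α i.succ := by
    intro i
    have := i.2
    simp [unrotate, Fin.succ]
  have e2 : unrotate α (Fin.last n) = α 0 - 1 := by
    simp [unrotate]
  have h0' : α 0 ≠ 0 := h0
  rw [Finset.sum_congr rfl fun i _ => e1 i, e2]
  omega

lemma sum_swap {ℓ : ℕ} (α : Fin ℓ → ℕ) (i j : Fin ℓ) :
    ∑ k, (α ∘ Equiv.swap i j) k = ∑ k, α k :=
  Equiv.sum_comp (Equiv.swap i j) α

lemma weightedSum_swap_lt {ℓ : ℕ} (α : Fin ℓ → ℕ) (i : Fin (ℓ - 1)) (h1 : α (lo i) = 0)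
    (h2 : α (hi i) ≠ 0) :
    ∑ k : Fin ℓ, k.1 * (α ∘ Equiv.swap (lo i) (hi i)) k < ∑ k : Fin ℓ, k.1 * α k := by
  have e : ∑ k : Fin ℓ, k.1 * (α ∘ Equiv.swap (lo i) (hi i)) k =
      ∑ k : Fin ℓ, (Equiv.swap (lo i) (hi i) k).1 * α k := by
    rw [← Equiv.sum_comp (Equiv.swap (lo i) (hi i))]
    simp
  rw [e]
  apply Finset.sum_lt_sum
  · intro k _
    by_cases hl : k = lo i
    · subst hl; simp [h1]
    · by_cases hh : k = hi i
      · subst hh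
        rw [Equiv.swap_apply_right]
        exact Nat.mul_le_mul_right _ (by simp [lo, hi])
      · rw [Equiv.swap_apply_of_ne_of_ne hl hh]
  · refine ⟨hi i, Finset.mem_univ _, ?_⟩
    rw [Equiv.swap_apply_right]
    exact Nat.mul_lt_mul_of_pos_right (by simp [lo, hi]) (Nat.pos_of_ne_zero h2)

/-- The `t = 0` Knop-Sahi recurrence, in renormalized form, for a family of polynomials indexed by
weak compositions. -/
structure KnopSahi (ℓ : ℕ) (E : (Fin ℓ → ℕ) → PolyRing ℓ) : Prop where
  zero : E 0 = 1
  step : ∀ (i : Fin (ℓ - 1)) (α : Fin ℓ → ℕ), E (heckeStep i α) = demazureP i (E α)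
  rot : ∀ (h : 0 < ℓ) (α : Fin ℓ → ℕ), E (rotate α) = MvPolynomial.X ⟨0, h⟩ * Phi ℓ (E α)

open Classical in
/-- The renormalized `t = 0` nonsymmetric Macdonald polynomial `Ẽ_α`, computed by the Knop-Sahi
recurrence: rotate if `α_1 > 0`, else move the first nonzero entry one step to the left. -/
def macdonaldE {ℓ : ℕ} (α : Fin ℓ → ℕ) : PolyRing ℓ :=
  if h : ∃ h : 0 < ℓ, α ⟨0, h⟩ ≠ 0 then
    MvPolynomial.X ⟨0, h.1⟩ * Phi ℓ (macdonaldE (unrotate α))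
  else if h : ∃ i : Fin (ℓ - 1), (∀ k ≤ lo i, α k = 0) ∧ α (hi i) ≠ 0 then
    demazureP h.choose (macdonaldE (α ∘ Equiv.swap (lo h.choose) (hi h.choose)))
  else 1
termination_by (∑ k, α k, ∑ k : Fin ℓ, k.1 * α k)
decreasing_by
  · exact Prod.Lex.left _ _ (sum_unrotate_lt h.1 h.2)
  · have h1 := h.choose_spec.1 _ le_rfl
    have h2 := h.choose_spec.2
    rw [sum_swap]
    exact Prod.Lex.right _ (weightedSum_swap_lt _ _ h1 h2)

/-! ### Comparison of the rings, specialization, weights -/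

/-- The inclusion `ℤ[q][x_1, …, x_ℓ] → ℤ[x^{±1}][[q]]`. -/
def toSeries (ℓ : ℕ) : PolyRing ℓ →+* PowerSeries (Laurent ℓ) :=
  MvPolynomial.eval₂Hom
    (Polynomial.eval₂RingHom (Int.castRingHom (PowerSeries (Laurent ℓ))) PowerSeries.X)
    fun i => PowerSeries.C (xL i)

/-- The specialization `x_{ℓ+1} = ⋯ = x_m = 0` from `m` variables to `ℓ` variables. -/
def specialize (m ℓ : ℕ) : PolyRing m →ₐ[Polynomial ℤ] PolyRing ℓ :=
  MvPolynomial.aeval fun j : Fin m => if h : j.1 < ℓ then MvPolynomial.X ⟨j.1, h⟩ else 0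

/-- The weight `1^m 0^{n-m}` of length `n` (for `m ≤ n`). -/
def onesZeros (n m : ℕ) : Fin n → ℤ := fun i => if i.1 < m then 1 else 0

/-- The tuple `(α, 0^{n-ℓ})` of length `n` (for `ℓ ≤ n`). -/
def padZeros {ℓ : ℕ} (n : ℕ) (α : Fin ℓ → ℕ) : Fin n → ℕ := fun j =>
  if h : j.1 < ℓ then α ⟨j.1, h⟩ else 0

end

end NSMacdonald

/-!
Modulo the kernel of polynomial truncation, removing a row from the root ideal of a Catalan function
is the rotation step of the Knop–Sahi recurrence. Iterating this peels the root ideal `Δ'_ℓ(η)` off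
row by row, and the exponent that remains to be identified is computed by a combinatorial recursion
whose value is the conjugate of `η`.

*The 0-Hecke monoid.* It acts faithfully on permutations, and bubble sort recovers an element from
its value on the decreasing tuple. Hence the elements carrying `α⁺` to `α` have a unique longest
one, the sorting element of the standardization of `α` (`isLongestTo_iff`). By maximality it
absorbs on the right every generator fixing `α⁺` (`IsLongestTo.mul_gen`), in particular those
exchanging two zeros of `α⁺`; this is tameness, since the first row of `Δ'_ℓ(η)` starts after the
number of nonzero entries of `α`.

*The recurrence.* Undoing rotations and steps that move the first nonzero entry to the front defines
a family, and this family satisfies the recurrence at every step, because the Demazure operators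
satisfy the 0-Hecke relations and are compatible with the rotation `x_1 Φ`
(`macdonaldE_heckeStep`). The same descent shows that the recurrence determines the family
(`KnopSahi.eq_macdonaldE`). In particular `Ẽ_{zα} = π_z Ẽ_α` for all `z` (`macdonaldE_heckeAct`).

*Truncation.* The key polynomials with nonnegative exponents are polynomials; the others lie in
`negPart`, the set of Laurent polynomials `f` such that every monomial of `f ∏_{i<j} (1 - x_i/x_j)`
has a negative exponent. The polynomials and `negPart` are complementary, so `poly` is the projection
onto the polynomials along `negPart` (`poly_eq_posProj`). The kernel `negPart` is stable under the
Demazure operators (`demazureL_mem_negPart`), so truncation commutes with them, and all identities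
can be checked modulo `negPart`.

*The rotation step.* The root ideals are described by staircases: row `i` starts at column `r i`.
Removing the first row and the first column of a staircase leaves, up to a rotation of the variables,
the next staircase without its last column; and the last column does not matter modulo `negPart`.
Symmetrization in the variables beyond the first row then turns the product over the first row into
the missing Demazure operators (`rotation_step`). Hence the symmetrized series of a staircase is
congruent to a symmetrized nonsymmetric Macdonald polynomial, whose exponent arises by alternately
applying the longest element of an interval of generators and a rotation (`stairSeries_congr`).

*Combinatorics.* For the row lengths of `Δ'(η)` this exponent is the conjugate of `η`
(`stairExp_nrEntry`), which is `α⁺` for `η = (α⁺)'` (`conjPart_conj`). Applying `π_z` with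
`z α⁺ = α` gives `Ẽ_α`. Finally, setting the additional variables to zero in the polynomials with
zeros added to the exponent produces a family satisfying the recurrence in `ℓ` variables, hence
the family itself (`specialize_macdonaldE`); this settles the case of more boxes than variables.
-/

namespace NSMacdonald

noncomputable section

/-! ### The 0-Hecke monoid and its action on tuples -/

section Hecke

variable {ℓ : ℕ}

lemma heckeAct_gen {T : Type*} [LinearOrder T] (i : Fin (ℓ - 1)) (α : Fin ℓ → T) :
    heckeAct ℓ T (gen i) α = heckeStep i α := rfl

lemma heckeAct_one {T : Type*} [LinearOrder T] (α : Fin ℓ → T) : heckeAct ℓ T 1 α = α := by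
  rw [map_one]; rfl

lemma heckeAct_mul {T : Type*} [LinearOrder T] (z w : ZeroHecke ℓ) (α : Fin ℓ → T) :
    heckeAct ℓ T (z * w) α = heckeAct ℓ T z (heckeAct ℓ T w α) := by
  rw [map_mul]; rfl

lemma gen_idem (i : Fin (ℓ - 1)) : gen i * gen i = gen i :=
  PresentedMonoid.mk_eq_mk_of_rel (ZeroHeckeRel.idem i)

lemma gen_braid (i j : Fin (ℓ - 1)) (h : i.1 + 1 = j.1) :
    gen i * gen j * gen i = gen j * gen i * gen j :=
  PresentedMonoid.mk_eq_mk_of_rel (ZeroHeckeRel.braid i j h)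

lemma gen_comm (i j : Fin (ℓ - 1)) (h : i.1 + 1 < j.1) : gen i * gen j = gen j * gen i :=
  PresentedMonoid.mk_eq_mk_of_rel (ZeroHeckeRel.comm i j h)

lemma exists_word (z : ZeroHecke ℓ) : ∃ u : List (Fin (ℓ - 1)), (u.map gen).prod = z := by
  obtain ⟨a, rfl⟩ := PresentedMonoid.surjective_mk z
  induction a with
  | one => exact ⟨[], rfl⟩
  | of x => exact ⟨[x], by simp [gen, PresentedMonoid.of]⟩
  | mul x y hx hy =>
    obtain ⟨u, hu⟩ := hx
    obtain ⟨v, hv⟩ := hy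
    exact ⟨u ++ v, by simp [hu, hv]⟩

lemma hecke_induction {P : ZeroHecke ℓ → Prop} (one : P 1)
    (gen_mul : ∀ i z, P z → P (gen i * z)) (z : ZeroHecke ℓ) : P z := by
  obtain ⟨u, rfl⟩ := exists_word z
  induction u with
  | nil => simpa using one
  | cons i u ih => simpa using gen_mul i _ ih

lemma heckeStep_of_lt {T : Type*} [LinearOrder T] {i : Fin (ℓ - 1)} {α : Fin ℓ → T}
    (h : α (hi i) < α (lo i)) : heckeStep i α = α ∘ Equiv.swap (lo i) (hi i) := if_pos h.le

lemma comp_swap_eq_self {T : Type*} {α : Fin ℓ → T} {a b : Fin ℓ} (h : α a = α b) :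
    α ∘ Equiv.swap a b = α := by
  funext k
  simp only [Function.comp_apply, Equiv.swap_apply_def]
  split_ifs with h1 h2
  · rw [h1, h]
  · rw [h2, h]
  · rfl

lemma heckeStep_of_le {T : Type*} [LinearOrder T] {i : Fin (ℓ - 1)} {α : Fin ℓ → T}
    (h : α (lo i) ≤ α (hi i)) : heckeStep i α = α := by
  unfold heckeStep
  split_ifs with h1
  · exact comp_swap_eq_self (le_antisymm h h1)
  · rfl

lemma heckeStep_comp_swap {T : Type*} [LinearOrder T] {i : Fin (ℓ - 1)} {α : Fin ℓ → T}
    (h : α (lo i) < α (hi i)) : heckeStep i (α ∘ Equiv.swap (lo i) (hi i)) = α := by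
  rw [heckeStep_of_lt (by simpa using h)]
  funext k
  simp

/-- Hecke steps replace adjacent entries by their minimum and maximum, so that they commute with
monotone relabelings of the entries. -/
lemma heckeStep_comp {T U : Type*} [LinearOrder T] [LinearOrder U] {f : T → U} (hf : Monotone f)
    (i : Fin (ℓ - 1)) (α : Fin ℓ → T) : heckeStep i (f ∘ α) = f ∘ heckeStep i α := by
  funext k
  simp only [heckeStep_apply, Function.comp_apply]
  split_ifs <;> simp [hf.map_min, hf.map_max]

lemma heckeAct_comp {T U : Type*} [LinearOrder T] [LinearOrder U] {f : T → U} (hf : Monotone f)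
    (z : ZeroHecke ℓ) (α : Fin ℓ → T) : heckeAct ℓ U z (f ∘ α) = f ∘ heckeAct ℓ T z α := by
  induction z using hecke_induction with
  | one => simp [heckeAct_one]
  | gen_mul i z ih => rw [heckeAct_mul, heckeAct_mul, ih, heckeAct_gen, heckeAct_gen,
      heckeStep_comp hf]

/-! ### Bubble sort and faithfulness -/

/-- The pairs of positions at which a tuple increases strictly. -/
def ascPairs {T : Type*} [LinearOrder T] (σ : Fin ℓ → T) : Finset (Fin ℓ × Fin ℓ) :=
  Finset.univ.filter fun p => p.1 < p.2 ∧ σ p.1 < σ p.2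

lemma mem_ascPairs {T : Type*} [LinearOrder T] {σ : Fin ℓ → T} {p : Fin ℓ × Fin ℓ} :
    p ∈ ascPairs σ ↔ p.1 < p.2 ∧ σ p.1 < σ p.2 := by
  simp [ascPairs]

lemma lo_lt_hi (i : Fin (ℓ - 1)) : lo i < hi i := by
  simp [lo, hi]

/-- An adjacent transposition keeps the order of every pair of positions but the exchanged one. -/
lemma swap_lt_swap {i : Fin (ℓ - 1)} {a b : Fin ℓ} (h : a < b) (hne : ¬ (a = lo i ∧ b = hi i)) :
    Equiv.swap (lo i) (hi i) a < Equiv.swap (lo i) (hi i) b := by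
  have e1 : (lo i).1 = i.1 := rfl
  have e2 : (hi i).1 = i.1 + 1 := rfl
  simp only [Equiv.swap_apply_def, Fin.ext_iff, Fin.lt_def] at *
  grind

lemma card_ascPairs_swap {T : Type*} [LinearOrder T] {i : Fin (ℓ - 1)} {σ : Fin ℓ → T}
    (h : σ (lo i) < σ (hi i)) :
    (ascPairs σ).card = (ascPairs (σ ∘ Equiv.swap (lo i) (hi i))).card + 1 := by
  have hmem : (lo i, hi i) ∈ ascPairs σ := mem_ascPairs.2 ⟨lo_lt_hi i, h⟩
  rw [← Finset.card_erase_add_one hmem]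
  congr 1
  let e := (Equiv.swap (lo i) (hi i)).prodCongr (Equiv.swap (lo i) (hi i))
  apply Finset.card_equiv e
  rintro ⟨a, b⟩
  simp only [Finset.mem_erase, mem_ascPairs, e, Equiv.prodCongr_apply, Prod.map, ne_eq,
    Prod.mk.injEq, Function.comp_apply, Equiv.swap_apply_self]
  constructor
  · rintro ⟨h1, h2, h3⟩
    exact ⟨swap_lt_swap h2 h1, h3⟩
  · rintro ⟨h1, h2⟩
    have h3 : ¬ (Equiv.swap (lo i) (hi i) a = lo i ∧ Equiv.swap (lo i) (hi i) b = hi i) := by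
      rintro ⟨h3, h4⟩
      rw [← Equiv.eq_symm_apply, Equiv.symm_swap, Equiv.swap_apply_left] at h3
      rw [← Equiv.eq_symm_apply, Equiv.symm_swap, Equiv.swap_apply_right] at h4
      subst h3 h4
      exact lt_asymm h h2
    have h4 := swap_lt_swap h1 h3
    rw [Equiv.swap_apply_self, Equiv.swap_apply_self] at h4
    refine ⟨?_, h4, h2⟩
    rintro ⟨rfl, rfl⟩
    simp only [Equiv.swap_apply_left, Equiv.swap_apply_right] at h1
    exact lt_asymm h1 (lo_lt_hi i)

open Classical in
/-- The element of the 0-Hecke monoid read off from sorting a tuple into weakly decreasing order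
by removing adjacent ascents one by one. -/
def bubble {T : Type*} [LinearOrder T] (σ : Fin ℓ → T) : ZeroHecke ℓ :=
  if h : ∃ i : Fin (ℓ - 1), σ (lo i) < σ (hi i) then
    gen h.choose * bubble (σ ∘ Equiv.swap (lo h.choose) (hi h.choose))
  else 1
termination_by (ascPairs σ).card
decreasing_by
  have := card_ascPairs_swap h.choose_spec
  omega

lemma bubble_of_antitone {T : Type*} [LinearOrder T] {σ : Fin ℓ → T} (h : Antitone σ) :
    bubble σ = 1 := by
  rw [bubble, dif_neg]
  rintro ⟨i, hi'⟩
  exact (h (lo_lt_hi i).le).not_gt hi'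

lemma antitone_of_step {T : Type*} [LinearOrder T] {σ : Fin ℓ → T}
    (h : ∀ i : Fin (ℓ - 1), σ (hi i) ≤ σ (lo i)) : Antitone σ := by
  rcases ℓ with _ | n
  · exact fun a => a.elim0
  · apply Fin.antitone_iff_succ_le.2
    intro i
    exact h i

/-- The sorting element does not depend on the ascent removed first. -/
lemma bubble_eq {T : Type*} [LinearOrder T] (σ : Fin ℓ → T) (i : Fin (ℓ - 1))
    (h : σ (lo i) < σ (hi i)) :
    bubble σ = gen i * bubble (σ ∘ Equiv.swap (lo i) (hi i)) := by
  induction hn : (ascPairs σ).card using Nat.strong_induction_on generalizing σ i with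
  | _ n ih =>
    subst hn
    have hex : ∃ j : Fin (ℓ - 1), σ (lo j) < σ (hi j) := ⟨i, h⟩
    obtain ⟨j, hj, e⟩ : ∃ j : Fin (ℓ - 1), σ (lo j) < σ (hi j) ∧
        bubble σ = gen j * bubble (σ ∘ Equiv.swap (lo j) (hi j)) :=
      ⟨hex.choose, hex.choose_spec, by rw [bubble, dif_pos hex]⟩
    have IH : ∀ k, σ (lo k) < σ (hi k) → ∀ i, (σ ∘ Equiv.swap (lo k) (hi k)) (lo i) <
        (σ ∘ Equiv.swap (lo k) (hi k)) (hi i) → bubble (σ ∘ Equiv.swap (lo k) (hi k)) =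
          gen i * bubble ((σ ∘ Equiv.swap (lo k) (hi k)) ∘ Equiv.swap (lo i) (hi i)) := by
      intro k hk i hi'
      exact ih _ (by have := card_ascPairs_swap hk; omega) _ i hi' rfl
    have IH2 : ∀ k, σ (lo k) < σ (hi k) → ∀ m, (σ ∘ Equiv.swap (lo k) (hi k)) (lo m) <
        (σ ∘ Equiv.swap (lo k) (hi k)) (hi m) → ∀ i,
        ((σ ∘ Equiv.swap (lo k) (hi k)) ∘ Equiv.swap (lo m) (hi m)) (lo i) <
        ((σ ∘ Equiv.swap (lo k) (hi k)) ∘ Equiv.swap (lo m) (hi m)) (hi i) →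
        bubble (σ ∘ Equiv.swap (lo k) (hi k)) =
          gen m * (gen i * bubble (((σ ∘ Equiv.swap (lo k) (hi k)) ∘
            Equiv.swap (lo m) (hi m)) ∘ Equiv.swap (lo i) (hi i))) := by
      intro k hk m hm i hi'
      rw [IH k hk m hm]
      congr 1
      refine ih _ ?_ _ i hi' rfl
      have := card_ascPairs_swap hk
      have := card_ascPairs_swap hm
      omega
    -- Two commuting ascents: the two orders of removal agree by the commutation relation.
    have far : ∀ i j : Fin (ℓ - 1), i.1 + 1 < j.1 → σ (lo i) < σ (hi i) → σ (lo j) < σ (hi j) →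
        gen j * bubble (σ ∘ Equiv.swap (lo j) (hi j)) =
        gen i * bubble (σ ∘ Equiv.swap (lo i) (hi i)) := by
      intro i j hij h hj
      have n1 : lo i ≠ lo j := by simp only [lo, ne_eq, Fin.ext_iff]; omega
      have n2 : lo i ≠ hi j := by simp only [lo, hi, ne_eq, Fin.ext_iff]; omega
      have n3 : hi i ≠ lo j := by simp only [lo, hi, ne_eq, Fin.ext_iff]; omega
      have n4 : hi i ≠ hi j := by simp only [hi, ne_eq, Fin.ext_iff]; omega
      rw [IH j hj i (by simpa [Equiv.swap_apply_of_ne_of_ne, n1, n2, n3, n4] using h),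
        IH i h j (by simpa [Equiv.swap_apply_of_ne_of_ne, n1.symm, n2.symm, n3.symm, n4.symm]
          using hj), ← mul_assoc, ← mul_assoc, gen_comm i j hij]
      congr 2
      funext k
      simp only [Function.comp_apply, Equiv.swap_apply_def]
      congr 1
      grind
    -- Two adjacent ascents: both orders of removal lead to the reversal of the three entries, in
    -- three steps each, and agree by the braid relation.
    have near : ∀ i j : Fin (ℓ - 1), i.1 + 1 = j.1 → σ (lo i) < σ (hi i) → σ (lo j) < σ (hi j) →
        gen j * bubble (σ ∘ Equiv.swap (lo j) (hi j)) =
        gen i * bubble (σ ∘ Equiv.swap (lo i) (hi i)) := by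
      intro i j hij h hj
      have e : lo j = hi i := by simp [lo, hi, hij]
      have n1 : lo i ≠ hi i := lo_ne_hi i
      have n2 : hi i ≠ hi j := by rw [← e]; exact lo_ne_hi j
      have n3 : lo i ≠ hi j := by simp only [lo, hi, ne_eq, Fin.ext_iff]; omega
      rw [e] at hj
      have hj' : σ (lo j) < σ (hi j) := by rwa [e]
      rw [IH2 j hj' i (by simpa [e, Equiv.swap_apply_of_ne_of_ne, n1, n3] using h.trans hj) j
          (by simpa [e, Equiv.swap_apply_of_ne_of_ne, n1, n2, n3, n1.symm, n2.symm, n3.symm]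
            using h),
        IH2 i h j (by simpa [e, Equiv.swap_apply_of_ne_of_ne, n2.symm, n3.symm] using h.trans hj) i
          (by simpa [e, Equiv.swap_apply_of_ne_of_ne, n1, n2, n3, n1.symm, n2.symm, n3.symm]
            using hj), ← mul_assoc, ← mul_assoc, ← mul_assoc, ← mul_assoc, gen_braid i j hij]
      congr 2
      funext k
      simp only [Function.comp_apply, Equiv.swap_apply_def, e]
      congr 1
      grind
    rw [e]
    rcases lt_trichotomy i.1 j.1 with hij | hij | hij
    · rcases Nat.lt_or_ge (i.1 + 1) j.1 with h1 | h1
      · exact far i j h1 h hj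
      · exact near i j (by omega) h hj
    · rw [Fin.ext hij]
    · rcases Nat.lt_or_ge (j.1 + 1) i.1 with h1 | h1
      · exact (far j i h1 hj h).symm
      · exact (near j i (by omega) hj h).symm

lemma gen_mul_bubble {T : Type*} [LinearOrder T] {σ : Fin ℓ → T} (hσ : Function.Injective σ)
    (i : Fin (ℓ - 1)) : gen i * bubble σ = bubble (heckeStep i σ) := by
  rcases lt_or_gt_of_ne (hσ.ne (lo_ne_hi i)) with h | h
  · rw [heckeStep_of_le h.le, bubble_eq σ i h, ← mul_assoc, gen_idem]
  · rw [heckeStep_of_lt h, bubble_eq (σ ∘ Equiv.swap (lo i) (hi i)) i (by simpa using h)]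
    congr 2
    funext k
    simp

lemma heckeStep_injective {T : Type*} [LinearOrder T] {σ : Fin ℓ → T}
    (hσ : Function.Injective σ) (i : Fin (ℓ - 1)) : Function.Injective (heckeStep i σ) := by
  unfold heckeStep
  split_ifs
  · exact hσ.comp (Equiv.injective _)
  · exact hσ

lemma heckeAct_injective {T : Type*} [LinearOrder T] {σ : Fin ℓ → T}
    (hσ : Function.Injective σ) (z : ZeroHecke ℓ) : Function.Injective (heckeAct ℓ T z σ) := by
  induction z using hecke_induction with
  | one => simpa [heckeAct_one] using hσ
  | gen_mul i z ih => rw [heckeAct_mul, heckeAct_gen]; exact heckeStep_injective ih i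

lemma bubble_heckeAct {T : Type*} [LinearOrder T] {σ : Fin ℓ → T} (hσ : Function.Injective σ)
    (z : ZeroHecke ℓ) : bubble (heckeAct ℓ T z σ) = z * bubble σ := by
  induction z using hecke_induction with
  | one => simp [heckeAct_one]
  | gen_mul i z ih =>
    rw [heckeAct_mul, heckeAct_gen, ← gen_mul_bubble (heckeAct_injective hσ z), ih, mul_assoc]

/-- The permutation attached to an element of the 0-Hecke monoid: its value at the decreasing
arrangement `ℓ - 1, …, 1, 0`. -/
def toPerm (z : ZeroHecke ℓ) : Fin ℓ → Fin ℓ := heckeAct ℓ (Fin ℓ) z Fin.rev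

lemma bubble_toPerm (z : ZeroHecke ℓ) : bubble (toPerm z) = z := by
  rw [toPerm, bubble_heckeAct Fin.rev_injective, bubble_of_antitone Fin.rev_anti, mul_one]

lemma toPerm_injective : Function.Injective (toPerm : ZeroHecke ℓ → _) := fun z w h => by
  rw [← bubble_toPerm z, h, bubble_toPerm]

lemma dec_comp_perm {T : Type*} [LinearOrder T] (α : Fin ℓ → T) (σ : Equiv.Perm (Fin ℓ)) :
    dec (α ∘ σ) = dec α := by
  have := Tuple.comp_perm_comp_sort_eq_comp_sort (f := α) (σ := σ)
  funext i
  exact congrFun this i.rev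

lemma dec_of_antitone {T : Type*} [LinearOrder T] {α : Fin ℓ → T} (h : Antitone α) :
    dec α = α := by
  have := (Tuple.comp_sort_eq_comp_iff_monotone (f := α) (σ := Fin.revPerm)).2
    (fun a b hab => h (Fin.rev_anti hab))
  funext i
  have := congrFun this i.rev
  simpa [dec] using this.symm

lemma dec_antitone {T : Type*} [LinearOrder T] (α : Fin ℓ → T) : Antitone (dec α) :=
  fun _ _ h => Tuple.monotone_sort α (Fin.rev_anti h)

lemma dec_heckeStep {T : Type*} [LinearOrder T] (i : Fin (ℓ - 1)) (α : Fin ℓ → T) :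
    dec (heckeStep i α) = dec α := by
  unfold heckeStep
  split_ifs
  · exact dec_comp_perm _ _
  · rfl

/-- The 0-Hecke monoid acts transitively on the rearrangements of a dominant weight. -/
lemma heckeAct_bubble {T : Type*} [LinearOrder T] (α : Fin ℓ → T) :
    heckeAct ℓ T (bubble α) (dec α) = α := by
  induction hn : (ascPairs α).card using Nat.strong_induction_on generalizing α with
  | _ n ih =>
    subst hn
    by_cases h : ∃ i : Fin (ℓ - 1), α (lo i) < α (hi i)
    · obtain ⟨i, h⟩ := h
      have := ih _ (by have := card_ascPairs_swap h; omega)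
        (α ∘ Equiv.swap (lo i) (hi i)) rfl
      rw [dec_comp_perm] at this
      rw [bubble_eq α i h, heckeAct_mul, this, heckeAct_gen, heckeStep_comp_swap h]
    · push Not at h
      have h' := antitone_of_step h
      rw [bubble_of_antitone h', dec_of_antitone h', heckeAct_one]

lemma perm_eq_refl_of_strictMono {σ : Fin ℓ → Fin ℓ} (h : StrictMono σ) : σ = id :=
  h.range_inj strictMono_id |>.1 (by
    rw [Set.range_id, (Finite.surjective_of_injective h.injective).range_eq])

lemma dec_of_injective {σ : Fin ℓ → Fin ℓ} (h : Function.Injective σ) : dec σ = Fin.rev := by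
  have h1 : StrictMono (σ ∘ Tuple.sort σ) :=
    (Tuple.monotone_sort σ).strictMono_of_injective (h.comp (Equiv.injective _))
  have h2 := perm_eq_refl_of_strictMono h1
  funext i
  exact congrFun h2 i.rev

lemma toPerm_bubble {σ : Fin ℓ → Fin ℓ} (h : Function.Injective σ) : toPerm (bubble σ) = σ := by
  rw [toPerm, ← dec_of_injective h, heckeAct_bubble]

/-! ### Lengths -/

lemma card_ascPairs_heckeStep_le {T : Type*} [LinearOrder T] (i : Fin (ℓ - 1)) (σ : Fin ℓ → T) :
    (ascPairs (heckeStep i σ)).card ≤ (ascPairs σ).card + 1 ∧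
      (ascPairs σ).card ≤ (ascPairs (heckeStep i σ)).card := by
  rcases le_or_gt (σ (lo i)) (σ (hi i)) with h | h
  · rw [heckeStep_of_le h]; omega
  · rw [heckeStep_of_lt h]
    have := card_ascPairs_swap (σ := σ ∘ Equiv.swap (lo i) (hi i)) (i := i) (by simpa using h)
    have e : (σ ∘ Equiv.swap (lo i) (hi i)) ∘ Equiv.swap (lo i) (hi i) = σ := by funext k; simp
    rw [e] at this
    omega

lemma exists_word_bubble {T : Type*} [LinearOrder T] (σ : Fin ℓ → T) :
    ∃ u : List (Fin (ℓ - 1)), u.length = (ascPairs σ).card ∧ (u.map gen).prod = bubble σ := by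
  induction hn : (ascPairs σ).card using Nat.strong_induction_on generalizing σ with
  | _ n ih =>
    subst hn
    by_cases h : ∃ i : Fin (ℓ - 1), σ (lo i) < σ (hi i)
    · obtain ⟨i, h⟩ := h
      have hc := card_ascPairs_swap h
      obtain ⟨u, hu, hu'⟩ := ih _ (by omega) (σ ∘ Equiv.swap (lo i) (hi i)) rfl
      exact ⟨i :: u, by simp [hu, hc], by simp [hu', bubble_eq σ i h]⟩
    · push Not at h
      have h' := antitone_of_step h
      refine ⟨[], ?_, by simp [bubble_of_antitone h']⟩
      symm
      simp only [List.length_nil, Finset.card_eq_zero, Finset.eq_empty_iff_forall_notMem,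
        mem_ascPairs, not_and, not_lt]
      exact fun p hp => h' hp.le

lemma len_eq (z : ZeroHecke ℓ) : len z = (ascPairs (toPerm z)).card := by
  apply le_antisymm
  · obtain ⟨u, hu, hu'⟩ := exists_word_bubble (toPerm z)
    exact Nat.sInf_le ⟨u, hu, by rw [hu', bubble_toPerm]⟩
  · obtain ⟨v, hv⟩ := exists_word z
    unfold len
    refine le_csInf ⟨v.length, v, rfl, hv⟩ ?_
    rintro n ⟨u, rfl, rfl⟩
    clear hv
    induction u with
    | nil =>
      simp only [List.map_nil, List.prod_nil, List.length_nil, nonpos_iff_eq_zero,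
        Finset.card_eq_zero, Finset.eq_empty_iff_forall_notMem, mem_ascPairs, toPerm,
        heckeAct_one, not_and, not_lt]
      exact fun p hp => Fin.rev_anti hp.le
    | cons i u ih =>
      simp only [List.map_cons, List.prod_cons, List.length_cons]
      rw [toPerm, heckeAct_mul, heckeAct_gen]
      exact (card_ascPairs_heckeStep_le _ _).1.trans (by simpa [toPerm] using ih)

lemma len_le_gen_mul (i : Fin (ℓ - 1)) (z : ZeroHecke ℓ) : len z ≤ len (gen i * z) := by
  rw [len_eq, len_eq, toPerm, toPerm, heckeAct_mul, heckeAct_gen]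
  exact (card_ascPairs_heckeStep_le _ _).2

/-- The anti-automorphism of the 0-Hecke monoid fixing the generators. -/
def reverse : ZeroHecke ℓ →* (ZeroHecke ℓ)ᵐᵒᵖ :=
  zeroHeckeLift (fun i => MulOpposite.op (gen i))
    (fun i => by rw [← MulOpposite.op_mul, gen_idem])
    (fun i j h => by
      simp only [← MulOpposite.op_mul, ← mul_assoc]
      rw [gen_braid i j h])
    (fun i j h => by
      simp only [← MulOpposite.op_mul]
      rw [gen_comm i j h])

lemma reverse_gen (i : Fin (ℓ - 1)) : reverse (gen i) = MulOpposite.op (gen i) := rfl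

lemma reverse_mul (z w : ZeroHecke ℓ) :
    (reverse (z * w)).unop = (reverse w).unop * (reverse z).unop := by simp

lemma reverse_word (u : List (Fin (ℓ - 1))) :
    (reverse (u.map gen).prod).unop = (u.reverse.map gen).prod := by
  induction u with
  | nil => simp
  | cons i u ih =>
    rw [List.map_cons, List.prod_cons, reverse_mul, ih, reverse_gen]
    simp

lemma reverse_reverse (z : ZeroHecke ℓ) : (reverse (reverse z).unop).unop = z := by
  obtain ⟨u, rfl⟩ := exists_word z
  rw [reverse_word, reverse_word, List.reverse_reverse]

lemma len_reverse (z : ZeroHecke ℓ) : len (reverse z).unop = len z := by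
  unfold len
  congr 1
  ext n
  constructor
  · rintro ⟨u, h1, h2⟩
    refine ⟨u.reverse, by simpa using h1, ?_⟩
    rw [← reverse_word, h2, reverse_reverse]
  · rintro ⟨u, h1, rfl⟩
    exact ⟨u.reverse, by simpa using h1, (reverse_word u).symm⟩

lemma len_le_mul_gen (z : ZeroHecke ℓ) (i : Fin (ℓ - 1)) : len z ≤ len (z * gen i) := by
  rw [← len_reverse z, ← len_reverse (z * gen i), reverse_mul, reverse_gen]
  exact len_le_gen_mul _ _

/-! ### Standardization and longest elements -/

/-- The standardization of a tuple: ranks of its entries, ties being ranked from left to right. -/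
def std {T : Type*} [LinearOrder T] (α : Fin ℓ → T) : Fin ℓ → Fin ℓ := (Tuple.sort α).symm

lemma std_injective {T : Type*} [LinearOrder T] (α : Fin ℓ → T) : Function.Injective (std α) :=
  Equiv.injective _

lemma sort_std {T : Type*} [LinearOrder T] (α : Fin ℓ → T) :
    (α ∘ Tuple.sort α) ∘ std α = α := by
  funext i
  simp [std]

lemma std_lt {T : Type*} [LinearOrder T] {α : Fin ℓ → T} {a b : Fin ℓ} (h : a < b)
    (hab : α a ≤ α b) : std α a < std α b := by
  by_contra hc
  have hne : std α b ≠ std α a := (std_injective α).ne h.ne'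
  have hlt : std α b < std α a := lt_of_le_of_ne (not_lt.1 hc) hne
  have h1 := Tuple.monotone_sort α hlt.le
  obtain ⟨-, h3⟩ := (Tuple.eq_sort_iff (f := α) (σ := Tuple.sort α)).1 rfl
  have h4 := h3 _ _ hlt
  simp only [std, Function.comp_apply, Equiv.apply_symm_apply] at h1 h4
  exact lt_asymm h (h4 (le_antisymm h1 hab))

lemma lt_of_std_lt {T : Type*} [LinearOrder T] {α : Fin ℓ → T} {a b : Fin ℓ}
    (h : std α a < std α b) : α a ≤ α b := by
  simpa [std] using Tuple.monotone_sort α h.le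

/-- Hecke steps commute with standardization: ties count as ascents on both sides. -/
lemma heckeStep_std {T : Type*} [LinearOrder T] (i : Fin (ℓ - 1)) (α : Fin ℓ → T) :
    heckeStep i (std α) = std (heckeStep i α) := by
  rcases le_or_gt (α (lo i)) (α (hi i)) with h | h
  · rw [heckeStep_of_le h, heckeStep_of_le (std_lt (lo_lt_hi i) h).le]
  · have h' : std α (hi i) < std α (lo i) := by
      by_contra hc
      rcases (not_lt.1 hc).lt_or_eq with h1 | h1
      · exact (lt_of_std_lt h1).not_gt h
      · exact lo_ne_hi i (std_injective α h1)
    rw [heckeStep_of_lt h, heckeStep_of_lt h']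
    have e : (Tuple.sort α).trans (Equiv.swap (lo i) (hi i)) =
        Tuple.sort (α ∘ Equiv.swap (lo i) (hi i)) := by
      rw [Tuple.eq_sort_iff]
      have e1 : (α ∘ Equiv.swap (lo i) (hi i)) ∘
          ((Tuple.sort α).trans (Equiv.swap (lo i) (hi i))) = α ∘ Tuple.sort α := by
        funext k; simp
      rw [e1]
      refine ⟨Tuple.monotone_sort α, fun a b hab heq => ?_⟩
      simp only [Equiv.trans_apply, Function.comp_apply, Equiv.swap_apply_self] at heq
      have h4 := ((Tuple.eq_sort_iff (f := α) (σ := Tuple.sort α)).1 rfl).2 a b hab heq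
      refine swap_lt_swap h4 ?_
      rintro ⟨h5, h6⟩
      rw [h5, h6] at heq
      exact h.ne' heq
    unfold std
    rw [← e]
    rfl

lemma heckeAct_std {T : Type*} [LinearOrder T] (z : ZeroHecke ℓ) (α : Fin ℓ → T) :
    heckeAct ℓ (Fin ℓ) z (std α) = std (heckeAct ℓ T z α) := by
  induction z using hecke_induction with
  | one => simp [heckeAct_one]
  | gen_mul i z ih => rw [heckeAct_mul, heckeAct_mul, ih, heckeAct_gen, heckeAct_gen,
      heckeStep_std]

lemma eq_of_lt_imp_lt {σ τ : Fin ℓ → Fin ℓ} (hσ : Function.Injective σ)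
    (h : ∀ a b, σ a < σ b → τ a < τ b) : σ = τ := by
  let e := Equiv.ofBijective σ (Finite.injective_iff_bijective.1 hσ)
  have h1 : StrictMono (τ ∘ e.symm) := by
    intro a b hab
    apply h
    have e1 : ∀ c, σ (e.symm c) = c := fun c => e.apply_symm_apply c
    rwa [e1, e1]
  have h2 := perm_eq_refl_of_strictMono h1
  funext a
  have := congrFun h2 (e a)
  simp only [Function.comp_apply, Equiv.symm_apply_apply, id] at this
  exact this.symm

lemma heckeAct_dec {T : Type*} [LinearOrder T] (z : ZeroHecke ℓ) (α : Fin ℓ → T) :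
    heckeAct ℓ T z (dec α) = (α ∘ Tuple.sort α) ∘ toPerm z :=
  heckeAct_comp (Tuple.monotone_sort α) z Fin.rev

/-- The longest element carrying `α⁺` to `α` corresponds to the standardization of `α`. -/
lemma isLongestTo_iff {T : Type*} [LinearOrder T] (α : Fin ℓ → T) (z : ZeroHecke ℓ) :
    IsLongestTo α z ↔ z = bubble (std α) := by
  have key : heckeAct ℓ T (bubble (std α)) (dec α) = α := by
    rw [heckeAct_dec, toPerm_bubble (std_injective α), sort_std]
  have sub : ∀ z', heckeAct ℓ T z' (dec α) = α → ascPairs (toPerm z') ⊆ ascPairs (std α) := by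
    intro z' hz' p hp
    rw [mem_ascPairs] at hp ⊢
    refine ⟨hp.1, std_lt hp.1 ?_⟩
    rw [heckeAct_dec] at hz'
    have h1 := congrFun hz' p.1
    have h2 := congrFun hz' p.2
    rw [← h1, ← h2]
    exact Tuple.monotone_sort α hp.2.le
  have hmax : ∀ z', heckeAct ℓ T z' (dec α) = α → len z' ≤ len (bubble (std α)) := by
    intro z' hz'
    rw [len_eq, len_eq, toPerm_bubble (std_injective α)]
    exact Finset.card_le_card (sub z' hz')
  constructor
  · rintro ⟨h1, h2⟩
    have hle := h2 _ key
    rw [len_eq, len_eq, toPerm_bubble (std_injective α)] at hle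
    have heq := Finset.eq_of_subset_of_card_le (sub z h1) hle
    have hinj : Function.Injective (toPerm z) := heckeAct_injective Fin.rev_injective z
    apply toPerm_injective
    rw [toPerm_bubble (std_injective α)]
    symm
    apply eq_of_lt_imp_lt (std_injective α)
    intro a b hab
    rcases lt_trichotomy a b with h | rfl | h
    · have : (a, b) ∈ ascPairs (std α) := mem_ascPairs.2 ⟨h, hab⟩
      rw [← heq] at this
      exact (mem_ascPairs.1 this).2
    · exact absurd hab (lt_irrefl _)
    · by_contra hc
      have hlt := lt_of_le_of_ne (not_lt.1 hc) (hinj.ne h.ne)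
      have : (b, a) ∈ ascPairs (toPerm z) := mem_ascPairs.2 ⟨h, hlt⟩
      rw [heq] at this
      exact lt_asymm hab (mem_ascPairs.1 this).2
  · rintro rfl
    exact ⟨key, hmax⟩

/-- The longest element carrying `α⁺` to `α` absorbs on the right the generators fixing `α⁺`:
multiplying by one of them cannot decrease the length. -/
lemma IsLongestTo.mul_gen {T : Type*} [LinearOrder T] {α : Fin ℓ → T} {z : ZeroHecke ℓ}
    (hz : IsLongestTo α z) {i : Fin (ℓ - 1)} (h : dec α (lo i) = dec α (hi i)) :
    z * gen i = z := by
  have h1 : IsLongestTo α (z * gen i) := by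
    refine ⟨?_, fun z' hz' => (hz.2 z' hz').trans (len_le_mul_gen z i)⟩
    rw [heckeAct_mul, heckeAct_gen, heckeStep_of_le h.le, hz.1]
  rw [(isLongestTo_iff α z).1 hz, (isLongestTo_iff α _).1 h1] at *

/-- A vector fixed by the generators that fix a dominant weight is fixed by its stabilizer. -/
lemma act_stabilizer {T : Type*} [LinearOrder T] {X : Type*} (φ : ZeroHecke ℓ →* Function.End X)
    {lam : Fin ℓ → T} (hlam : Antitone lam) {v : X}
    (hv : ∀ i, lam (lo i) = lam (hi i) → φ (gen i) v = v) (z : ZeroHecke ℓ)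
    (hz : heckeAct ℓ T z lam = lam) : φ z v = v := by
  induction z using hecke_induction with
  | one => rw [map_one]; rfl
  | gen_mul i z ih =>
    rw [heckeAct_mul, heckeAct_gen] at hz
    have h1 : heckeAct ℓ T z lam = lam := by
      rcases le_or_gt (heckeAct ℓ T z lam (lo i)) (heckeAct ℓ T z lam (hi i)) with h | h
      · rwa [heckeStep_of_le h] at hz
      · rw [heckeStep_of_lt h] at hz
        have h2 := congrFun hz (lo i)
        have h3 := congrFun hz (hi i)
        simp only [Function.comp_apply, Equiv.swap_apply_left, Equiv.swap_apply_right] at h2 h3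
        rw [h2, h3] at h
        exact absurd h (hlam (lo_lt_hi i).le).not_gt
    rw [h1] at hz
    rw [map_mul]
    change φ (gen i) (φ z v) = v
    rw [ih h1]
    apply hv
    apply le_antisymm _ (hlam (lo_lt_hi i).le)
    by_contra hc
    rw [heckeStep_of_lt (not_le.1 hc)] at hz
    have := congrFun hz (lo i)
    simp only [Function.comp_apply, Equiv.swap_apply_left] at this
    exact hc this.ge

/-- If `v` is fixed by the generators fixing `α⁺`, then `z · v` depends only on `z · α⁺`. -/
lemma act_eq_of_heckeAct_eq {T : Type*} [LinearOrder T] {X : Type*}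
    (φ : ZeroHecke ℓ →* Function.End X) {lam : Fin ℓ → T} (hlam : Antitone lam) {v : X}
    (hv : ∀ i, lam (lo i) = lam (hi i) → φ (gen i) v = v) {z z' : ZeroHecke ℓ}
    (hz : heckeAct ℓ T z lam = heckeAct ℓ T z' lam) : φ z v = φ z' v := by
  -- `V` is the longest element fixing `lam`; multiplying by it on the right makes `z` and `z'`
  -- equal, by faithfulness of the action on permutations.
  set V := bubble (std lam)
  have hV : heckeAct ℓ T V lam = lam := by
    have := ((isLongestTo_iff lam V).2 rfl).1
    rwa [dec_of_antitone hlam] at this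
  have hfix := act_stabilizer φ hlam hv V hV
  have heq : z * V = z' * V := by
    apply toPerm_injective
    rw [toPerm, toPerm, heckeAct_mul, heckeAct_mul]
    change heckeAct ℓ (Fin ℓ) z (toPerm V) = heckeAct ℓ (Fin ℓ) z' (toPerm V)
    rw [toPerm_bubble (std_injective lam), heckeAct_std, heckeAct_std, hz]
  rw [← hfix]
  have := congrArg (fun w => φ w v) heq
  rw [map_mul, map_mul] at this
  exact this

end Hecke

/-! ### Longest elements of intervals of generators -/

section Parabolic

variable {ℓ : ℕ}

/-- The generator of index `i : ℕ`, read as `1` when `i` is out of range. -/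
def genN (ℓ i : ℕ) : ZeroHecke ℓ := if h : i < ℓ - 1 then gen ⟨i, h⟩ else 1

lemma genN_of_lt {i : ℕ} (h : i < ℓ - 1) : genN ℓ i = gen ⟨i, h⟩ := dif_pos h

lemma genN_val (i : Fin (ℓ - 1)) : genN ℓ i.1 = gen i := dif_pos i.2

lemma genN_of_ge {i : ℕ} (h : ℓ - 1 ≤ i) : genN ℓ i = 1 := dif_neg h.not_gt

lemma genN_idem (i : ℕ) : genN ℓ i * genN ℓ i = genN ℓ i := by
  unfold genN
  split_ifs
  · exact gen_idem _
  · simp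

lemma genN_comm {i j : ℕ} (h : i + 1 < j) : genN ℓ i * genN ℓ j = genN ℓ j * genN ℓ i := by
  unfold genN
  split_ifs
  · exact gen_comm _ _ h
  all_goals simp

lemma genN_braid (i : ℕ) :
    genN ℓ i * genN ℓ (i + 1) * genN ℓ i = genN ℓ (i + 1) * genN ℓ i * genN ℓ (i + 1) := by
  by_cases h : i + 1 < ℓ - 1
  · rw [genN_of_lt h, genN_of_lt (show i < ℓ - 1 by omega)]
    exact gen_braid _ _ rfl
  · rw [genN_of_ge (i := i + 1) (by omega)]
    simp [genN_idem]

/-- The product of the generators with indices in a list. -/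
def wordProd (ℓ : ℕ) (u : List ℕ) : ZeroHecke ℓ := (u.map (genN ℓ)).prod

lemma wordProd_nil : wordProd ℓ [] = 1 := rfl

lemma wordProd_cons (i : ℕ) (u : List ℕ) : wordProd ℓ (i :: u) = genN ℓ i * wordProd ℓ u := by
  simp [wordProd]

lemma wordProd_append (u v : List ℕ) : wordProd ℓ (u ++ v) = wordProd ℓ u * wordProd ℓ v := by
  simp [wordProd]

/-- A reduced word of the longest element permuting the `n` positions `a, …, a + n - 1`. -/
def longWord (a : ℕ) : ℕ → List ℕ
  | 0 => []
  | n + 1 => List.range' a n ++ longWord a n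

lemma mem_longWord {a n i : ℕ} (h : i ∈ longWord a n) : a ≤ i ∧ i + 1 < a + n := by
  induction n with
  | zero => simp [longWord] at h
  | succ n ih =>
    simp only [longWord, List.mem_append, List.mem_range'_1] at h
    rcases h with h | h
    · omega
    · have := ih h
      omega

lemma longWord_succ_left (a n : ℕ) : longWord (a + 1) n = (longWord a n).map (· + 1) := by
  induction n with
  | zero => rfl
  | succ n ih =>
    simp only [longWord, ih, List.map_append]
    congr 1
    rw [List.range'_eq_map_range, List.range'_eq_map_range, List.map_map]
    apply List.map_congr_left
    intro t _
    simp only [Function.comp_apply]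
    omega

lemma genN_mul_range' (a n i : ℕ) (h : a ≤ i) (hi : i + 1 < a + n) :
    genN ℓ (i + 1) * wordProd ℓ (List.range' a n) = wordProd ℓ (List.range' a n) * genN ℓ i := by
  have far : ∀ n j, a + n < j →
      genN ℓ j * wordProd ℓ (List.range' a n) = wordProd ℓ (List.range' a n) * genN ℓ j := by
    intro n
    induction n with
    | zero => intro j _; simp [wordProd]
    | succ n ih =>
      intro j hj
      rw [← List.range'_append_1 (n := 1), wordProd_append, ← mul_assoc, ih j (by omega), mul_assoc,
        mul_assoc]
      congr 1
      simp only [List.range'_one, wordProd_cons, wordProd_nil, mul_one]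
      exact (genN_comm (by omega)).symm
  induction n with
  | zero => omega
  | succ n ih =>
    rw [← List.range'_append_1 (n := 1), wordProd_append]
    simp only [List.range'_one, wordProd_cons, wordProd_nil, mul_one]
    rcases Nat.lt_or_ge (i + 1) (a + n) with h1 | h1
    · rw [← mul_assoc, ih h1, mul_assoc, mul_assoc, genN_comm h1]
    · obtain ⟨k, rfl⟩ : ∃ k, n = k + 1 := ⟨n - 1, by omega⟩
      obtain rfl : i = a + k := by omega
      rw [← List.range'_append_1 (n := 1), wordProd_append]
      simp only [List.range'_one, wordProd_cons, wordProd_nil, mul_one]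
      have e : a + (k + 1) = a + k + 1 := rfl
      rw [e, ← mul_assoc, ← mul_assoc, far k (a + k + 1) (by omega), mul_assoc, mul_assoc,
        ← mul_assoc (genN ℓ (a + k + 1)), ← genN_braid]
      simp only [mul_assoc]

/-- The longest element of an interval of generators absorbs these generators on the left. -/
lemma genN_mul_longWord (a n i : ℕ) (h : a ≤ i) (hi : i + 1 < a + n) :
    genN ℓ i * wordProd ℓ (longWord a n) = wordProd ℓ (longWord a n) := by
  induction n generalizing i with
  | zero => omega
  | succ n ih =>
    simp only [longWord, wordProd_append]
    rw [← mul_assoc]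
    rcases h.eq_or_lt with rfl | h1
    · obtain ⟨k, rfl⟩ : ∃ k, n = k + 1 := ⟨n - 1, by omega⟩
      rw [List.range'_succ, wordProd_cons, ← mul_assoc (genN ℓ a), genN_idem]
    · obtain ⟨k, rfl⟩ : ∃ k, i = k + 1 := ⟨i - 1, by omega⟩
      rw [genN_mul_range' a n k (by omega) (by omega), mul_assoc, ih k (by omega) (by omega)]

lemma wordProd_mul_of_absorb {u : List ℕ} {w : ZeroHecke ℓ} (h : ∀ i ∈ u, genN ℓ i * w = w) :
    wordProd ℓ u * w = w := by
  induction u with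
  | nil => simp [wordProd]
  | cons i u ih =>
    rw [wordProd_cons, mul_assoc, ih fun j hj => h j (List.mem_cons_of_mem _ hj)]
    exact h i (by simp)

lemma mul_wordProd_of_absorb {u : List ℕ} {w : ZeroHecke ℓ} (h : ∀ i ∈ u, w * genN ℓ i = w) :
    w * wordProd ℓ u = w := by
  induction u with
  | nil => simp [wordProd]
  | cons i u ih =>
    rw [wordProd_cons, ← mul_assoc, h i (by simp)]
    exact ih fun j hj => h j (List.mem_cons_of_mem _ hj)

lemma reverse_genN (i : ℕ) : (reverse (genN ℓ i)).unop = genN ℓ i := by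
  unfold genN
  split_ifs
  · rfl
  · simp

lemma reverse_wordProd (u : List ℕ) : (reverse (wordProd ℓ u)).unop = wordProd ℓ u.reverse := by
  induction u with
  | nil => simp [wordProd]
  | cons i u ih =>
    rw [wordProd_cons, reverse_mul, ih, reverse_genN, List.reverse_cons, wordProd_append]
    simp [wordProd]

/-- The longest element of an interval of generators absorbs these generators on the right: it
equals its own reverse, and it absorbs them on the left. -/
lemma longWord_mul_genN (a n i : ℕ) (h : a ≤ i) (hi : i + 1 < a + n) :
    wordProd ℓ (longWord a n) * genN ℓ i = wordProd ℓ (longWord a n) := by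
  set w := wordProd ℓ (longWord a n)
  have hr : ∀ j, a ≤ j → j + 1 < a + n → (reverse w).unop * genN ℓ j = (reverse w).unop := by
    intro j h1 h2
    rw [← reverse_genN j, ← reverse_mul, genN_mul_longWord a n j h1 h2]
  have e1 : (reverse w).unop * w = w := by
    rw [reverse_wordProd]
    apply wordProd_mul_of_absorb
    intro j hj
    have := mem_longWord (List.mem_reverse.1 hj)
    exact genN_mul_longWord a n j this.1 this.2
  have e2 : (reverse w).unop * w = (reverse w).unop :=
    mul_wordProd_of_absorb fun j hj => hr j (mem_longWord hj).1 (mem_longWord hj).2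
  rw [e1] at e2
  rw [e2]
  exact hr i h hi

end Parabolic

/-! ### Demazure operators on `ℤ[q][x]` -/

section DemazureP

variable {ℓ : ℕ}

open MvPolynomial

/-- The exchange of the variables `x_i`, `x_{i+1}` in `ℤ[q][x]`. -/
def swapP (i : Fin (ℓ - 1)) : PolyRing ℓ →ₐ[Polynomial ℤ] PolyRing ℓ :=
  rename (Equiv.swap (lo i) (hi i))

lemma swapP_X (i : Fin (ℓ - 1)) (k : Fin ℓ) :
    swapP i (X k) = X (Equiv.swap (lo i) (hi i) k) := rename_X _ _

lemma swapP_swapP (i : Fin (ℓ - 1)) (f : PolyRing ℓ) : swapP i (swapP i f) = f := by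
  unfold swapP
  rw [rename_rename]
  have : (Equiv.swap (lo i) (hi i) : Fin ℓ → Fin ℓ) ∘ Equiv.swap (lo i) (hi i) = id := by
    funext k; simp
  rw [this, rename_id, AlgHom.id_apply]

lemma dvd_sub_swapP (i : Fin (ℓ - 1)) (f : PolyRing ℓ) :
    (X (lo i) - X (hi i) : PolyRing ℓ) ∣ f - swapP i f := by
  induction f using MvPolynomial.induction_on with
  | C a => simp [swapP]
  | add p q hp hq =>
    rw [map_add]
    convert dvd_add hp hq using 1
    ring
  | mul_X p k hp =>
    have hk : (X (lo i) - X (hi i) : PolyRing ℓ) ∣ X k - swapP i (X k) := by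
      rw [swapP_X]
      by_cases h1 : k = lo i
      · subst h1; simp
      · by_cases h2 : k = hi i
        · subst h2
          rw [Equiv.swap_apply_right]
          exact ⟨-1, by ring⟩
        · rw [Equiv.swap_apply_of_ne_of_ne h1 h2, sub_self]
          exact dvd_zero _
    rw [map_mul]
    have : p * X k - swapP i p * swapP i (X k) =
        (p - swapP i p) * X k + swapP i p * (X k - swapP i (X k)) := by ring
    rw [this]
    exact dvd_add (hp.mul_right _) (hk.mul_left _)

lemma X_lo_ne_X_hi (i : Fin (ℓ - 1)) : (X (lo i) : PolyRing ℓ) ≠ X (hi i) :=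
  (X_injective (R := Polynomial ℤ)).ne (lo_ne_hi i)

lemma demazureP_spec (i : Fin (ℓ - 1)) (f : PolyRing ℓ) :
    (X (lo i) - X (hi i)) * demazureP i f = X (lo i) * f - X (hi i) * swapP i f :=
  demazureOp_spec (dvd_sub_swapP i) f

lemma demazureP_eq_of {i : Fin (ℓ - 1)} {f g : PolyRing ℓ}
    (h : (X (lo i) - X (hi i)) * g = X (lo i) * f - X (hi i) * swapP i f) :
    demazureP i f = g :=
  mul_left_cancel₀ (sub_ne_zero.2 (X_lo_ne_X_hi i)) ((demazureP_spec i f).trans h.symm)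

lemma demazureP_of_swapP_eq {i : Fin (ℓ - 1)} {f : PolyRing ℓ} (h : swapP i f = f) :
    demazureP i f = f :=
  demazureP_eq_of (by rw [h]; ring)

lemma demazureP_one (i : Fin (ℓ - 1)) : demazureP i (1 : PolyRing ℓ) = 1 :=
  demazureP_of_swapP_eq (map_one _)

lemma demazureP_mul_left {i : Fin (ℓ - 1)} {f : PolyRing ℓ} (h : swapP i f = f)
    (g : PolyRing ℓ) : demazureP i (f * g) = f * demazureP i g :=
  demazureP_eq_of (by
    rw [map_mul, h]
    linear_combination f * demazureP_spec i g)

lemma demazureP_idem (i : Fin (ℓ - 1)) (f : PolyRing ℓ) :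
    demazureP i (demazureP i f) = demazureP i f :=
  demazureOp_idem (swapP_swapP i) ((swapP_X i _).trans (by rw [Equiv.swap_apply_left]))
    ((swapP_X i _).trans (by rw [Equiv.swap_apply_right])) (X_lo_ne_X_hi i) (dvd_sub_swapP i) f

/-- The image of `π_i` consists of polynomials symmetric in `x_i`, `x_{i+1}`. -/
lemma swapP_of_demazureP_eq {i : Fin (ℓ - 1)} {f : PolyRing ℓ} (h : demazureP i f = f) :
    swapP i f = f := by
  have := demazureP_spec i f
  rw [h] at this
  apply mul_left_cancel₀ (X_ne_zero (R := Polynomial ℤ) (hi i))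
  linear_combination this

lemma demazureP_comm (i j : Fin (ℓ - 1)) (h : i.1 + 1 < j.1) (f : PolyRing ℓ) :
    demazureP i (demazureP j f) = demazureP j (demazureP i f) := by
  have n1 : lo i ≠ lo j := by simp only [lo, ne_eq, Fin.ext_iff]; omega
  have n2 : lo i ≠ hi j := by simp only [lo, hi, ne_eq, Fin.ext_iff]; omega
  have n3 : hi i ≠ lo j := by simp only [lo, hi, ne_eq, Fin.ext_iff]; omega
  have n4 : hi i ≠ hi j := by simp only [hi, ne_eq, Fin.ext_iff]; omega
  refine demazureOp_comm (s := (swapP i).toRingHom) (t := (swapP j).toRingHom)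
    ?_ ?_ ?_ ?_ ?_ (X_lo_ne_X_hi i) (X_lo_ne_X_hi j)
    (dvd_sub_swapP i) (dvd_sub_swapP j) f
  · intro f
    change swapP i (swapP j f) = swapP j (swapP i f)
    unfold swapP
    rw [rename_rename, rename_rename]
    congr 2
    funext k
    simp only [Function.comp_apply, Equiv.swap_apply_def]
    grind
  · exact (swapP_X i _).trans (by rw [Equiv.swap_apply_of_ne_of_ne n1.symm n3.symm])
  · exact (swapP_X i _).trans (by rw [Equiv.swap_apply_of_ne_of_ne n2.symm n4.symm])
  · exact (swapP_X j _).trans (by rw [Equiv.swap_apply_of_ne_of_ne n1 n2])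
  · exact (swapP_X j _).trans (by rw [Equiv.swap_apply_of_ne_of_ne n3 n4])

lemma demazureP_braid (i j : Fin (ℓ - 1)) (h : i.1 + 1 = j.1) (f : PolyRing ℓ) :
    demazureP i (demazureP j (demazureP i f)) = demazureP j (demazureP i (demazureP j f)) := by
  have e : lo j = hi i := by simp [lo, hi, h]
  have n1 : lo i ≠ hi i := lo_ne_hi i
  have n2 : hi i ≠ hi j := by rw [← e]; exact lo_ne_hi j
  have n3 : lo i ≠ hi j := by simp only [lo, hi, ne_eq, Fin.ext_iff]; omega
  have hX := (X_injective (σ := Fin ℓ) (R := Polynomial ℤ))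
  have hj : ∀ f : PolyRing ℓ, (X (hi i) - X (hi j) : PolyRing ℓ) ∣ f - swapP j f := by
    rw [← e]; exact dvd_sub_swapP j
  have key := demazureOp_braid (s := (swapP i).toRingHom) (t := (swapP j).toRingHom)
    (x := (X (lo i) : PolyRing ℓ)) (y := X (hi i)) (z := X (hi j))
    (by
      intro f
      change swapP i (swapP j (swapP i f)) = swapP j (swapP i (swapP j f))
      unfold swapP
      rw [rename_rename, rename_rename, rename_rename, rename_rename]
      congr 2
      funext k
      simp only [Function.comp_apply, Equiv.swap_apply_def, e]
      grind)
    ((swapP_X i _).trans (by rw [Equiv.swap_apply_left]))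
    ((swapP_X i _).trans (by rw [Equiv.swap_apply_right]))
    ((swapP_X i _).trans (by rw [Equiv.swap_apply_of_ne_of_ne n3.symm n2.symm]))
    ((swapP_X j _).trans (by rw [e, Equiv.swap_apply_of_ne_of_ne n1 n3]))
    ((swapP_X j _).trans (by rw [e, Equiv.swap_apply_left]))
    ((swapP_X j _).trans (by rw [e, Equiv.swap_apply_right]))
    (hX.ne n1) (hX.ne n2) (hX.ne n3) (dvd_sub_swapP i) hj (swapP_swapP i) (swapP_swapP j) f
  have hd : ∀ f, demazureP j f = demazureOp (swapP j).toRingHom (X (hi i)) (X (hi j)) f := by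
    intro f
    rw [← e]
    rfl
  rw [hd, hd, hd]
  exact key

/-- The Demazure operators `π_w` on `ℤ[q][x]`. -/
def demazurePW (ℓ : ℕ) : ZeroHecke ℓ →* Function.End (PolyRing ℓ) :=
  zeroHeckeLift (M := Function.End (PolyRing ℓ)) (fun i => demazureP i)
    (fun i => funext fun f => demazureP_idem i f)
    (fun i j h => funext fun f => demazureP_braid i j h f)
    (fun i j h => funext fun f => demazureP_comm i j h f)

lemma demazurePW_gen (i : Fin (ℓ - 1)) (f : PolyRing ℓ) :
    demazurePW ℓ (gen i) f = demazureP i f := rfl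

lemma demazurePW_mul (z w : ZeroHecke ℓ) (f : PolyRing ℓ) :
    demazurePW ℓ (z * w) f = demazurePW ℓ z (demazurePW ℓ w f) := by
  rw [map_mul]; rfl

lemma demazurePW_one (f : PolyRing ℓ) : demazurePW ℓ 1 f = f := by
  rw [map_one]; rfl

/-! ### The rotation operator -/

lemma Phi_X_of_lt {k : Fin ℓ} (h : k.1 + 1 < ℓ) : Phi ℓ (X k) = X ⟨k.1 + 1, h⟩ := by
  simp [Phi, h]

lemma Phi_X_of_not_lt {k : Fin ℓ} (h : ¬ k.1 + 1 < ℓ) :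
    Phi ℓ (X k) = C Polynomial.X * X ⟨0, by have := k.2; omega⟩ := by
  simp [Phi, h]

lemma swapP_C (i : Fin (ℓ - 1)) (c : Polynomial ℤ) : swapP i (C c) = C c := rename_C _ _

lemma Phi_C (c : Polynomial ℤ) : Phi ℓ (C c) = C c := by
  unfold Phi
  rw [aeval_C]
  rfl

lemma Phi_swapP {i j : Fin (ℓ - 1)} (h : i.1 + 1 = j.1) (f : PolyRing ℓ) :
    Phi ℓ (swapP i f) = swapP j (Phi ℓ f) := by
  have : (Phi ℓ).comp (swapP i) = (swapP j).comp (Phi ℓ) := by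
    apply MvPolynomial.algHom_ext
    intro k
    simp only [AlgHom.comp_apply, swapP_X]
    have e1 : (lo i).1 = i.1 := rfl
    have e2 : (hi i).1 = i.1 + 1 := rfl
    have e3 : (lo j).1 = j.1 := rfl
    have e4 : (hi j).1 = j.1 + 1 := rfl
    have hj := j.2
    by_cases hk : k.1 + 1 < ℓ
    · have hk' : (Equiv.swap (lo i) (hi i) k).1 + 1 < ℓ := by
        rw [Equiv.swap_apply_def]
        split_ifs <;> omega
      rw [Phi_X_of_lt hk, Phi_X_of_lt hk', swapP_X]
      congr 1
      simp only [Equiv.swap_apply_def, Fin.ext_iff]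
      split_ifs <;> first | omega | simp_all
    · have h1 : k ≠ lo i := by rw [ne_eq, Fin.ext_iff]; omega
      have h2 : k ≠ hi i := by rw [ne_eq, Fin.ext_iff]; omega
      rw [Equiv.swap_apply_of_ne_of_ne h1 h2, Phi_X_of_not_lt hk, map_mul, swapP_C, swapP_X,
        Equiv.swap_apply_of_ne_of_ne]
      · rw [ne_eq, Fin.ext_iff]; simp only; omega
      · rw [ne_eq, Fin.ext_iff]; simp only; omega
  exact DFunLike.congr_fun this f

lemma Phi_demazureP {i j : Fin (ℓ - 1)} (h : i.1 + 1 = j.1) (f : PolyRing ℓ) :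
    Phi ℓ (demazureP i f) = demazureP j (Phi ℓ f) := by
  symm
  apply demazureP_eq_of
  have := congrArg (Phi ℓ) (demazureP_spec i f)
  have hj := j.2
  have e1 : Phi ℓ (X (lo i)) = X (lo j) := by
    rw [Phi_X_of_lt (by simp only [lo]; omega)]
    congr 1
    simp [lo, h]
  have e2 : Phi ℓ (X (hi i)) = X (hi j) := by
    rw [Phi_X_of_lt (by simp only [hi]; omega)]
    congr 1
    simp [hi, h]
  simpa only [map_mul, map_sub, e1, e2, Phi_swapP h] using this

/-- The operator `f ↦ x_1 Φ(f)`. -/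
def rotP (h : 0 < ℓ) (f : PolyRing ℓ) : PolyRing ℓ := X ⟨0, h⟩ * Phi ℓ f

lemma rotP_demazureP (hℓ : 0 < ℓ) {i j : Fin (ℓ - 1)} (h : i.1 + 1 = j.1) (f : PolyRing ℓ) :
    rotP hℓ (demazureP i f) = demazureP j (rotP hℓ f) := by
  unfold rotP
  rw [Phi_demazureP h, demazureP_mul_left]
  rw [swapP_X, Equiv.swap_apply_of_ne_of_ne]
  · simp only [lo, ne_eq, Fin.ext_iff]; omega
  · simp only [hi, ne_eq, Fin.ext_iff]; omega

/-- Applying the rotation twice turns `π_{ℓ-1}` into `π_1`: this is the relation of the affine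
0-Hecke monoid that involves the affine generator. -/
lemma rotP_rotP_demazureP (hℓ : 0 < ℓ) {i j : Fin (ℓ - 1)} (hi' : i.1 + 2 = ℓ) (hj : j.1 = 0)
    (f : PolyRing ℓ) :
    rotP hℓ (rotP hℓ (demazureP i f)) = demazureP j (rotP hℓ (rotP hℓ f)) := by
  have e0 : (⟨0, hℓ⟩ : Fin ℓ) = lo j := by simp [lo, hj]
  have p0 : Phi ℓ (X (lo j)) = X (hi j) := by
    rw [Phi_X_of_lt (by simp only [lo]; omega)]
    congr 1
  have hΦ : ∀ f, Phi ℓ (Phi ℓ (swapP i f)) = swapP j (Phi ℓ (Phi ℓ f)) := by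
    intro f
    have : ((Phi ℓ).comp (Phi ℓ)).comp (swapP i) = (swapP j).comp ((Phi ℓ).comp (Phi ℓ)) := by
      apply MvPolynomial.algHom_ext
      intro k
      simp only [AlgHom.comp_apply, swapP_X]
      have plo : Phi ℓ (Phi ℓ (X (lo i))) = C Polynomial.X * X (lo j) := by
        rw [Phi_X_of_lt (by simp only [lo]; omega), Phi_X_of_not_lt (by simp only [lo]; omega), e0]
      have phi : Phi ℓ (Phi ℓ (X (hi i))) = C Polynomial.X * X (hi j) := by
        rw [Phi_X_of_not_lt (by simp only [hi]; omega), e0, map_mul, p0, Phi_C]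
      by_cases h1 : k = lo i
      · subst h1
        rw [Equiv.swap_apply_left, plo, phi, map_mul, swapP_C, swapP_X, Equiv.swap_apply_left]
      · by_cases h2 : k = hi i
        · subst h2
          rw [Equiv.swap_apply_right, plo, phi, map_mul, swapP_C, swapP_X, Equiv.swap_apply_right]
        · rw [Equiv.swap_apply_of_ne_of_ne h1 h2]
          have hk := k.2
          simp only [lo, hi, Fin.ext_iff] at h1 h2
          rw [Phi_X_of_lt (by omega), Phi_X_of_lt (by simp only; omega), swapP_X,
            Equiv.swap_apply_of_ne_of_ne]
          · simp only [lo, ne_eq, Fin.ext_iff]; omega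
          · simp only [hi, ne_eq, Fin.ext_iff]; omega
    exact DFunLike.congr_fun this f
  unfold rotP
  rw [e0, map_mul, map_mul, p0, ← mul_assoc, ← mul_assoc, demazureP_mul_left]
  · congr 1
    symm
    apply demazureP_eq_of
    have := congrArg (Phi ℓ) (congrArg (Phi ℓ) (demazureP_spec i f))
    have plo : Phi ℓ (Phi ℓ (X (lo i))) = C Polynomial.X * X (lo j) := by
      rw [Phi_X_of_lt (by simp only [lo]; omega), Phi_X_of_not_lt (by simp only [lo]; omega), e0]
    have phi : Phi ℓ (Phi ℓ (X (hi i))) = C Polynomial.X * X (hi j) := by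
      rw [Phi_X_of_not_lt (by simp only [hi]; omega), e0, map_mul, p0, Phi_C]
    simp only [map_mul, map_sub, plo, phi, hΦ] at this
    have hq : (C Polynomial.X : PolyRing ℓ) ≠ 0 := by
      rw [ne_eq, C_eq_zero]; exact Polynomial.X_ne_zero
    apply mul_left_cancel₀ hq
    linear_combination this
  · rw [map_mul, swapP_X, swapP_X, Equiv.swap_apply_left, Equiv.swap_apply_right, mul_comm]

end DemazureP

/-! ### Consistency of the Knop–Sahi recurrence -/

section Recurrence

variable {ℓ : ℕ}

open MvPolynomial

lemma comp_swap_apply {T : Type*} (α : Fin ℓ → T) (i : Fin (ℓ - 1)) (k : Fin ℓ) :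
    (α ∘ Equiv.swap (lo i) (hi i)) k =
      if k.1 = i.1 then α (hi i) else if k.1 = i.1 + 1 then α (lo i) else α k := by
  have hlo : k.1 = i.1 ↔ k = lo i := by simp [lo, Fin.ext_iff]
  have hhi : k.1 = i.1 + 1 ↔ k = hi i := by simp [hi, Fin.ext_iff]
  simp only [hlo, hhi, Function.comp_apply, Equiv.swap_apply_def]
  split_ifs <;> rfl

/-- The first nonzero entry of `α` is at position `i + 1`. -/
def FirstAt (i : Fin (ℓ - 1)) (α : Fin ℓ → ℕ) : Prop := (∀ k ≤ lo i, α k = 0) ∧ α (hi i) ≠ 0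

lemma FirstAt.unique {i j : Fin (ℓ - 1)} {α : Fin ℓ → ℕ} (h : FirstAt i α) (h' : FirstAt j α) :
    i = j := by
  by_contra hne
  rcases lt_or_gt_of_ne hne with hlt | hlt
  · exact h.2 (h'.1 _ (by simp only [lo, hi, Fin.le_def]; omega))
  · exact h'.2 (h.1 _ (by simp only [lo, hi, Fin.le_def]; omega))

lemma macdonaldE_of_ne_zero (h : 0 < ℓ) {α : Fin ℓ → ℕ} (h0 : α ⟨0, h⟩ ≠ 0) :
    macdonaldE α = rotP h (macdonaldE (unrotate α)) := by
  rw [macdonaldE, dif_pos ⟨h, h0⟩]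
  rfl

lemma macdonaldE_of_firstAt {i : Fin (ℓ - 1)} {α : Fin ℓ → ℕ} (h : FirstAt i α) :
    macdonaldE α = demazureP i (macdonaldE (α ∘ Equiv.swap (lo i) (hi i))) := by
  have hex : ∃ i : Fin (ℓ - 1), (∀ k ≤ lo i, α k = 0) ∧ α (hi i) ≠ 0 := ⟨i, h⟩
  rw [macdonaldE, dif_neg, dif_pos hex]
  · obtain rfl : hex.choose = i := FirstAt.unique hex.choose_spec h
    rfl
  · rintro ⟨h1, h2⟩
    exact h2 (h.1 _ (by simp [lo, Fin.le_def]))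

lemma macdonaldE_zero : macdonaldE (0 : Fin ℓ → ℕ) = 1 := by
  rw [macdonaldE, dif_neg (by simp), dif_neg (by simp)]

/-- Every nonzero tuple with vanishing first entry has a first nonzero entry further on. -/
lemma exists_firstAt {α : Fin ℓ → ℕ} (h0 : ∀ h : 0 < ℓ, α ⟨0, h⟩ = 0) (hα : α ≠ 0) :
    ∃ i : Fin (ℓ - 1), FirstAt i α := by
  classical
  have hex : ∃ n, ∃ h : n < ℓ, α ⟨n, h⟩ ≠ 0 := by
    by_contra hc
    push Not at hc
    exact hα (funext fun k => hc k.1 k.2)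
  obtain ⟨h1, h2⟩ := Nat.find_spec hex
  have hmin := fun m => Nat.find_min hex (m := m)
  generalize Nat.find hex = n at h1 h2 hmin
  have hn : n ≠ 0 := by
    rintro rfl
    exact h2 (h0 h1)
  refine ⟨⟨n - 1, by omega⟩, fun k hk => ?_, ?_⟩
  · have hk' : k.1 ≤ n - 1 := hk
    by_contra hc
    exact hmin k.1 (by omega) ⟨k.2, hc⟩
  · have e : hi (⟨n - 1, by omega⟩ : Fin (ℓ - 1)) = ⟨n, h1⟩ :=
      Fin.ext (by simp only [hi]; omega)
    rw [e]
    exact h2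

lemma rotate_unrotate (h : 0 < ℓ) {α : Fin ℓ → ℕ} (h0 : α ⟨0, h⟩ ≠ 0) :
    rotate (unrotate α) = α := by
  funext k
  have hk := k.2
  unfold rotate unrotate
  by_cases h1 : k.1 = 0
  · have e : k = ⟨0, h⟩ := Fin.ext h1
    subst e
    simp only [if_true]
    rw [dif_neg (by omega)]
    omega
  · rw [if_neg h1, dif_pos (by simp only; omega)]
    congr 1
    ext
    simp only
    omega

lemma unrotate_rotate (α : Fin ℓ → ℕ) : unrotate (rotate α) = α := by
  funext k
  have hk := k.2
  simp only [rotate, unrotate]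
  by_cases h1 : k.1 + 1 < ℓ
  · rw [dif_pos h1, if_neg (by simp)]
    congr 1
  · rw [dif_neg h1]
    simp only [if_true, Nat.add_sub_cancel]
    congr 1
    ext
    simp only
    omega

/-- The statistic used, after the size of the tuple, in the recursion. -/
def wsum (α : Fin ℓ → ℕ) : ℕ := ∑ k : Fin ℓ, k.1 * α k

lemma wsum_comp_swap (α : Fin ℓ → ℕ) (i : Fin (ℓ - 1)) :
    wsum (α ∘ Equiv.swap (lo i) (hi i)) + α (hi i) = wsum α + α (lo i) := by
  have split : ∀ β : Fin ℓ → ℕ, wsum β = (lo i).1 * β (lo i) + ((hi i).1 * β (hi i) +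
      ∑ k ∈ (Finset.univ.erase (lo i)).erase (hi i), k.1 * β k) := by
    intro β
    unfold wsum
    rw [← Finset.add_sum_erase _ _ (Finset.mem_univ (lo i)),
      ← Finset.add_sum_erase (Finset.univ.erase (lo i)) _
        (Finset.mem_erase.2 ⟨(lo_ne_hi i).symm, Finset.mem_univ (hi i)⟩)]
  rw [split α, split (α ∘ _)]
  have e : ∑ k ∈ (Finset.univ.erase (lo i)).erase (hi i),
      k.1 * (α ∘ Equiv.swap (lo i) (hi i)) k =
      ∑ k ∈ (Finset.univ.erase (lo i)).erase (hi i), k.1 * α k := by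
    apply Finset.sum_congr rfl
    intro k hk
    simp only [Finset.mem_erase] at hk
    rw [Function.comp_apply, Equiv.swap_apply_of_ne_of_ne hk.2.1 hk.1]
  rw [e]
  simp only [Function.comp_apply, Equiv.swap_apply_left, Equiv.swap_apply_right]
  simp only [lo, hi]
  ring

lemma sum_heckeStep (i : Fin (ℓ - 1)) (α : Fin ℓ → ℕ) : ∑ k, heckeStep i α k = ∑ k, α k := by
  unfold heckeStep
  split_ifs
  · exact sum_swap α _ _
  · rfl

lemma unrotate_heckeStep {i j : Fin (ℓ - 1)} (h : j.1 + 1 = i.1) (α : Fin ℓ → ℕ) :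
    unrotate (heckeStep i α) = heckeStep j (unrotate α) := by
  funext k
  have hi' := i.2
  have hk := k.2
  simp only [heckeStep_apply, unrotate, lo, hi]
  grind

lemma unrotate_unrotate_heckeStep {i j : Fin (ℓ - 1)} (hj : j.1 + 2 = ℓ) (hi' : i.1 = 0)
    {α : Fin ℓ → ℕ} (h0 : α (lo i) ≠ 0) (h1 : α (hi i) ≠ 0) :
    unrotate (unrotate (heckeStep i α)) = heckeStep j (unrotate (unrotate α)) := by
  obtain ⟨n, rfl⟩ : ∃ n, ℓ = n + 2 := ⟨ℓ - 2, by omega⟩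
  have e1 : lo i = 0 := Fin.ext (by simpa [lo] using hi')
  have e2 : hi i = 1 := Fin.ext (by simp [hi, hi'])
  rw [e1] at h0
  rw [e2] at h1
  funext k
  have hk := k.2
  have f0 : ∀ β : Fin (n + 2) → ℕ, ∀ h, β ⟨0, h⟩ = β 0 := fun _ _ => rfl
  have f1 : ∀ β : Fin (n + 2) → ℕ, ∀ h, β ⟨0 + 1, h⟩ = β 1 := fun _ _ => rfl
  simp only [heckeStep_apply, unrotate, lo, hi, hi']
  grind

lemma heckeStep_comp_swap_of_far {i j : Fin (ℓ - 1)} (h : j.1 + 1 < i.1) {α : Fin ℓ → ℕ} :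
    heckeStep i α ∘ Equiv.swap (lo j) (hi j) = heckeStep i (α ∘ Equiv.swap (lo j) (hi j)) := by
  funext k
  simp only [comp_swap_apply, heckeStep_apply]
  simp only [lo, hi]
  grind

lemma heckeStep_comp_swap_of_near {i j : Fin (ℓ - 1)} (h : j.1 + 1 = i.1) {α : Fin ℓ → ℕ}
    (h0 : α (lo j) = 0) : heckeStep i α ∘ Equiv.swap (lo j) (hi j) =
      heckeStep i (heckeStep j ((α ∘ Equiv.swap (lo j) (hi j)) ∘
        Equiv.swap (lo i) (hi i))) := by
  have e : lo i = hi j := by simp [lo, hi, h]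
  have hil := i.2
  funext k
  simp only [comp_swap_apply, heckeStep_apply]
  simp only [lo, hi] at h0 ⊢
  grind

/-- The family `Ẽ` satisfies the recurrence under every Hecke step. The induction is on the size
of `α` and then on the weighted sum of its entries; the position of the first nonzero entry
decides which braid or rotation relation applies. -/
lemma macdonaldE_heckeStep (α : Fin ℓ → ℕ) (i : Fin (ℓ - 1)) :
    macdonaldE (heckeStep i α) = demazureP i (macdonaldE α) := by
  induction hs : ∑ k, α k using Nat.strong_induction_on generalizing α i with
  | _ s ih1 =>
  induction hw : wsum α using Nat.strong_induction_on generalizing α i with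
  | _ w ih2 =>
  subst hs hw
  have IH1 : ∀ β : Fin ℓ → ℕ, ∑ k, β k < ∑ k, α k → ∀ i,
      macdonaldE (heckeStep i β) = demazureP i (macdonaldE β) :=
    fun β hβ i => ih1 _ hβ β i rfl
  have IH2 : ∀ β : Fin ℓ → ℕ, ∑ k, β k = ∑ k, α k → wsum β < wsum α → ∀ i,
      macdonaldE (heckeStep i β) = demazureP i (macdonaldE β) :=
    fun β hβ hβ' i => ih2 _ hβ' β i hβ rfl
  clear ih1 ih2
  have hil := i.2
  have hℓ : 0 < ℓ := by omega
  by_cases h0 : α ⟨0, hℓ⟩ = 0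
  · by_cases hz : α = 0
    · subst hz
      rw [heckeStep_of_le le_rfl, macdonaldE_zero, demazureP_one]
    obtain ⟨j, hj⟩ := exists_firstAt (fun _ => h0) hz
    have hjl := j.2
    have hαlo : α (lo j) = 0 := hj.1 _ le_rfl
    set α' := α ∘ Equiv.swap (lo j) (hi j) with hα'
    have eα : macdonaldE α = demazureP j (macdonaldE α') := macdonaldE_of_firstAt hj
    have sα' : ∑ k, α' k = ∑ k, α k := sum_swap α _ _
    have wα' : wsum α' + α (hi j) = wsum α := by
      have := wsum_comp_swap α j
      rwa [hαlo, add_zero] at this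
    have hj2 := hj.2
    have iα' := IH2 α' sα' (by omega)
    rcases lt_trichotomy i.1 j.1 with hij | hij | hij
    · have hz : ∀ k : Fin ℓ, k.1 ≤ j.1 → α k = 0 := fun k hk => hj.1 k hk
      have st : heckeStep i α = α :=
        heckeStep_of_le (by rw [hz (lo i) (by simp only [lo]; omega)]; exact Nat.zero_le _)
      rw [st]
      rcases Nat.lt_or_ge (i.1 + 1) j.1 with h1 | h1
      · -- The step is far to the left of the first nonzero entry.
        have st' : heckeStep i α' = α' := by
          apply heckeStep_of_le
          rw [hα', comp_swap_apply, if_neg (by simp only [lo]; omega),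
            if_neg (by simp only [lo]; omega), hz (lo i) (by simp only [lo]; omega)]
          exact Nat.zero_le _
        have := iα' i
        rw [st'] at this
        rw [eα, demazureP_comm i j h1, ← this]
      · -- The step is adjacent to the first nonzero entry `a`, on the left: `α` reads `(0, 0, a)`,
        -- and `α''` reads `(a, 0, 0)`.
        have h1' : i.1 + 1 = j.1 := by omega
        have hF : FirstAt i α' := by
          constructor
          · intro k hk
            have hk' : k.1 ≤ i.1 := hk
            rw [hα', comp_swap_apply, if_neg (by omega), if_neg (by omega), hz k (by omega)]
          · rw [hα', comp_swap_apply, if_pos (by simp only [hi]; omega)]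
            exact hj2
        have eα' := macdonaldE_of_firstAt hF
        have wα'' := wsum_comp_swap α' i
        set α'' := α' ∘ Equiv.swap (lo i) (hi i) with hα''
        have sα'' : ∑ k, α'' k = ∑ k, α k := (sum_swap α' _ _).trans sα'
        have hlo' : α' (lo i) = 0 := hF.1 _ le_rfl
        have st'' : heckeStep j α'' = α'' := by
          apply heckeStep_of_le
          rw [hα'', comp_swap_apply, if_neg (by simp only [lo]; omega),
            if_pos (by simp only [lo]; omega), hlo']
          exact Nat.zero_le _
        have := IH2 α'' sα'' (by omega) j
        rw [st''] at this
        rw [eα, eα', demazureP_braid i j h1', ← this]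
    · obtain rfl : i = j := Fin.ext hij
      rw [heckeStep_of_le (by rw [hαlo]; exact Nat.zero_le _), eα, demazureP_idem]
    · rcases Nat.lt_or_ge (j.1 + 1) i.1 with h1 | h1
      · -- The step is far to the right of the first nonzero entry.
        have hF : FirstAt j (heckeStep i α) := by
          constructor
          · intro k hk
            have hk' : k.1 ≤ j.1 := hk
            rw [heckeStep_apply, if_neg (by omega), if_neg (by omega)]
            exact hj.1 k hk
          · rw [heckeStep_apply, if_neg (by simp only [hi]; omega),
              if_neg (by simp only [hi]; omega)]
            exact hj2
        rw [macdonaldE_of_firstAt hF, heckeStep_comp_swap_of_far h1, iα', demazureP_comm j i h1, ← eα]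
      · have h1' : j.1 + 1 = i.1 := by omega
        have elo : lo i = hi j := by simp [lo, hi, h1']
        by_cases hb : α (hi i) = 0
        · -- The step moves the first nonzero entry to the right; `Ẽ` at the moved exponent is
          -- defined by undoing this step.
          have st : heckeStep i α = α ∘ Equiv.swap (lo i) (hi i) := by
            apply heckeStep_of_lt
            rw [hb, elo]
            omega
          have hF : FirstAt i (α ∘ Equiv.swap (lo i) (hi i)) := by
            constructor
            · intro k hk
              have hk' : k.1 ≤ i.1 := hk
              rw [comp_swap_apply]
              split_ifs with h2 h3
              · exact hb
              · omega
              · exact hj.1 k (by simp only [lo, Fin.le_def]; omega)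
            · simpa [elo] using hj2
          have e : (α ∘ Equiv.swap (lo i) (hi i)) ∘ Equiv.swap (lo i) (hi i) = α := by
            funext k; simp
          rw [st, macdonaldE_of_firstAt hF, e]
        · -- Around the first nonzero entry `α` reads `(0, a, b)` with `a, b > 0`, and `γ` reads
          -- `(a, b, 0)`.
          have wγ := wsum_comp_swap α' i
          set γ := α' ∘ Equiv.swap (lo i) (hi i) with hγ
          have sγ : ∑ k, γ k = ∑ k, α k := (sum_swap α' _ _).trans sα'
          have a1 : α' (lo i) = 0 := by
            rw [hα', comp_swap_apply, if_neg (by simp only [lo]; omega),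
              if_pos (by simp only [lo]; omega), hαlo]
          have a2 : α' (hi i) = α (hi i) := by
            rw [hα', comp_swap_apply, if_neg (by simp only [hi]; omega),
              if_neg (by simp only [hi]; omega)]
          have a3 : α' (lo j) = α (hi j) := by simp [hα']
          have hγlo : γ (lo j) = α (hi j) := by
            rw [hγ, comp_swap_apply, if_neg (by simp only [lo]; omega),
              if_neg (by simp only [lo]; omega), a3]
          have hγhi : γ (hi j) = α (hi i) := by
            rw [hγ, comp_swap_apply, if_pos (by simp only [hi]; omega), a2]
          have stγ : heckeStep i γ = α' := by
            apply heckeStep_comp_swap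
            rw [a1, a2]
            omega
          have e1 := IH2 γ sγ (by omega) i
          rw [stγ] at e1
          have e2 := IH2 γ sγ (by omega) j
          have e3 := IH2 (heckeStep j γ) ((sum_heckeStep _ _).trans sγ) (by
            have := wsum_comp_swap γ j
            unfold heckeStep
            split_ifs <;> omega) i
          have hF : FirstAt j (heckeStep i α) := by
            constructor
            · intro k hk
              have hk' : k.1 ≤ j.1 := hk
              rw [heckeStep_apply, if_neg (by omega), if_neg (by omega)]
              exact hj.1 k hk
            · rw [heckeStep_apply, if_pos (by simp only [hi]; omega), elo]
              omega
          have e4 := heckeStep_comp_swap_of_near h1' hαlo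
          rw [macdonaldE_of_firstAt hF, e4, e3, e2, eα, e1, demazureP_braid j i h1']
  · by_cases hi0 : i.1 = 0
    · have hlo : lo i = ⟨0, hℓ⟩ := Fin.ext hi0
      by_cases hα1 : α (hi i) = 0
      · have st : heckeStep i α = α ∘ Equiv.swap (lo i) (hi i) := by
          apply heckeStep_of_lt
          rw [hα1, hlo]
          omega
        have hF : FirstAt i (α ∘ Equiv.swap (lo i) (hi i)) := by
          constructor
          · intro k hk
            have hk' : k.1 ≤ i.1 := hk
            rw [comp_swap_apply, if_pos (by omega), hα1]
          · simpa [hlo] using h0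
        have e : (α ∘ Equiv.swap (lo i) (hi i)) ∘ Equiv.swap (lo i) (hi i) = α := by
          funext k; simp
        rw [st, macdonaldE_of_firstAt hF, e]
      · -- Two nonzero entries in front: after undoing two rotations they stand at the end, and the
        -- step becomes one at the last position.
        have lrot : ∀ β : Fin ℓ → ℕ, β (lo i) ≠ 0 → β (hi i) ≠ 0 →
            macdonaldE β = rotP hℓ (rotP hℓ (macdonaldE (unrotate (unrotate β)))) := by
          intro β hβ hβ'
          rw [hlo] at hβ
          rw [macdonaldE_of_ne_zero hℓ hβ, macdonaldE_of_ne_zero hℓ]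
          unfold unrotate
          rw [dif_pos (by simp only; omega)]
          convert hβ' using 2
          ext
          simp [hi, hi0]
        have hαlo : α (lo i) ≠ 0 := by rwa [hlo]
        have hs1 : ∑ k, unrotate α k < ∑ k, α k := sum_unrotate_lt hℓ h0
        have hs2 : ∑ k, unrotate (unrotate α) k ≤ ∑ k, unrotate α k := by
          apply (sum_unrotate_lt hℓ _).le
          unfold unrotate
          rw [dif_pos (by simp only; omega)]
          convert hα1 using 2
          ext
          simp [hi, hi0]
        have hlast : (⟨ℓ - 2, by omega⟩ : Fin (ℓ - 1)).1 + 2 = ℓ := by simp only; omega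
        rw [lrot _ ?_ ?_, lrot α hαlo hα1, unrotate_unrotate_heckeStep hlast hi0 hαlo hα1,
          IH1 _ (by omega), rotP_rotP_demazureP hℓ hlast hi0]
        · rw [heckeStep_apply, if_pos (show (lo i).1 = i.1 from rfl)]; omega
        · rw [heckeStep_apply, if_neg (by simp [hi]),
            if_pos (show (hi i).1 = i.1 + 1 from rfl)]
          omega
    · -- Undoing one rotation shifts the step by one position.
      have hj : (⟨i.1 - 1, by omega⟩ : Fin (ℓ - 1)).1 + 1 = i.1 := by simp only; omega
      rw [macdonaldE_of_ne_zero hℓ h0, macdonaldE_of_ne_zero hℓ, unrotate_heckeStep hj,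
        IH1 _ (sum_unrotate_lt hℓ h0), rotP_demazureP hℓ hj]
      rw [heckeStep_apply, if_neg (by simp only; omega), if_neg (by simp only; omega)]
      exact h0

lemma knopSahi_macdonaldE (ℓ : ℕ) : KnopSahi ℓ macdonaldE where
  zero := macdonaldE_zero
  step i α := macdonaldE_heckeStep α i
  rot h α := by
    rw [macdonaldE_of_ne_zero h (α := rotate α) (by simp [rotate]), unrotate_rotate]
    rfl

/-- The recurrence determines the family. -/
lemma KnopSahi.eq_macdonaldE {E : (Fin ℓ → ℕ) → PolyRing ℓ} (hE : KnopSahi ℓ E) :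
    E = macdonaldE := by
  funext α
  induction hs : ∑ k, α k using Nat.strong_induction_on generalizing α with
  | _ s ih1 =>
  induction hw : wsum α using Nat.strong_induction_on generalizing α with
  | _ w ih2 =>
  subst hs hw
  by_cases h0 : ∃ h : 0 < ℓ, α ⟨0, h⟩ ≠ 0
  · obtain ⟨h, h0⟩ := h0
    rw [macdonaldE_of_ne_zero h h0, ← ih1 _ (sum_unrotate_lt h h0) (unrotate α) rfl]
    conv_lhs => rw [← rotate_unrotate h h0]
    exact hE.rot h _
  · push Not at h0
    by_cases hz : α = 0
    · rw [hz, hE.zero, macdonaldE_zero]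
    · obtain ⟨i, hi'⟩ := exists_firstAt h0 hz
      have h1 : α (lo i) = 0 := hi'.1 _ le_rfl
      have h2 := hi'.2
      have h3 := wsum_comp_swap α i
      rw [macdonaldE_of_firstAt hi', ← ih2 _ (by omega) (α ∘ Equiv.swap (lo i) (hi i))
        (sum_swap α _ _) rfl, ← hE.step, heckeStep_comp_swap (by omega)]

lemma macdonaldE_heckeAct (z : ZeroHecke ℓ) (α : Fin ℓ → ℕ) :
    macdonaldE (heckeAct ℓ ℕ z α) = demazurePW ℓ z (macdonaldE α) := by
  induction z using hecke_induction with
  | one => rw [heckeAct_one, demazurePW_one]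
  | gen_mul i z ih => rw [heckeAct_mul, heckeAct_gen, macdonaldE_heckeStep, ih, demazurePW_mul,
      demazurePW_gen]

lemma macdonaldE_rotate (h : 0 < ℓ) (α : Fin ℓ → ℕ) :
    macdonaldE (rotate α) = rotP h (macdonaldE α) := (knopSahi_macdonaldE ℓ).rot h α

end Recurrence

/-! ### Laurent polynomials with prescribed support -/

section LaurentSupport

variable {ℓ : ℕ}

/-- The Laurent polynomials all of whose exponents lie in `s`. -/
def suppIn (s : Set (Fin ℓ → ℤ)) : Submodule ℤ (Laurent ℓ) where
  carrier := {f | ∀ a, f.coeff a ≠ 0 → a ∈ s}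
  zero_mem' := by simp
  add_mem' := by
    intro f g hf hg a h
    by_contra ha
    exact h (by simp [not_imp_comm.1 (hf a) ha, not_imp_comm.1 (hg a) ha])
  smul_mem' := by
    intro c f hf a h
    apply hf
    intro h0
    exact h (by rw [AddMonoidAlgebra.coeff_smul_apply, h0, smul_zero])

lemma coeff_eq_zero_of_mem_suppIn {s : Set (Fin ℓ → ℤ)} {f : Laurent ℓ} (hf : f ∈ suppIn s)
    {a : Fin ℓ → ℤ} (ha : a ∉ s) : f.coeff a = 0 := by
  by_contra h
  exact ha (hf a h)

lemma suppIn_mono {s t : Set (Fin ℓ → ℤ)} (h : s ⊆ t) : suppIn s ≤ suppIn t :=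
  fun _ hf a ha => h (hf a ha)

lemma coeff_mono (a b : Fin ℓ → ℤ) [Decidable (a = b)] :
    (mono a).coeff b = if a = b then 1 else 0 := by
  simp [mono, Finsupp.single_apply]

lemma mono_mem_suppIn {s : Set (Fin ℓ → ℤ)} {a : Fin ℓ → ℤ} (h : a ∈ s) : mono a ∈ suppIn s := by
  classical
  intro b hb
  rw [coeff_mono] at hb
  by_cases hab : a = b
  · rwa [← hab]
  · simp [hab] at hb

lemma eq_sum_mono (f : Laurent ℓ) : f = ∑ a ∈ f.coeff.support, f.coeff a • mono a := by
  conv_lhs => rw [← AddMonoidAlgebra.sum_coeff_single f]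
  unfold Finsupp.sum
  apply Finset.sum_congr rfl
  intro a _
  simp [mono]

lemma suppIn_induction {s : Set (Fin ℓ → ℤ)} {K : Submodule ℤ (Laurent ℓ)}
    (h : ∀ a ∈ s, mono a ∈ K) : suppIn s ≤ K := by
  intro f hf
  rw [eq_sum_mono f]
  exact K.sum_mem fun a ha => K.smul_mem _ (h a (hf a (Finsupp.mem_support_iff.1 ha)))

lemma mul_mem_suppIn {s t u : Set (Fin ℓ → ℤ)} (h : ∀ a ∈ s, ∀ b ∈ t, a + b ∈ u)
    {f g : Laurent ℓ} (hf : f ∈ suppIn s) (hg : g ∈ suppIn t) : f * g ∈ suppIn u := by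
  classical
  intro c hc
  have h1 := AddMonoidAlgebra.support_coeff_mul_subset f g (Finsupp.mem_support_iff.2 hc)
  obtain ⟨a, ha, b, hb, rfl⟩ := Finset.mem_add.1 h1
  exact h a (hf a (Finsupp.mem_support_iff.1 ha)) b (hg b (Finsupp.mem_support_iff.1 hb))

lemma coeff_mono_mul (a b : Fin ℓ → ℤ) (f : Laurent ℓ) :
    (mono a * f).coeff b = f.coeff (b - a) := by
  rw [mono, AddMonoidAlgebra.coeff_single_mul_apply, one_mul, neg_add_eq_sub]

lemma coeff_permL (σ : Equiv.Perm (Fin ℓ)) (f : Laurent ℓ) (a : Fin ℓ → ℤ) :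
    (permL σ f).coeff a = f.coeff (a ∘ σ) := by
  classical
  induction f using AddMonoidAlgebra.induction_linear with
  | zero => simp
  | add f g hf hg => rw [map_add]; simp [hf, hg]
  | single b r =>
    have e : AddMonoidAlgebra.single b r = r • mono b := by simp [mono]
    rw [e, map_zsmul, permL_mono]
    simp only [AddMonoidAlgebra.coeff_smul, Finsupp.smul_apply, coeff_mono]
    congr 2
    rw [eq_iff_iff]
    constructor
    · rintro rfl; funext k; simp
    · rintro rfl; funext k; simp

lemma permL_mem_suppIn (σ : Equiv.Perm (Fin ℓ)) {s t : Set (Fin ℓ → ℤ)}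
    (h : ∀ a, a ∘ σ ∈ s → a ∈ t) {f : Laurent ℓ} (hf : f ∈ suppIn s) : permL σ f ∈ suppIn t := by
  intro a ha
  rw [coeff_permL] at ha
  exact h a (hf _ ha)

/-! ### Demazure operators on Laurent polynomials -/

/-- The exchange of the variables `x_i`, `x_{i+1}` in a Laurent polynomial. -/
def swapL (i : Fin (ℓ - 1)) : Laurent ℓ →+* Laurent ℓ := permL (Equiv.swap (lo i) (hi i))

lemma swapL_swapL (i : Fin (ℓ - 1)) (f : Laurent ℓ) : swapL i (swapL i f) = f := by
  unfold swapL
  rw [permL_mul, Equiv.swap_mul_self, permL_one]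

lemma xL_lo_sub_ne_zero (i : Fin (ℓ - 1)) : (xL (lo i) - xL (hi i) : Laurent ℓ) ≠ 0 :=
  sub_ne_zero.2 (xL_injective.ne (lo_ne_hi i))

lemma demazureL_spec (i : Fin (ℓ - 1)) (f : Laurent ℓ) :
    (xL (lo i) - xL (hi i)) * demazureL i f = xL (lo i) * f - xL (hi i) * swapL i f :=
  demazureOp_spec (dvd_sub_swap _ _) f

lemma demazureL_eq_of {i : Fin (ℓ - 1)} {f g : Laurent ℓ}
    (h : (xL (lo i) - xL (hi i)) * g = xL (lo i) * f - xL (hi i) * swapL i f) :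
    demazureL i f = g :=
  mul_left_cancel₀ (xL_lo_sub_ne_zero i) ((demazureL_spec i f).trans h.symm)

/-- The Demazure operator `π_i` as a linear map. -/
def demazureLin (i : Fin (ℓ - 1)) : Laurent ℓ →ₗ[ℤ] Laurent ℓ :=
  (AddMonoidHom.mk' (demazureL i) fun f g => demazureL_eq_of (by
    rw [map_add]
    linear_combination demazureL_spec i f + demazureL_spec i g)).toIntLinearMap

lemma demazureLin_apply (i : Fin (ℓ - 1)) (f : Laurent ℓ) : demazureLin i f = demazureL i f := rfl

lemma demazureL_of_swapL_eq {i : Fin (ℓ - 1)} {f : Laurent ℓ} (h : swapL i f = f) :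
    demazureL i f = f :=
  demazureL_eq_of (by rw [h]; ring)

lemma demazureW_gen (i : Fin (ℓ - 1)) (f : Laurent ℓ) : demazureW ℓ (gen i) f = demazureL i f :=
  rfl

lemma demazureW_one (f : Laurent ℓ) : demazureW ℓ 1 f = f := by
  rw [map_one]; rfl

lemma demazureW_mul (z w : ZeroHecke ℓ) (f : Laurent ℓ) :
    demazureW ℓ (z * w) f = demazureW ℓ z (demazureW ℓ w f) := by
  rw [map_mul]; rfl

/-- The operator `π_w` as a linear map. -/
lemma exists_linearMap_demazureW (w : ZeroHecke ℓ) :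
    ∃ T : Laurent ℓ →ₗ[ℤ] Laurent ℓ, ∀ f, T f = demazureW ℓ w f := by
  induction w using hecke_induction with
  | one => exact ⟨LinearMap.id, fun f => (demazureW_one f).symm⟩
  | gen_mul i z ih =>
    obtain ⟨T, hT⟩ := ih
    exact ⟨(demazureLin i).comp T, fun f => by
      rw [LinearMap.comp_apply, hT, demazureLin_apply, demazureW_mul, demazureW_gen]⟩

/-- The exponent of `x_i / x_j`. -/
def rootVec (i j : Fin ℓ) : Fin ℓ → ℤ := Pi.single i 1 - Pi.single j 1

/-- The simple root `e_i - e_{i+1}`. -/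
def simpleRoot (i : Fin (ℓ - 1)) : Fin ℓ → ℤ := rootVec (lo i) (hi i)

lemma simpleRoot_lo (i : Fin (ℓ - 1)) : simpleRoot i (lo i) = 1 := by
  simp [simpleRoot, rootVec, Pi.single_eq_of_ne (lo_ne_hi i)]

lemma simpleRoot_hi (i : Fin (ℓ - 1)) : simpleRoot i (hi i) = -1 := by
  simp [simpleRoot, rootVec, Pi.single_eq_of_ne (lo_ne_hi i).symm]

lemma simpleRoot_of_ne {i : Fin (ℓ - 1)} {k : Fin ℓ} (h1 : k ≠ lo i) (h2 : k ≠ hi i) :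
    simpleRoot i k = 0 := by
  simp [simpleRoot, rootVec, Pi.single_eq_of_ne h1, Pi.single_eq_of_ne h2]

lemma xL_hi_mul_simpleRoot (i : Fin (ℓ - 1)) : xL (hi i) * mono (simpleRoot i) = xL (lo i) := by
  unfold xL
  rw [← mono_add, simpleRoot, rootVec, add_sub_cancel]

lemma comp_swap_eq_add_smul (a : Fin ℓ → ℤ) (i : Fin (ℓ - 1)) :
    a ∘ Equiv.swap (lo i) (hi i) = a + (a (hi i) - a (lo i)) • simpleRoot i := by
  funext k
  by_cases h1 : k = lo i
  · subst h1; simp [simpleRoot_lo]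
  · by_cases h2 : k = hi i
    · subst h2; simp [simpleRoot_hi]
    · simp [simpleRoot_of_ne h1 h2, Equiv.swap_apply_of_ne_of_ne h1 h2]

lemma swapL_mono (i : Fin (ℓ - 1)) (a : Fin ℓ → ℤ) :
    swapL i (mono a) = mono (a ∘ Equiv.swap (lo i) (hi i)) := by
  rw [swapL, permL_mono, Equiv.symm_swap]

/-- The geometric sum for `π_i` on a monomial `x^a` with `a_i ≥ a_{i+1}`. -/
lemma demazureL_mono (i : Fin (ℓ - 1)) (a : Fin ℓ → ℤ) (n : ℕ) (hn : a (lo i) - a (hi i) = n) :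
    demazureL i (mono a) = ∑ k ∈ Finset.range (n + 1), mono (a - (k : ℤ) • simpleRoot i) := by
  have tel : ∀ m : ℕ, (xL (lo i) - xL (hi i)) *
      ∑ k ∈ Finset.range m, mono (a - (k : ℤ) • simpleRoot i) =
      xL (lo i) * mono a - xL (lo i) * mono (a - (m : ℤ) • simpleRoot i) := by
    intro m
    induction m with
    | zero => simp
    | succ m ih =>
      have e : mono (a - (m : ℤ) • simpleRoot i) =
          mono (simpleRoot i) * mono (a - ((m + 1 : ℕ) : ℤ) • simpleRoot i) := by
        rw [← mono_add]
        congr 1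
        push_cast
        rw [add_smul, one_smul]
        abel
      rw [Finset.sum_range_succ, mul_add, ih]
      have e' := xL_hi_mul_simpleRoot i
      linear_combination (-xL (hi i)) * e -
        mono (a - ((m + 1 : ℕ) : ℤ) • simpleRoot i) * e'
  apply demazureL_eq_of
  rw [tel, swapL_mono, comp_swap_eq_add_smul]
  have e : xL (lo i) * mono (a - ((n + 1 : ℕ) : ℤ) • simpleRoot i) =
      xL (hi i) * mono (a + (a (hi i) - a (lo i)) • simpleRoot i) := by
    rw [← xL_hi_mul_simpleRoot, mul_assoc, ← mono_add]
    congr 2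
    have : a (hi i) - a (lo i) = -(n : ℤ) := by omega
    rw [this]
    push_cast
    rw [add_smul, one_smul, neg_smul]
    abel
  rw [e]

lemma demazureL_add_swap (i : Fin (ℓ - 1)) (f : Laurent ℓ) :
    demazureL i f = f + swapL i f - demazureL i (swapL i f) := by
  have h : demazureL i (f + swapL i f) = f + swapL i f :=
    demazureL_of_swapL_eq (by rw [map_add, swapL_swapL, add_comm])
  rw [← h, ← demazureLin_apply i (_ + _), map_add, demazureLin_apply, demazureLin_apply]
  ring

/-! ### Ordinary polynomials -/

/-- The polynomials, inside the ring of Laurent polynomials. -/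
def posPart (ℓ : ℕ) : Submodule ℤ (Laurent ℓ) := suppIn {a | 0 ≤ a}

lemma demazureL_mem_posPart (i : Fin (ℓ - 1)) {f : Laurent ℓ} (hf : f ∈ posPart ℓ) :
    demazureL i f ∈ posPart ℓ := by
  have dom : ∀ a : Fin ℓ → ℤ, 0 ≤ a → a (hi i) ≤ a (lo i) →
      demazureL i (mono a) ∈ posPart ℓ := by
    intro a ha hle
    rw [demazureL_mono i a (a (lo i) - a (hi i)).toNat (by omega)]
    refine Submodule.sum_mem _ fun k hk => mono_mem_suppIn fun j => ?_
    have hk' := Finset.mem_range.1 hk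
    have hj := ha j
    have hh := ha (hi i)
    simp only [Pi.zero_apply] at hj hh
    simp only [Pi.zero_apply, Pi.sub_apply, Pi.smul_apply, smul_eq_mul]
    by_cases h1 : j = lo i
    · subst h1; rw [simpleRoot_lo]; omega
    · by_cases h2 : j = hi i
      · subst h2; rw [simpleRoot_hi]; omega
      · rw [simpleRoot_of_ne h1 h2]; omega
  have : posPart ℓ ≤ (posPart ℓ).comap (demazureLin i) := by
    apply suppIn_induction
    intro a ha
    rw [Submodule.mem_comap, demazureLin_apply]
    rcases le_total (a (hi i)) (a (lo i)) with h | h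
    · exact dom a ha h
    · have hs : swapL i (mono a) ∈ posPart ℓ := by
        rw [swapL_mono]
        exact mono_mem_suppIn fun k => ha _
      rw [demazureL_add_swap]
      refine Submodule.sub_mem _ (Submodule.add_mem _ (mono_mem_suppIn ha) hs) ?_
      rw [swapL_mono]
      exact dom _ (fun k => ha _) (by simpa using h)
  exact this hf

/-! ### The complement of the polynomials -/

/-- The denominator `∏_{i < j} (1 - x_i / x_j)` over the positions in `J`. -/
def rootProd (J : Finset (Fin ℓ)) : Laurent ℓ :=
  ∏ p ∈ (J ×ˢ J).filter (fun p => p.1 < p.2), (1 - mono (rootVec p.1 p.2))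

/-- The exponents that are negative somewhere on `J`. -/
def negOn (J : Finset (Fin ℓ)) : Set (Fin ℓ → ℤ) := {a | ∃ j ∈ J, a j < 0}

/-- The Laurent polynomials `f` such that every monomial of `f ∏_{i < j ∈ J} (1 - x_i / x_j)` has
a negative exponent on `J`. For `J` the set of all positions this is the kernel of polynomial
truncation. -/
def negPart (J : Finset (Fin ℓ)) : Submodule ℤ (Laurent ℓ) :=
  (suppIn (negOn J)).comap (LinearMap.mulRight ℤ (rootProd J))

lemma mem_negPart {J : Finset (Fin ℓ)} {f : Laurent ℓ} :
    f ∈ negPart J ↔ f * rootProd J ∈ suppIn (negOn J) := Iff.rfl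

lemma mul_mem_negPart {J : Finset (Fin ℓ)} {f g : Laurent ℓ} (hf : f ∈ negPart J)
    (hg : g ∈ suppIn {a | ∀ j ∈ J, a j ≤ 0}) : g * f ∈ negPart J := by
  rw [mem_negPart] at hf ⊢
  rw [mul_assoc]
  refine mul_mem_suppIn ?_ hg hf
  rintro a ha b ⟨j, hj, hb⟩
  refine ⟨j, hj, ?_⟩
  have := ha j hj
  simp only [Pi.add_apply]
  omega

lemma swapL_rootProd_erase (i : Fin (ℓ - 1)) {J : Finset (Fin ℓ)} (h1 : lo i ∈ J)
    (h2 : hi i ∈ J) : ∃ D : Laurent ℓ, swapL i D = D ∧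
      rootProd J = (1 - mono (simpleRoot i)) * D := by
  have hmem : (lo i, hi i) ∈ (J ×ˢ J).filter (fun p => p.1 < p.2) :=
    Finset.mem_filter.2 ⟨Finset.mem_product.2 ⟨h1, h2⟩, lo_lt_hi i⟩
  refine ⟨∏ p ∈ ((J ×ˢ J).filter (fun p => p.1 < p.2)).erase (lo i, hi i),
    (1 - mono (rootVec p.1 p.2)), ?_, (Finset.mul_prod_erase _ _ hmem).symm⟩
  rw [map_prod]
  set s := Equiv.swap (lo i) (hi i) with hs
  have hsJ : ∀ k, k ∈ J → s k ∈ J := by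
    intro k hk
    rw [hs, Equiv.swap_apply_def]
    split_ifs <;> assumption
  have hmaps : ∀ p : Fin ℓ × Fin ℓ,
      p ∈ ((J ×ˢ J).filter (fun p => p.1 < p.2)).erase (lo i, hi i) →
      (s p.1, s p.2) ∈ ((J ×ˢ J).filter (fun p => p.1 < p.2)).erase (lo i, hi i) := by
    rintro ⟨a, b⟩ hp
    simp only [Finset.mem_erase, Finset.mem_filter, Finset.mem_product, ne_eq, Prod.mk.injEq]
      at hp ⊢
    obtain ⟨h3, ⟨h4, h5⟩, h6⟩ := hp
    refine ⟨?_, ⟨hsJ _ h4, hsJ _ h5⟩, swap_lt_swap h6 h3⟩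
    rintro ⟨h7, h8⟩
    have h7' : a = hi i := by
      have := congrArg s h7
      simpa [hs] using this
    have h8' : b = lo i := by
      have := congrArg s h8
      simpa [hs] using this
    rw [h7', h8'] at h6
    exact lt_asymm h6 (lo_lt_hi i)
  refine Finset.prod_bij' (fun p _ => (s p.1, s p.2)) (fun p _ => (s p.1, s p.2)) hmaps hmaps
    (by simp [hs]) (by simp [hs]) ?_
  rintro ⟨a, b⟩ _
  rw [map_sub, map_one, swapL_mono]
  congr 2
  funext k
  have e : ∀ c, (Pi.single c (1 : ℤ) : Fin ℓ → ℤ) (s k) = (Pi.single (s c) 1 : Fin ℓ → ℤ) k := by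
    intro c
    simp only [Pi.single_apply]
    congr 1
    rw [eq_iff_iff]
    constructor
    · rintro rfl; simp [hs]
    · rintro rfl; simp [hs]
  simp only [rootVec, Function.comp_apply, Pi.sub_apply]
  rw [← hs, e, e]

/-- A function that is locally constant on a string of integers takes equal values on it. -/
lemma string_const (h : ℤ → ℤ) (p r : ℕ) (hc : ∀ j : ℤ, -p ≤ j → j ≤ r → h j = h (j - 1)) :
    h (r - p) = h (-1) := by
  have up : ∀ n : ℕ, n ≤ r + 1 → h (-1 + n) = h (-1) := by
    intro n
    induction n with
    | zero => intro _; simp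
    | succ n ih =>
      intro hn
      rw [hc _ (by push_cast; omega) (by push_cast; omega), ← ih (by omega)]
      congr 1
      push_cast
      ring
  have down : ∀ n : ℕ, n ≤ p → h (-1 - n) = h (-1) := by
    intro n
    induction n with
    | zero => intro _; simp
    | succ n ih =>
      intro hn
      rw [← ih (by omega), hc (-1 - n) (by omega) (by omega)]
      congr 1
      push_cast
      ring
  rcases le_or_gt p (r + 1) with h1 | h1
  · have := up (r + 1 - p) (by omega)
    rw [← this]
    congr 1
    omega
  · have := down (p - (r + 1)) (by omega)
    rw [← this]
    congr 1
    omega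

/-- The Demazure operators inside `J` preserve `negPart J`. Up to a factor symmetric in
`x_i, x_{i+1}`, the coefficients of `f` are constant along the nonnegative part of each `i`-string,
so that those of `s_i f - (x_i / x_{i+1}) f` vanish there. -/
lemma demazureL_mem_negPart {i : Fin (ℓ - 1)} {J : Finset (Fin ℓ)} (h1 : lo i ∈ J)
    (h2 : hi i ∈ J) {f : Laurent ℓ} (hf : f ∈ negPart J) : demazureL i f ∈ negPart J := by
  obtain ⟨D, hD, hJ⟩ := swapL_rootProd_erase i h1 h2
  rw [mem_negPart, hJ] at hf ⊢
  set y := mono (simpleRoot i) with hy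
  have key : demazureL i f * ((1 - y) * D) = swapL i (f * D) - y * (f * D) := by
    have hx : xL (hi i) * y = xL (lo i) := xL_hi_mul_simpleRoot i
    have hne : (xL (hi i) : Laurent ℓ) ≠ 0 := by
      intro h0
      have := congrArg (fun g : Laurent ℓ => g.coeff (Pi.single (hi i) 1)) h0
      simp [xL, mono] at this
    apply mul_left_cancel₀ hne
    rw [map_mul, hD]
    linear_combination (-D) * demazureL_spec i f + (f * D - demazureL i f * D) * hx
  rw [key]
  intro a ha
  by_contra hneg
  apply ha
  have hpos : ∀ j ∈ J, 0 ≤ a j := by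
    intro j hj
    by_contra hc
    exact hneg ⟨j, hj, not_le.1 hc⟩
  set v := f * D
  have hv : ∀ b : Fin ℓ → ℤ, (∀ j ∈ J, 0 ≤ b j) → v.coeff b = v.coeff (b - simpleRoot i) := by
    intro b hb
    have hnb : b ∉ negOn J := by
      rintro ⟨j, hj, hlt⟩
      exact absurd (hb j hj) (not_le.2 hlt)
    have := coeff_eq_zero_of_mem_suppIn hf hnb
    rw [mul_comm, mul_assoc, mul_comm D f, sub_mul, one_mul, AddMonoidAlgebra.coeff_sub,
      Finsupp.sub_apply, hy, coeff_mono_mul] at this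
    linarith
  have hs := string_const (fun j => v.coeff (a + j • simpleRoot i)) (a (lo i)).toNat
    (a (hi i)).toNat (by
      intro j hj1 hj2
      have b1 := hpos _ h1
      have b2 := hpos _ h2
      rw [hv]
      · congr 1
        rw [sub_smul, one_smul, add_sub_assoc]
      · intro k hk
        simp only [Pi.add_apply, Pi.smul_apply, smul_eq_mul]
        by_cases e1 : k = lo i
        · subst e1; rw [simpleRoot_lo]; omega
        · by_cases e2 : k = hi i
          · subst e2; rw [simpleRoot_hi]; omega
          · rw [simpleRoot_of_ne e1 e2]
            simpa using hpos k hk)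
  rw [AddMonoidAlgebra.coeff_sub, Finsupp.sub_apply, hy, coeff_mono_mul, swapL, coeff_permL,
    comp_swap_eq_add_smul, sub_eq_zero]
  rw [Int.toNat_of_nonneg (hpos _ h1), Int.toNat_of_nonneg (hpos _ h2)] at hs
  rw [hs, neg_smul, one_smul, sub_eq_add_neg]

/-! ### Leading exponents -/

/-- If an additive statistic is negative on all roots `e_i - e_j` with `i < j`, then the product of
the `1 - x_i / x_j` is `1` plus terms where the statistic is negative. -/
lemma rootProd_sub_one_mem {Γ : Type*} [AddCommGroup Γ] [LinearOrder Γ] [IsOrderedAddMonoid Γ]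
    (φ : (Fin ℓ → ℤ) →+ Γ) (hφ : ∀ i j : Fin ℓ, i < j → φ (rootVec i j) < 0)
    (J : Finset (Fin ℓ)) : rootProd J - 1 ∈ suppIn {a | φ a < 0} := by
  unfold rootProd
  suffices ∀ s : Finset (Fin ℓ × Fin ℓ), (∀ p ∈ s, p.1 < p.2) →
      ∏ p ∈ s, (1 - mono (rootVec p.1 p.2)) - 1 ∈ suppIn {a | φ a < 0} from
    this _ fun p hp => (Finset.mem_filter.1 hp).2
  intro s
  induction s using Finset.induction_on with
  | empty => simp
  | insert p s hp ih =>
    intro this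
    rw [Finset.prod_insert hp]
    have ih := ih fun p hp => this p (Finset.mem_insert_of_mem hp)
    set D := ∏ p ∈ s, (1 - mono (rootVec p.1 p.2))
    have e : (1 - mono (rootVec p.1 p.2)) * D - 1 =
        (D - 1) - mono (rootVec p.1 p.2) * (D - 1) - mono (rootVec p.1 p.2) := by ring
    have hm : mono (rootVec p.1 p.2) ∈ suppIn {a | φ a < 0} :=
      mono_mem_suppIn (hφ _ _ (this p (Finset.mem_insert_self _ _)))
    rw [e]
    refine Submodule.sub_mem _ (Submodule.sub_mem _ ih (mul_mem_suppIn ?_ hm ih)) hm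
    intro a ha b hb
    simp only [Set.mem_ofPred_eq, map_add] at *
    exact add_neg ha hb

/-- The denominator has leading term `1` for every additive order of the exponents in which
`x_i / x_j` is negative for `i < j`, so multiplying by it preserves leading terms. -/
lemma exists_leading {Γ : Type*} [AddCommGroup Γ] [LinearOrder Γ] [IsOrderedAddMonoid Γ]
    (φ : (Fin ℓ → ℤ) →+ Γ) (hφ : ∀ i j : Fin ℓ, i < j → φ (rootVec i j) < 0)
    (J : Finset (Fin ℓ)) {f : Laurent ℓ} (hf : f ≠ 0) :
    ∃ a, f.coeff a ≠ 0 ∧ (f * rootProd J).coeff a = f.coeff a ∧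
      ∀ b, f.coeff b ≠ 0 → φ b ≤ φ a := by
  have hne : f.coeff.support.Nonempty := by
    rw [Finset.nonempty_iff_ne_empty]
    intro h
    exact hf (AddMonoidAlgebra.coeff_eq_zero.1 (Finsupp.support_eq_empty.1 h))
  obtain ⟨a, ha, hmax⟩ := f.coeff.support.exists_max_image φ hne
  have hmax' : ∀ b, f.coeff b ≠ 0 → φ b ≤ φ a := fun b hb => hmax b (Finsupp.mem_support_iff.2 hb)
  refine ⟨a, Finsupp.mem_support_iff.1 ha, ?_, hmax'⟩
  have e : f * rootProd J = f + f * (rootProd J - 1) := by ring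
  have h2 : f * (rootProd J - 1) ∈ suppIn {b | φ b < φ a} := by
    refine mul_mem_suppIn (s := {b | φ b ≤ φ a}) ?_ hmax' (rootProd_sub_one_mem φ hφ J)
    intro b hb c hc
    simp only [Set.mem_ofPred_eq, map_add] at *
    exact (add_lt_of_neg_right _ hc).trans_le hb
  rw [e, AddMonoidAlgebra.coeff_add, Finsupp.add_apply,
    coeff_eq_zero_of_mem_suppIn h2 (a := a) (by simp), add_zero]

/-- The statistic `∑ k a_k`. -/
def height (ℓ : ℕ) : (Fin ℓ → ℤ) →+ ℤ where
  toFun a := ∑ k : Fin ℓ, (k.1 : ℤ) * a k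
  map_zero' := by simp
  map_add' a b := by simp [mul_add, Finset.sum_add_distrib]

lemma height_apply (a : Fin ℓ → ℤ) : height ℓ a = ∑ k : Fin ℓ, (k.1 : ℤ) * a k := rfl

lemma height_rootVec (i j : Fin ℓ) : height ℓ (rootVec i j) = i.1 - j.1 := by
  simp [height_apply, rootVec, mul_sub, Finset.sum_sub_distrib, Pi.single_apply]

/-- A nonzero polynomial is not in the kernel of truncation. -/
lemma eq_zero_of_mem_posPart_of_mem_negPart {f : Laurent ℓ} (h1 : f ∈ posPart ℓ)
    (h2 : f ∈ negPart Finset.univ) : f = 0 := by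
  by_contra hf
  obtain ⟨a, ha, hc, -⟩ := exists_leading (height ℓ) (fun i j hij => by
    rw [height_rootVec]
    have : i.1 < j.1 := hij
    omega) Finset.univ hf
  obtain ⟨j, -, hj⟩ := h2 a (by
    change (f * rootProd Finset.univ).coeff a ≠ 0
    rwa [hc])
  exact absurd (h1 a ha j) (not_le.2 hj)

end LaurentSupport

/-! ### Key polynomials span the Laurent polynomials -/

section Truncation

variable {ℓ : ℕ}

lemma prod_mem_suppIn (S : AddSubmonoid (Fin ℓ → ℤ)) {ι : Type*} (s : Finset ι)
    (f : ι → Laurent ℓ) (h : ∀ p ∈ s, f p ∈ suppIn (S : Set (Fin ℓ → ℤ))) :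
    ∏ p ∈ s, f p ∈ suppIn (S : Set (Fin ℓ → ℤ)) := by
  classical
  induction s using Finset.induction_on with
  | empty =>
    rw [Finset.prod_empty]
    exact mono_mem_suppIn S.zero_mem
  | insert p s hp ih =>
    rw [Finset.prod_insert hp]
    exact mul_mem_suppIn (fun a ha b hb => S.add_mem ha hb) (h p (Finset.mem_insert_self _ _))
      (ih fun q hq => h q (Finset.mem_insert_of_mem hq))

lemma one_mem_suppIn {s : Set (Fin ℓ → ℤ)} (h : (0 : Fin ℓ → ℤ) ∈ s) :
    (1 : Laurent ℓ) ∈ suppIn s := mono_mem_suppIn h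

lemma rootProd_mem_suppIn (S : AddSubmonoid (Fin ℓ → ℤ)) (J : Finset (Fin ℓ))
    (h : ∀ i ∈ J, ∀ j ∈ J, i < j → rootVec i j ∈ S) :
    rootProd J ∈ suppIn (S : Set (Fin ℓ → ℤ)) := by
  apply prod_mem_suppIn
  intro p hp
  simp only [Finset.mem_filter, Finset.mem_product] at hp
  exact Submodule.sub_mem _ (one_mem_suppIn S.zero_mem)
    (mono_mem_suppIn (h _ hp.1.1 _ hp.1.2 hp.2))

lemma rootVec_apply (i j k : Fin ℓ) :
    rootVec i j k = (if k = i then 1 else 0) - (if k = j then 1 else 0) := by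
  simp [rootVec, Pi.single_apply]

/-- The exponents whose entry at `k` is at most `0`. -/
def nonposAt (k : Fin ℓ) : AddSubmonoid (Fin ℓ → ℤ) where
  carrier := {a | a k ≤ 0}
  zero_mem' := by simp
  add_mem' {a b} ha hb := by
    simp only [Set.mem_ofPred_eq, Pi.add_apply] at *
    omega

lemma mem_nonposAt {k : Fin ℓ} {a : Fin ℓ → ℤ} : a ∈ nonposAt k ↔ a k ≤ 0 := by
  rw [nonposAt, AddSubmonoid.mem_mk]
  simp

/-- Monomials with negative exponent at the last position of `J` are killed by truncation. -/
lemma mem_negPart_of_neg_at_max {J : Finset (Fin ℓ)} {k : Fin ℓ} (hk : k ∈ J)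
    (hmax : ∀ j ∈ J, j ≤ k) {f : Laurent ℓ} (hf : f ∈ suppIn {a | a k < 0}) :
    f ∈ negPart J := by
  rw [mem_negPart]
  have h := rootProd_mem_suppIn (nonposAt k) J (by
    intro i hi' j hj hij
    have : k ≠ i := (hij.trans_le (hmax j hj)).ne'
    rw [mem_nonposAt, rootVec_apply, if_neg this]
    split_ifs <;> simp)
  refine mul_mem_suppIn ?_ hf h
  intro a ha b hb
  refine ⟨k, hk, ?_⟩
  simp only [Set.mem_ofPred_eq, SetLike.mem_coe, mem_nonposAt, Pi.add_apply] at *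
  omega

lemma demazureW_mem_posPart (w : ZeroHecke ℓ) {f : Laurent ℓ} (hf : f ∈ posPart ℓ) :
    demazureW ℓ w f ∈ posPart ℓ := by
  induction w using hecke_induction with
  | one => rwa [demazureW_one]
  | gen_mul i z ih => rw [demazureW_mul, demazureW_gen]; exact demazureL_mem_posPart i ih

lemma demazureW_mem_negPart (w : ZeroHecke ℓ) {f : Laurent ℓ} (hf : f ∈ negPart Finset.univ) :
    demazureW ℓ w f ∈ negPart Finset.univ := by
  induction w using hecke_induction with
  | one => rwa [demazureW_one]
  | gen_mul i z ih =>
    rw [demazureW_mul, demazureW_gen]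
    exact demazureL_mem_negPart (Finset.mem_univ _) (Finset.mem_univ _) ih

lemma isShortestTo_shortestTo {T : Type*} [LinearOrder T] (α : Fin ℓ → T) :
    IsShortestTo α (shortestTo α) := by
  apply Classical.epsilon_spec (p := IsShortestTo α)
  classical
  have hex : ∃ n, ∃ z : ZeroHecke ℓ, heckeAct ℓ T z (dec α) = α ∧ len z = n :=
    ⟨_, bubble α, heckeAct_bubble α, rfl⟩
  obtain ⟨z, h1, h2⟩ := Nat.find_spec hex
  exact ⟨z, h1, fun z' hz' => by rw [h2]; exact Nat.find_min' hex ⟨z', hz', rfl⟩⟩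

/-- Any `z` with `z · α⁺ = α` may be used to compute the key polynomial. -/
lemma key_eq {α : Fin ℓ → ℤ} {z : ZeroHecke ℓ} (hz : heckeAct ℓ ℤ z (dec α) = α) :
    key α = demazureW ℓ z (mono (dec α)) := by
  refine act_eq_of_heckeAct_eq (demazureW ℓ) (dec_antitone α) ?_
    ((isShortestTo_shortestTo α).1.trans hz.symm)
  intro i h
  apply demazureL_of_swapL_eq
  rw [swapL_mono, comp_swap_eq_self h]

lemma key_heckeStep (i : Fin (ℓ - 1)) (α : Fin ℓ → ℤ) :
    key (heckeStep i α) = demazureL i (key α) := by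
  have h1 := heckeAct_bubble α
  have h2 : heckeAct ℓ ℤ (gen i * bubble α) (dec (heckeStep i α)) = heckeStep i α := by
    rw [dec_heckeStep, heckeAct_mul, h1, heckeAct_gen]
  rw [key_eq h1, key_eq h2, dec_heckeStep, demazureW_mul, demazureW_gen]

lemma key_dec (α : Fin ℓ → ℤ) : key (dec α) = mono (dec α) := by
  have h : dec (dec α) = dec α := dec_of_antitone (dec_antitone α)
  have h1 : heckeAct ℓ ℤ 1 (dec (dec α)) = dec α := by rw [heckeAct_one, h]
  rw [key_eq h1, h, demazureW_one]

lemma nonneg_dec_iff (α : Fin ℓ → ℤ) : 0 ≤ dec α ↔ 0 ≤ α := by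
  constructor
  · intro h k
    have := h ((Tuple.sort α).symm k).rev
    simpa [dec] using this
  · intro h k
    exact h _

lemma key_mem_posPart {α : Fin ℓ → ℤ} (h : 0 ≤ α) : key α ∈ posPart ℓ :=
  demazureW_mem_posPart _ (mono_mem_suppIn ((nonneg_dec_iff α).2 h))

lemma key_mem_negPart {α : Fin ℓ → ℤ} (h : ¬ 0 ≤ α) : key α ∈ negPart Finset.univ := by
  apply demazureW_mem_negPart
  rw [← nonneg_dec_iff] at h
  simp only [Pi.le_def, not_forall, Pi.zero_apply, not_le] at h
  obtain ⟨k, hk⟩ := h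
  have hlast : ∀ j : Fin ℓ, j ≤ ⟨ℓ - 1, by have := k.2; omega⟩ := fun j => by
    have := j.2
    rw [Fin.le_def]
    simp only
    omega
  exact mem_negPart_of_neg_at_max (Finset.mem_univ _) (fun j _ => hlast j)
    (mono_mem_suppIn ((dec_antitone α (hlast k)).trans_lt hk))

/-- The squared Euclidean norm of an exponent. -/
def normSq (a : Fin ℓ → ℤ) : ℤ := ∑ k, a k * a k

lemma normSq_nonneg (a : Fin ℓ → ℤ) : 0 ≤ normSq a :=
  Finset.sum_nonneg fun _ _ => mul_self_nonneg _

lemma normSq_sub (a : Fin ℓ → ℤ) (i : Fin (ℓ - 1)) (c : ℤ) :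
    normSq (a - c • simpleRoot i) = normSq a - 2 * c * (a (lo i) - a (hi i)) + 2 * c ^ 2 := by
  have e : ∀ b : Fin ℓ → ℤ, ∑ k, b k * simpleRoot i k = b (lo i) - b (hi i) := by
    intro b
    simp [simpleRoot, rootVec_apply, mul_sub, Finset.sum_sub_distrib]
  have e1 := e a
  have e2 := e (simpleRoot i)
  rw [simpleRoot_lo, simpleRoot_hi] at e2
  have : ∀ k, (a - c • simpleRoot i) k * (a - c • simpleRoot i) k =
      a k * a k - 2 * c * (a k * simpleRoot i k) + c ^ 2 * (simpleRoot i k * simpleRoot i k) := by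
    intro k
    simp only [Pi.sub_apply, Pi.smul_apply, smul_eq_mul]
    ring
  unfold normSq
  rw [Finset.sum_congr rfl fun k _ => this k, Finset.sum_add_distrib, Finset.sum_sub_distrib,
    ← Finset.mul_sum, ← Finset.mul_sum, e1, e2]
  ring

/-- The key polynomials span: by induction on the norm, using that `π_i x^a` is
`x^a + x^{s_i a}` plus monomials with exponents of smaller norm. -/
lemma span_key (ℓ : ℕ) : Submodule.span ℤ (Set.range (key : (Fin ℓ → ℤ) → Laurent ℓ)) = ⊤ := by
  set K := Submodule.span ℤ (Set.range (key : (Fin ℓ → ℤ) → Laurent ℓ)) with hK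
  have stable : ∀ (i : Fin (ℓ - 1)) f, f ∈ K → demazureL i f ∈ K := by
    intro i f hf
    have : K ≤ K.comap (demazureLin i) := by
      rw [hK, Submodule.span_le]
      rintro _ ⟨α, rfl⟩
      exact Submodule.subset_span ⟨heckeStep i α, key_heckeStep i α⟩
    exact this hf
  have main : ∀ a : Fin ℓ → ℤ, mono a ∈ K := by
    intro a
    induction hn : (normSq a).toNat using Nat.strong_induction_on generalizing a with
    | _ n ih =>
    subst hn
    have norm_step : ∀ (b : Fin ℓ → ℤ) (i : Fin (ℓ - 1)),
        normSq (b ∘ Equiv.swap (lo i) (hi i)) = normSq b := by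
      intro b i
      unfold normSq
      exact Equiv.sum_comp (Equiv.swap (lo i) (hi i)) fun k => b k * b k
    have hdec : normSq (dec a) = normSq a := by
      unfold normSq dec
      exact Equiv.sum_comp (Fin.revPerm.trans (Tuple.sort a)) fun k => a k * a k
    have orbit : ∀ z : ZeroHecke ℓ, mono (heckeAct ℓ ℤ z (dec a)) ∈ K ∧
        normSq (heckeAct ℓ ℤ z (dec a)) = normSq a := by
      intro z
      induction z using hecke_induction with
      | one =>
        rw [heckeAct_one, ← key_dec]
        exact ⟨Submodule.subset_span ⟨_, rfl⟩, hdec⟩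
      | gen_mul i z ihz =>
        rw [heckeAct_mul, heckeAct_gen]
        obtain ⟨h1, h2⟩ := ihz
        set b := heckeAct ℓ ℤ z (dec a)
        rcases le_or_gt (b (lo i)) (b (hi i)) with h | h
        · rw [heckeStep_of_le h]
          exact ⟨h1, h2⟩
        · rw [heckeStep_of_lt h]
          refine ⟨?_, (norm_step b i).trans h2⟩
          obtain ⟨m, hm⟩ : ∃ m : ℕ, b (lo i) - b (hi i) = (m + 1 : ℕ) :=
            ⟨(b (lo i) - b (hi i) - 1).toNat, by omega⟩
          have e := demazureL_mono i b (m + 1) hm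
          rw [Finset.sum_range_succ, Finset.sum_range_succ'] at e
          have hlast : mono (b - ((m + 1 : ℕ) : ℤ) • simpleRoot i) =
              mono (b ∘ Equiv.swap (lo i) (hi i)) := by
            rw [comp_swap_eq_add_smul, ← hm, sub_eq_add_neg, ← neg_smul, neg_sub]
          rw [hlast] at e
          have e' : mono (b ∘ Equiv.swap (lo i) (hi i)) = demazureL i (mono b) - mono b -
              ∑ k ∈ Finset.range m, mono (b - ((k + 1 : ℕ) : ℤ) • simpleRoot i) := by
            rw [e]
            simp only [Nat.cast_zero, zero_smul, sub_zero]
            ring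
          rw [e']
          refine Submodule.sub_mem _ (Submodule.sub_mem _ (stable i _ h1) h1) ?_
          refine Submodule.sum_mem _ fun k hk => ih _ ?_ _ rfl
          have hk' := Finset.mem_range.1 hk
          have hlt : normSq (b - ((k + 1 : ℕ) : ℤ) • simpleRoot i) < normSq a := by
            rw [normSq_sub, hm, h2]
            have : ((k + 1 : ℕ) : ℤ) < ((m + 1 : ℕ) : ℤ) := by exact_mod_cast (by omega)
            have : (0 : ℤ) < ((k + 1 : ℕ) : ℤ) := by exact_mod_cast (by omega)
            nlinarith
          have := normSq_nonneg (b - ((k + 1 : ℕ) : ℤ) • simpleRoot i)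
          omega
    have := (orbit (bubble a)).1
    rwa [heckeAct_bubble] at this
  rw [eq_top_iff]
  intro f _
  rw [eq_sum_mono f]
  exact K.sum_mem fun a _ => K.smul_mem _ (main a)

/-! ### Polynomial truncation as a projection -/

/-- The Laurent polynomials are the direct sum of the polynomials and of the kernel of
truncation. -/
lemma isCompl_posPart_negPart (ℓ : ℕ) : IsCompl (posPart ℓ) (negPart Finset.univ) := by
  constructor
  · rw [Submodule.disjoint_def]
    exact fun f h1 h2 => eq_zero_of_mem_posPart_of_mem_negPart h1 h2
  · rw [codisjoint_iff, eq_top_iff, ← span_key, Submodule.span_le]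
    rintro _ ⟨α, rfl⟩
    by_cases h : 0 ≤ α
    · exact Submodule.mem_sup_left (key_mem_posPart h)
    · exact Submodule.mem_sup_right (key_mem_negPart h)

/-- The projection of the Laurent polynomials onto the polynomials along the kernel of
truncation. -/
def posProj (ℓ : ℕ) : Laurent ℓ →ₗ[ℤ] Laurent ℓ :=
  (posPart ℓ).subtype.comp ((posPart ℓ).projectionOnto _ (isCompl_posPart_negPart ℓ))

lemma posProj_of_mem_posPart {f : Laurent ℓ} (h : f ∈ posPart ℓ) : posProj ℓ f = f := by
  have := Submodule.projectionOnto_apply_left (isCompl_posPart_negPart ℓ) ⟨f, h⟩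
  simp only at this
  rw [posProj, LinearMap.comp_apply, this]
  rfl

lemma posProj_of_mem_negPart {f : Laurent ℓ} (h : f ∈ negPart Finset.univ) : posProj ℓ f = 0 := by
  rw [posProj, LinearMap.comp_apply,
    (Submodule.projectionOnto_apply_eq_zero_iff (isCompl_posPart_negPart ℓ)).2 h, map_zero]

lemma poly_eq_posProj (ℓ : ℕ) : poly ℓ = posProj ℓ := by
  have h0 : IsPolyTruncation (posProj ℓ) :=
    ⟨fun _ hα => posProj_of_mem_posPart (key_mem_posPart hα),
      fun _ hα => posProj_of_mem_negPart (key_mem_negPart hα)⟩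
  have h1 : IsPolyTruncation (poly ℓ) := Classical.epsilon_spec (p := IsPolyTruncation) ⟨_, h0⟩
  apply LinearMap.ext_on_range (span_key ℓ)
  intro α
  by_cases h : 0 ≤ α
  · rw [h0.1 α h, h1.1 α h]
  · rw [h0.2 α h, h1.2 α h]

lemma poly_of_mem_posPart {f : Laurent ℓ} (h : f ∈ posPart ℓ) : poly ℓ f = f := by
  rw [poly_eq_posProj, posProj_of_mem_posPart h]

lemma poly_of_mem_negPart {f : Laurent ℓ} (h : f ∈ negPart Finset.univ) : poly ℓ f = 0 := by
  rw [poly_eq_posProj, posProj_of_mem_negPart h]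

lemma poly_mem_posPart (f : Laurent ℓ) : poly ℓ f ∈ posPart ℓ := by
  rw [poly_eq_posProj]
  exact Subtype.coe_prop _

lemma sub_poly_mem_negPart (f : Laurent ℓ) : f - poly ℓ f ∈ negPart Finset.univ := by
  have h : (posPart ℓ).projectionOnto _ (isCompl_posPart_negPart ℓ) (f - poly ℓ f) = 0 := by
    apply Subtype.ext
    change posProj ℓ (f - poly ℓ f) = 0
    rw [map_sub, posProj_of_mem_posPart (poly_mem_posPart f), poly_eq_posProj, sub_self]
  exact (Submodule.projectionOnto_apply_eq_zero_iff _).1 h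

lemma poly_eq_of_sub_mem {f g : Laurent ℓ} (hg : g ∈ posPart ℓ)
    (h : f - g ∈ negPart Finset.univ) : poly ℓ f = g := by
  have := poly_of_mem_negPart h
  rwa [map_sub, poly_of_mem_posPart hg, sub_eq_zero] at this

/-- Truncation commutes with the Demazure operators. -/
lemma poly_demazureW (w : ZeroHecke ℓ) (f : Laurent ℓ) :
    poly ℓ (demazureW ℓ w f) = demazureW ℓ w (poly ℓ f) := by
  apply poly_eq_of_sub_mem (demazureW_mem_posPart w (poly_mem_posPart f))
  obtain ⟨T, hT⟩ := exists_linearMap_demazureW w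
  rw [← hT, ← hT, ← map_sub, hT]
  exact demazureW_mem_negPart w (sub_poly_mem_negPart f)

end Truncation

/-! ### Power series with Laurent polynomial coefficients -/

section Series

variable {ℓ : ℕ}

open PowerSeries

/-- The power series all of whose coefficients lie in `P`. -/
def coefIn (P : Submodule ℤ (Laurent ℓ)) : Submodule ℤ (PowerSeries (Laurent ℓ)) where
  carrier := {f | ∀ d, coeff d f ∈ P}
  zero_mem' := by simp
  add_mem' := fun hf hg d => by rw [map_add]; exact P.add_mem (hf d) (hg d)
  smul_mem' := fun c f hf d => by rw [map_zsmul]; exact P.smul_mem c (hf d)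

lemma coefIn_mono {P Q : Submodule ℤ (Laurent ℓ)} (h : P ≤ Q) : coefIn P ≤ coefIn Q :=
  fun _ hf d => h (hf d)

lemma C_mem_coefIn {P : Submodule ℤ (Laurent ℓ)} {f : Laurent ℓ} (h : f ∈ P) :
    (C f : PowerSeries (Laurent ℓ)) ∈ coefIn P := by
  intro d
  rw [coeff_C]
  split_ifs
  · exact h
  · exact P.zero_mem

lemma mul_mem_coefIn {P Q R : Submodule ℤ (Laurent ℓ)} (h : ∀ f ∈ P, ∀ g ∈ Q, f * g ∈ R)
    {f g : PowerSeries (Laurent ℓ)} (hf : f ∈ coefIn P) (hg : g ∈ coefIn Q) :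
    f * g ∈ coefIn R := by
  intro d
  rw [coeff_mul]
  exact R.sum_mem fun p _ => h _ (hf _) _ (hg _)

lemma X_mem_coefIn {P : Submodule ℤ (Laurent ℓ)} (h : (1 : Laurent ℓ) ∈ P) :
    (X : PowerSeries (Laurent ℓ)) ∈ coefIn P := by
  intro d
  rw [coeff_X]
  split_ifs
  · exact h
  · exact P.zero_mem

lemma prod_mem_coefIn (S : AddSubmonoid (Fin ℓ → ℤ)) {ι : Type*} (s : Finset ι)
    (f : ι → PowerSeries (Laurent ℓ))
    (h : ∀ p ∈ s, f p ∈ coefIn (suppIn (S : Set (Fin ℓ → ℤ)))) :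
    ∏ p ∈ s, f p ∈ coefIn (suppIn (S : Set (Fin ℓ → ℤ))) := by
  classical
  induction s using Finset.induction_on with
  | empty =>
    rw [Finset.prod_empty, ← map_one (C (R := Laurent ℓ))]
    exact C_mem_coefIn (one_mem_suppIn S.zero_mem)
  | insert p s hp ih =>
    rw [Finset.prod_insert hp]
    refine mul_mem_coefIn (fun f hf g hg => mul_mem_suppIn (fun a ha b hb => S.add_mem ha hb) hf hg)
      (h p (Finset.mem_insert_self _ _)) (ih fun q hq => h q (Finset.mem_insert_of_mem hq))

/-- The exchange of `x_i`, `x_{i+1}` in a power series. -/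
def swapS (i : Fin (ℓ - 1)) : PowerSeries (Laurent ℓ) →+* PowerSeries (Laurent ℓ) :=
  PowerSeries.map (swapL i)

lemma swapS_C (i : Fin (ℓ - 1)) (f : Laurent ℓ) : swapS i (C f) = C (swapL i f) := map_C _ _

/-- The operator `π_w` applied to each coefficient of a power series. -/
def demazureS (w : ZeroHecke ℓ) (f : PowerSeries (Laurent ℓ)) : PowerSeries (Laurent ℓ) :=
  mk fun d => demazureW ℓ w (coeff d f)

lemma coeff_demazureS (w : ZeroHecke ℓ) (f : PowerSeries (Laurent ℓ)) (d : ℕ) :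
    coeff d (demazureS w f) = demazureW ℓ w (coeff d f) := coeff_mk _ _

lemma demazureS_one (f : PowerSeries (Laurent ℓ)) : demazureS 1 f = f := by
  ext1 d
  rw [coeff_demazureS, demazureW_one]

lemma demazureS_mul (z w : ZeroHecke ℓ) (f : PowerSeries (Laurent ℓ)) :
    demazureS (z * w) f = demazureS z (demazureS w f) := by
  ext1 d
  rw [coeff_demazureS, coeff_demazureS, coeff_demazureS, demazureW_mul]

lemma demazureS_sub (w : ZeroHecke ℓ) (f g : PowerSeries (Laurent ℓ)) :
    demazureS w (f - g) = demazureS w f - demazureS w g := by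
  obtain ⟨T, hT⟩ := exists_linearMap_demazureW w
  ext1 d
  simp only [map_sub, coeff_demazureS, ← hT]

lemma demazureS_add (w : ZeroHecke ℓ) (f g : PowerSeries (Laurent ℓ)) :
    demazureS w (f + g) = demazureS w f + demazureS w g := by
  obtain ⟨T, hT⟩ := exists_linearMap_demazureW w
  ext1 d
  simp only [map_add, coeff_demazureS, ← hT]

lemma demazureS_gen_spec (i : Fin (ℓ - 1)) (f : PowerSeries (Laurent ℓ)) :
    (C (xL (lo i)) - C (xL (hi i))) * demazureS (gen i) f =
      C (xL (lo i)) * f - C (xL (hi i)) * swapS i f := by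
  ext1 d
  rw [← map_sub, coeff_C_mul, map_sub, coeff_C_mul, coeff_C_mul, coeff_demazureS, demazureW_gen,
    demazureL_spec, swapS, coeff_map]

lemma demazureS_gen_eq_of {i : Fin (ℓ - 1)} {f g : PowerSeries (Laurent ℓ)}
    (h : (C (xL (lo i)) - C (xL (hi i))) * g = C (xL (lo i)) * f - C (xL (hi i)) * swapS i f) :
    demazureS (gen i) f = g := by
  ext1 d
  rw [coeff_demazureS, demazureW_gen]
  apply demazureL_eq_of
  have := congrArg (coeff d) h
  rwa [← map_sub, coeff_C_mul, map_sub, coeff_C_mul, coeff_C_mul, swapS, coeff_map] at this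

lemma demazureS_gen_mul {i : Fin (ℓ - 1)} {g : PowerSeries (Laurent ℓ)} (h : swapS i g = g)
    (f : PowerSeries (Laurent ℓ)) : demazureS (gen i) (g * f) = g * demazureS (gen i) f := by
  apply demazureS_gen_eq_of
  rw [map_mul, h]
  linear_combination g * demazureS_gen_spec i f

lemma demazureS_wordProd_mul {u : List ℕ} {g : PowerSeries (Laurent ℓ)}
    (h : ∀ i : Fin (ℓ - 1), i.1 ∈ u → swapS i g = g) (f : PowerSeries (Laurent ℓ)) :
    demazureS (wordProd ℓ u) (g * f) = g * demazureS (wordProd ℓ u) f := by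
  induction u with
  | nil => rw [wordProd_nil, demazureS_one, demazureS_one]
  | cons i u ih =>
    rw [wordProd_cons, demazureS_mul, demazureS_mul, ih fun j hj => h j (List.mem_cons_of_mem _ hj)]
    by_cases hi' : i < ℓ - 1
    · rw [genN_of_lt hi', demazureS_gen_mul (h _ List.mem_cons_self)]
    · rw [genN_of_ge (not_lt.1 hi'), demazureS_one, demazureS_one]

lemma demazureS_wordProd_mem_negPart {u : List ℕ} {J : Finset (Fin ℓ)}
    (h : ∀ i : Fin (ℓ - 1), i.1 ∈ u → lo i ∈ J ∧ hi i ∈ J) {f : PowerSeries (Laurent ℓ)}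
    (hf : f ∈ coefIn (negPart J)) : demazureS (wordProd ℓ u) f ∈ coefIn (negPart J) := by
  induction u with
  | nil => rwa [wordProd_nil, demazureS_one]
  | cons i u ih =>
    rw [wordProd_cons, demazureS_mul]
    have := ih fun j hj => h j (List.mem_cons_of_mem _ hj)
    by_cases hi' : i < ℓ - 1
    · rw [genN_of_lt hi']
      intro d
      rw [coeff_demazureS, demazureW_gen]
      obtain ⟨h1, h2⟩ := h ⟨i, hi'⟩ List.mem_cons_self
      exact demazureL_mem_negPart h1 h2 (this d)
    · rwa [genN_of_ge (not_lt.1 hi'), demazureS_one]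

lemma demazureS_mem_negPart (w : ZeroHecke ℓ) {f : PowerSeries (Laurent ℓ)}
    (hf : f ∈ coefIn (negPart Finset.univ)) : demazureS w f ∈ coefIn (negPart Finset.univ) := by
  intro d
  rw [coeff_demazureS]
  exact demazureW_mem_negPart w (hf d)

/-! ### Polynomials as power series -/

lemma toSeries_X (k : Fin ℓ) : toSeries ℓ (MvPolynomial.X k) = C (xL k) := by
  simp [toSeries]

lemma toSeries_C (c : Polynomial ℤ) :
    toSeries ℓ (MvPolynomial.C c) =
      PowerSeries.map (Int.castRingHom (Laurent ℓ)) (c : PowerSeries ℤ) := by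
  have : (toSeries ℓ).comp MvPolynomial.C =
      (PowerSeries.map (Int.castRingHom (Laurent ℓ))).comp Polynomial.coeToPowerSeries.ringHom := by
    apply Polynomial.ringHom_ext
    · intro n
      simp [toSeries]
    · simp [toSeries]
  exact DFunLike.congr_fun this c

lemma toSeries_C_X : toSeries ℓ (MvPolynomial.C Polynomial.X) = X := by
  rw [toSeries_C]
  simp

lemma swapS_toSeries (i : Fin (ℓ - 1)) (F : PolyRing ℓ) :
    swapS i (toSeries ℓ F) = toSeries ℓ (swapP i F) := by
  have : (swapS i).comp (toSeries ℓ) = (toSeries ℓ).comp (swapP i).toRingHom := by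
    apply MvPolynomial.ringHom_ext
    · intro c
      simp only [RingHom.comp_apply, AlgHom.toRingHom_eq_coe, RingHom.coe_coe, swapP_C, toSeries_C]
      ext1 d
      rw [swapS, coeff_map, coeff_map]
      simp
    · intro k
      simp only [RingHom.comp_apply, AlgHom.toRingHom_eq_coe, RingHom.coe_coe, swapP_X, toSeries_X,
        swapS_C, swapL, permL_xL]
  exact DFunLike.congr_fun this F

lemma toSeries_demazureP (i : Fin (ℓ - 1)) (F : PolyRing ℓ) :
    toSeries ℓ (demazureP i F) = demazureS (gen i) (toSeries ℓ F) := by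
  symm
  apply demazureS_gen_eq_of
  have := congrArg (toSeries ℓ) (demazureP_spec i F)
  simpa only [map_sub, map_mul, toSeries_X, swapS_toSeries] using this

lemma toSeries_demazurePW (w : ZeroHecke ℓ) (F : PolyRing ℓ) :
    toSeries ℓ (demazurePW ℓ w F) = demazureS w (toSeries ℓ F) := by
  induction w using hecke_induction with
  | one => rw [demazurePW_one, demazureS_one]
  | gen_mul i z ih =>
    rw [demazurePW_mul, demazurePW_gen, demazureS_mul, toSeries_demazureP, ih]

/-- The exponent in `ℤ^ℓ` of an ordinary monomial. -/
def toExp (s : Fin ℓ →₀ ℕ) : Fin ℓ → ℤ := fun k => s k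

lemma toExp_injective : Function.Injective (toExp : (Fin ℓ →₀ ℕ) → Fin ℓ → ℤ) := by
  intro s t h
  ext k
  have := congrFun h k
  simpa [toExp] using this

lemma toSeries_monomial (s : Fin ℓ →₀ ℕ) (c : Polynomial ℤ) :
    toSeries ℓ (MvPolynomial.monomial s c) = toSeries ℓ (MvPolynomial.C c) * C (mono (toExp s)) := by
  induction s using Finsupp.induction_linear generalizing c with
  | zero =>
    have : (mono (toExp 0) : Laurent ℓ) = 1 := by
      unfold mono
      rfl
    rw [this, map_one, mul_one]
    rfl
  | add s t hs ht =>
    have e : MvPolynomial.monomial (s + t) c =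
        MvPolynomial.monomial s c * MvPolynomial.monomial t 1 := by
      rw [MvPolynomial.monomial_mul, mul_one]
    have e' : toExp (s + t) = toExp s + toExp t := by
      funext k
      simp [toExp]
    rw [e, map_mul, hs, ht, e', mono_add, map_one, map_one, one_mul, map_mul, mul_assoc]
  | single k n =>
    have e : mono (toExp (Finsupp.single k n)) = (xL k : Laurent ℓ) ^ n := by
      induction n with
      | zero =>
        rw [pow_zero, Finsupp.single_zero]
        rfl
      | succ n ih =>
        have : toExp (Finsupp.single k (n + 1)) = toExp (Finsupp.single k n) + Pi.single k 1 := by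
          funext j
          by_cases h : k = j
          · subst h; simp [toExp]
          · simp [toExp, Finsupp.single_eq_of_ne (Ne.symm h), Pi.single_eq_of_ne (Ne.symm h)]
        rw [this, mono_add, ih, pow_succ]
        rfl
    rw [e, MvPolynomial.monomial_eq, map_mul]
    simp [toSeries_X]

lemma coeff_toSeries (F : PolyRing ℓ) (d : ℕ) :
    coeff d (toSeries ℓ F) =
      ∑ s ∈ F.support, (MvPolynomial.coeff s F).coeff d • mono (toExp s) := by
  conv_lhs => rw [MvPolynomial.as_sum F]
  rw [map_sum, map_sum]
  apply Finset.sum_congr rfl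
  intro s _
  rw [toSeries_monomial, toSeries_C, coeff_mul_C, coeff_map]
  simp

lemma coeff_coeff_toSeries (F : PolyRing ℓ) (d : ℕ) (s : Fin ℓ →₀ ℕ) :
    (coeff d (toSeries ℓ F)).coeff (toExp s) = (MvPolynomial.coeff s F).coeff d := by
  classical
  rw [coeff_toSeries]
  have e : ∀ t : Fin ℓ →₀ ℕ, ((MvPolynomial.coeff t F).coeff d • mono (toExp t)).coeff (toExp s) =
      if t = s then (MvPolynomial.coeff s F).coeff d else 0 := by
    intro t
    rw [AddMonoidAlgebra.coeff_smul_apply, coeff_mono]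
    by_cases h : t = s
    · subst h; simp
    · simp [h, toExp_injective.ne h]
  rw [AddMonoidAlgebra.coeff_sum, Finsupp.finsetSum_apply, Finset.sum_congr rfl fun t _ => e t]
  by_cases h : s ∈ F.support
  · simp [h]
  · simp [MvPolynomial.notMem_support_iff.1 h]

lemma toSeries_injective (ℓ : ℕ) : Function.Injective (toSeries ℓ) := by
  intro F G h
  ext s d
  rw [← coeff_coeff_toSeries, h, coeff_coeff_toSeries]

lemma toSeries_mem_posPart (F : PolyRing ℓ) : toSeries ℓ F ∈ coefIn (posPart ℓ) := by
  intro d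
  rw [coeff_toSeries]
  refine Submodule.sum_mem _ fun s _ => Submodule.smul_mem _ _ (mono_mem_suppIn fun k => ?_)
  simp [toExp]

/-- Two polynomials that agree modulo the kernel of truncation are equal. -/
lemma toSeries_eq_of_sub_mem {F G : PolyRing ℓ}
    (h : toSeries ℓ F - toSeries ℓ G ∈ coefIn (negPart Finset.univ)) : F = G := by
  apply toSeries_injective
  rw [← sub_eq_zero]
  ext1 d
  rw [map_zero]
  exact eq_zero_of_mem_posPart_of_mem_negPart
    ((coefIn (posPart ℓ)).sub_mem (toSeries_mem_posPart F) (toSeries_mem_posPart G) d) (h d)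

/-- The specialization of the last variable to `0`. -/
def dropLast (ℓ : ℕ) : PolyRing ℓ →ₐ[Polynomial ℤ] PolyRing ℓ :=
  MvPolynomial.aeval fun k : Fin ℓ => if k.1 + 1 < ℓ then MvPolynomial.X k else 0

lemma dropLast_X (k : Fin ℓ) : dropLast ℓ (MvPolynomial.X k) =
    if k.1 + 1 < ℓ then MvPolynomial.X k else 0 := MvPolynomial.aeval_X _ _

lemma dropLast_monomial {s : Fin ℓ →₀ ℕ} (h : ∀ k : Fin ℓ, ¬ k.1 + 1 < ℓ → s k = 0)
    (c : Polynomial ℤ) :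
    dropLast ℓ (MvPolynomial.monomial s c) = MvPolynomial.monomial s c := by
  rw [MvPolynomial.monomial_eq, map_mul, Finsupp.prod, map_prod]
  have h1 : dropLast ℓ (MvPolynomial.C c) = MvPolynomial.C c := MvPolynomial.aeval_C _ _
  rw [h1]
  congr 1
  apply Finset.prod_congr rfl
  intro k hk
  have hk' : k.1 + 1 < ℓ := by
    by_contra hn
    exact (Finsupp.mem_support_iff.1 hk) (h k hn)
  rw [map_pow, dropLast_X, if_pos hk']

/-- A power series in `q` is a polynomial if its coefficients are ordinary polynomials and almost
all vanish. -/
lemma exists_toSeries_eq {f : PowerSeries (Laurent ℓ)} (h1 : f ∈ coefIn (posPart ℓ)) (D : ℕ)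
    (h2 : ∀ d, D ≤ d → coeff d f = 0)
    (h3 : ∀ d a, (coeff d f).coeff a ≠ 0 → ∀ k : Fin ℓ, ¬ k.1 + 1 < ℓ → a k = 0) :
    ∃ F : PolyRing ℓ, dropLast ℓ F = F ∧ toSeries ℓ F = f := by
  let e : (Fin ℓ → ℤ) → Fin ℓ →₀ ℕ := fun a => Finsupp.equivFunOnFinite.symm fun k => (a k).toNat
  refine ⟨∑ d ∈ Finset.range D, ∑ a ∈ (coeff d f).coeff.support,
    MvPolynomial.monomial (e a) (Polynomial.monomial d ((coeff d f).coeff a)), ?_, ?_⟩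
  · simp only [map_sum]
    refine Finset.sum_congr rfl fun d _ => Finset.sum_congr rfl fun a ha => ?_
    apply dropLast_monomial
    intro k hk
    have := h3 d a (Finsupp.mem_support_iff.1 ha) k hk
    simp [e, this]
  · ext1 d'
    have term : ∀ d, coeff d' (toSeries ℓ (∑ a ∈ (coeff d f).coeff.support,
        MvPolynomial.monomial (e a) (Polynomial.monomial d ((coeff d f).coeff a)))) =
        if d = d' then coeff d' f else 0 := by
      intro d
      rw [map_sum, map_sum]
      have t : ∀ a ∈ (coeff d f).coeff.support, coeff d' (toSeries ℓ
          (MvPolynomial.monomial (e a) (Polynomial.monomial d ((coeff d f).coeff a)))) =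
          if d = d' then (coeff d f).coeff a • mono a else 0 := by
        intro a ha
        have hea : toExp (e a) = a := by
          funext k
          have := h1 d a (Finsupp.mem_support_iff.1 ha) k
          simpa [toExp, e] using this
        rw [toSeries_monomial, hea, toSeries_C, coeff_mul_C, coeff_map]
        simp only [Polynomial.coeff_coe, Polynomial.coeff_monomial]
        split_ifs
        · simp
        · simp
      rw [Finset.sum_congr rfl t]
      by_cases hd : d = d'
      · subst hd
        simp only [if_true]
        exact (eq_sum_mono _).symm
      · simp [hd]
    rw [map_sum, map_sum, Finset.sum_congr rfl fun d _ => term d, Finset.sum_ite_eq']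
    split_ifs with h
    · rfl
    · exact (h2 d' (by simpa using h)).symm

end Series

/-! ### Geometric series and the kernel of truncation -/

section Geometric

variable {ℓ : ℕ}

open PowerSeries

/-- The series `(1 - q x_i / x_j)⁻¹`. -/
def geom (i j : Fin ℓ) : PowerSeries (Laurent ℓ) :=
  invOfUnit (1 - X * C (mono (rootVec i j))) 1

lemma mul_geom (i j : Fin ℓ) : (1 - X * C (mono (rootVec i j))) * geom i j = 1 :=
  mul_invOfUnit _ _ (by simp)

lemma eq_geom_of {i j : Fin ℓ} {f : PowerSeries (Laurent ℓ)}
    (h : (1 - X * C (mono (rootVec i j))) * f = 1) : f = geom i j := by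
  have h1 := mul_geom i j
  calc f = f * ((1 - X * C (mono (rootVec i j))) * geom i j) := by rw [h1, mul_one]
    _ = ((1 - X * C (mono (rootVec i j))) * f) * geom i j := by ring
    _ = _ := by rw [h, one_mul]

lemma coeff_geom (i j : Fin ℓ) (d : ℕ) : coeff d (geom i j) = mono (rootVec i j) ^ d := by
  have : (mk fun d => mono (rootVec i j) ^ d) = geom i j := by
    apply eq_geom_of
    ext1 d
    cases d with
    | zero => simp [sub_mul, mul_assoc]
    | succ d =>
      rw [sub_mul, one_mul, mul_assoc, map_sub, coeff_succ_X_mul, coeff_C_mul, coeff_mk, coeff_mk,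
        pow_succ', sub_self, coeff_one, if_neg (Nat.succ_ne_zero d)]
  rw [← this, coeff_mk]

lemma mono_pow (a : Fin ℓ → ℤ) (d : ℕ) : (mono a : Laurent ℓ) ^ d = mono (d • a) := by
  induction d with
  | zero => rw [pow_zero, zero_smul]; rfl
  | succ d ih => rw [pow_succ, ih, ← mono_add, succ_nsmul]

lemma geom_mem_coefIn {S : AddSubmonoid (Fin ℓ → ℤ)} {i j : Fin ℓ} (h : rootVec i j ∈ S) :
    geom i j ∈ coefIn (suppIn (S : Set (Fin ℓ → ℤ))) := by
  intro d
  rw [coeff_geom, mono_pow]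
  exact mono_mem_suppIn (S.nsmul_mem h d)

lemma geom_sub_one (i j : Fin ℓ) : geom i j - 1 = X * C (mono (rootVec i j)) * geom i j := by
  linear_combination mul_geom i j

/-- A permutation of the variables in a power series. -/
def permS (σ : Equiv.Perm (Fin ℓ)) : PowerSeries (Laurent ℓ) →+* PowerSeries (Laurent ℓ) :=
  PowerSeries.map (permL σ)

lemma rootVec_comp_symm (σ : Equiv.Perm (Fin ℓ)) (i j : Fin ℓ) :
    rootVec i j ∘ σ.symm = rootVec (σ i) (σ j) := by
  funext k
  simp only [Function.comp_apply, rootVec_apply, Equiv.symm_apply_eq]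

lemma permS_geom (σ : Equiv.Perm (Fin ℓ)) (i j : Fin ℓ) :
    permS σ (geom i j) = geom (σ i) (σ j) := by
  apply eq_geom_of
  have := congrArg (permS σ) (mul_geom i j)
  rw [map_mul, map_sub, map_mul, map_one] at this
  rwa [permS, map_X, map_C, permL_mono, rootVec_comp_symm] at this

lemma swapS_geom (s : Fin (ℓ - 1)) (i j : Fin ℓ) :
    swapS s (geom i j) = geom (Equiv.swap (lo s) (hi s) i) (Equiv.swap (lo s) (hi s) j) :=
  permS_geom _ i j

/-- The exponents on which an additive statistic is at most `0`. -/
def nonposBy {Γ : Type*} [AddCommGroup Γ] [LinearOrder Γ] [IsOrderedAddMonoid Γ]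
    (φ : (Fin ℓ → ℤ) →+ Γ) : AddSubmonoid (Fin ℓ → ℤ) where
  carrier := {a | φ a ≤ 0}
  zero_mem' := by simp
  add_mem' {a b} ha hb := by
    simp only [Set.mem_ofPred_eq, map_add] at *
    exact add_nonpos ha hb

lemma mem_nonposBy {Γ : Type*} [AddCommGroup Γ] [LinearOrder Γ] [IsOrderedAddMonoid Γ]
    {φ : (Fin ℓ → ℤ) →+ Γ} {a : Fin ℓ → ℤ} : a ∈ nonposBy φ ↔ φ a ≤ 0 := by
  rw [nonposBy, AddSubmonoid.mem_mk]
  simp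

/-- The exponents whose entry at `k` is `0`. -/
def zeroAt (k : Fin ℓ) : AddSubmonoid (Fin ℓ → ℤ) where
  carrier := {a | a k = 0}
  zero_mem' := by simp
  add_mem' {a b} ha hb := by
    simp only [Set.mem_ofPred_eq, Pi.add_apply] at *
    omega

lemma mem_zeroAt {k : Fin ℓ} {a : Fin ℓ → ℤ} : a ∈ zeroAt k ↔ a k = 0 := by
  rw [zeroAt, AddSubmonoid.mem_mk]
  simp

lemma height_rootVec_neg {i j : Fin ℓ} (h : i < j) : height ℓ (rootVec i j) < 0 := by
  rw [height_rootVec]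
  have : i.1 < j.1 := h
  omega

lemma mem_negPart_of_height_neg {f : Laurent ℓ} (hf : f ∈ suppIn {a | height ℓ a < 0}) :
    f ∈ negPart Finset.univ := by
  rw [mem_negPart]
  have h := rootProd_mem_suppIn (nonposBy (height ℓ)) Finset.univ (by
    intro i _ j _ hij
    rw [mem_nonposBy]
    exact (height_rootVec_neg hij).le)
  refine mul_mem_suppIn ?_ hf h
  intro a ha b hb
  rw [SetLike.mem_coe, mem_nonposBy] at hb
  simp only [Set.mem_ofPred_eq] at ha
  by_contra hn
  have hpos : ∀ j, 0 ≤ (a + b) j := by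
    intro j
    by_contra hc
    exact hn ⟨j, Finset.mem_univ _, not_le.1 hc⟩
  have h1 : 0 ≤ height ℓ (a + b) := by
    rw [height_apply]
    exact Finset.sum_nonneg fun k _ => mul_nonneg (by positivity) (hpos k)
  rw [map_add] at h1
  omega

/-- Each factor `q` comes with a drop of the height by at least one. -/
lemma coeff_prod_geom_mem (s : Finset (Fin ℓ × Fin ℓ)) (hs : ∀ p ∈ s, p.1 < p.2) (d : ℕ) :
    coeff d (∏ p ∈ s, geom p.1 p.2) ∈ suppIn {a | height ℓ a + d ≤ 0} := by
  induction s using Finset.induction_on generalizing d with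
  | empty =>
    rw [Finset.prod_empty, coeff_one]
    split_ifs with h
    · subst h
      exact one_mem_suppIn (by simp)
    · exact Submodule.zero_mem _
  | insert p s hp ih =>
    rw [Finset.prod_insert hp, coeff_mul]
    refine Submodule.sum_mem _ fun e he => ?_
    have h1 : coeff e.1 (geom p.1 p.2) ∈ suppIn {a | height ℓ a + e.1 ≤ 0} := by
      rw [coeff_geom, mono_pow]
      apply mono_mem_suppIn
      have := height_rootVec_neg (hs p (Finset.mem_insert_self _ _))
      rw [Set.mem_ofPred_eq, map_nsmul, nsmul_eq_mul]
      nlinarith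
    refine mul_mem_suppIn ?_ h1 (ih (fun p hp => hs p (Finset.mem_insert_of_mem hp)) e.2)
    intro a ha b hb
    have := Finset.HasAntidiagonal.mem_antidiagonal.1 he
    simp only [Set.mem_ofPred_eq, map_add] at *
    omega

lemma constantCoeff_prod_geom (s : Finset (Fin ℓ × Fin ℓ)) :
    coeff 0 (∏ p ∈ s, geom p.1 p.2) = 1 := by
  rw [coeff_zero_eq_constantCoeff_apply, map_prod]
  apply Finset.prod_eq_one
  intro p _
  rw [← coeff_zero_eq_constantCoeff_apply, coeff_geom, pow_zero]

/-! ### Truncation and the last variable -/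

lemma rootVec_last_nonpos {i j k : Fin ℓ} (hk : ∀ j, j ≤ k) (h : i < j) : rootVec i j k ≤ 0 := by
  have : k ≠ i := (h.trans_le (hk j)).ne'
  rw [rootVec_apply, if_neg this]
  split_ifs <;> simp

/-- The pair of the exponent of `x_k` and of the height, ordered lexicographically. -/
def lastHeight (k : Fin ℓ) : (Fin ℓ → ℤ) →+ ℤ ×ₗ ℤ where
  toFun a := toLex (a k, height ℓ a)
  map_zero' := by simp
  map_add' a b := by rw [map_add]; rfl

/-- Truncation does not create positive exponents of the last variable. -/
lemma coeff_poly_last {k : Fin ℓ} (hk : ∀ j, j ≤ k) {f : Laurent ℓ}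
    (hf : f ∈ suppIn (nonposAt k : Set (Fin ℓ → ℤ))) {b : Fin ℓ → ℤ}
    (hb : (poly ℓ f).coeff b ≠ 0) : b k = 0 := by
  have hne : poly ℓ f ≠ 0 := by
    intro h0
    rw [h0] at hb
    exact hb (by simp)
  -- The leading coefficient of the truncation at `a`, for the order by the exponent of `x_k` and
  -- then by height, is also a coefficient of `f ∏ (1 - x_i / x_j)`, since `a` has no negative entry.
  obtain ⟨a, ha, hlead, hmax⟩ := exists_leading (lastHeight k) (by
    intro i j hij
    change toLex (rootVec i j k, height ℓ (rootVec i j)) < toLex ((0 : ℤ), (0 : ℤ))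
    rw [Prod.Lex.toLex_lt_toLex]
    have h1 := height_rootVec_neg hij
    have h2 := rootVec_last_nonpos hk hij
    simp only
    omega) Finset.univ hne
  have hpos := poly_mem_posPart f
  have hfa : (f * rootProd Finset.univ).coeff a ≠ 0 := by
    intro h0
    obtain ⟨j, -, hj⟩ := (mem_negPart.1 (sub_poly_mem_negPart f)) a (by
      rw [sub_mul, AddMonoidAlgebra.coeff_sub, Finsupp.sub_apply, h0, hlead, zero_sub]
      exact neg_ne_zero.2 ha)
    exact absurd (hpos a ha j) (not_le.2 hj)
  have hroot := rootProd_mem_suppIn (nonposAt k) Finset.univ (by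
    intro i _ j _ hij
    rw [mem_nonposAt]
    exact rootVec_last_nonpos hk hij)
  have hak : a k ≤ 0 := by
    have := mul_mem_suppIn (fun a ha b hb => (nonposAt k).add_mem ha hb) hf hroot a hfa
    rwa [SetLike.mem_coe, mem_nonposAt] at this
  have hle := hmax b hb
  change toLex (b k, height ℓ b) ≤ toLex (a k, height ℓ a) at hle
  rw [Prod.Lex.toLex_le_toLex] at hle
  have := hpos b hb k
  simp only [Pi.zero_apply] at this hle
  omega

/-- The truncation of a suitable series is a polynomial not involving the last variable. -/
lemma exists_truncation {A : PowerSeries (Laurent ℓ)}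
    (h1 : ∀ k : Fin ℓ, ¬ k.1 + 1 < ℓ → A ∈ coefIn (suppIn (nonposAt k : Set (Fin ℓ → ℤ))))
    (D : ℕ) (h2 : ∀ d, D ≤ d → coeff d A ∈ negPart Finset.univ) :
    ∃ F : PolyRing ℓ, dropLast ℓ F = F ∧ A - toSeries ℓ F ∈ coefIn (negPart Finset.univ) := by
  obtain ⟨F, hF, hA⟩ := exists_toSeries_eq (f := mk fun d => poly ℓ (coeff d A))
    (fun d => by rw [coeff_mk]; exact poly_mem_posPart _) D
    (fun d hd => by rw [coeff_mk]; exact poly_of_mem_negPart (h2 d hd))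
    (fun d a ha k hk => by
      rw [coeff_mk] at ha
      refine coeff_poly_last (fun j => ?_) (h1 k hk d) ha
      have := j.2
      rw [Fin.le_def]
      omega)
  refine ⟨F, hF, fun d => ?_⟩
  rw [hA, map_sub, coeff_mk]
  exact sub_poly_mem_negPart _

/-! ### The kernel of truncation and intervals of positions -/

lemma rootProd_mul_prod {J J' : Finset (Fin ℓ)} (h : J ⊆ J') :
    rootProd J' = (∏ p ∈ (J' ×ˢ J').filter (fun p => p.1 < p.2) \
      (J ×ˢ J).filter (fun p => p.1 < p.2), (1 - mono (rootVec p.1 p.2))) * rootProd J :=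
  (Finset.prod_sdiff (Finset.filter_subset_filter _ (Finset.product_subset_product h h))).symm

/-- All positions but the last. -/
def initPos (ℓ : ℕ) : Finset (Fin ℓ) := Finset.univ.filter fun k => k.1 + 1 < ℓ

/-- All positions but the first. -/
def tailPos (ℓ : ℕ) : Finset (Fin ℓ) := Finset.univ.filter fun k => 0 < k.1

lemma mem_initPos {k : Fin ℓ} : k ∈ initPos ℓ ↔ k.1 + 1 < ℓ := by simp [initPos]

lemma mem_tailPos {k : Fin ℓ} : k ∈ tailPos ℓ ↔ 0 < k.1 := by simp [tailPos]

lemma negPart_tailPos_le : negPart (tailPos ℓ) ≤ negPart Finset.univ := by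
  intro f hf
  rw [mem_negPart] at hf ⊢
  rw [rootProd_mul_prod (Finset.subset_univ (tailPos ℓ)), mul_left_comm]
  have h : ∀ k ∈ tailPos ℓ, (∏ p ∈ ((Finset.univ : Finset (Fin ℓ)) ×ˢ Finset.univ).filter
      (fun p => p.1 < p.2) \ (tailPos ℓ ×ˢ tailPos ℓ).filter (fun p => p.1 < p.2),
      (1 - mono (rootVec p.1 p.2) : Laurent ℓ)) ∈ suppIn (nonposAt k : Set (Fin ℓ → ℤ)) := by
    intro k hk
    apply prod_mem_suppIn
    intro p hp
    refine Submodule.sub_mem _ (one_mem_suppIn (nonposAt k).zero_mem) (mono_mem_suppIn ?_)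
    rw [SetLike.mem_coe, mem_nonposAt, rootVec_apply]
    simp only [Finset.mem_sdiff, Finset.mem_filter, Finset.mem_product, Finset.mem_univ, true_and,
      mem_tailPos, not_and] at hp
    rw [mem_tailPos] at hk
    have h12 : p.1.1 < p.2.1 := hp.1
    have : k ≠ p.1 := by
      rintro rfl
      exact hp.2 ⟨hk, by omega⟩ hp.1
    rw [if_neg this]
    split_ifs <;> simp
  refine mul_mem_suppIn (s := {a | ∀ j ∈ tailPos ℓ, a j ≤ 0}) (t := negOn (tailPos ℓ)) ?_ ?_ hf
  · rintro a ha b ⟨j, hj, hb⟩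
    refine ⟨j, Finset.mem_univ _, ?_⟩
    have := ha j hj
    simp only [Pi.add_apply]
    omega
  · intro a ha j hj
    have := h j hj a ha
    rwa [SetLike.mem_coe, mem_nonposAt] at this

/-- For a Laurent polynomial not involving the last variable, the roots `x_i / x_ℓ` can be dropped
from the denominator: they only contribute terms in which that variable has a negative exponent. -/
lemma mem_negPart_initPos {k : Fin ℓ} (hk : ¬ k.1 + 1 < ℓ) {f : Laurent ℓ}
    (h1 : f ∈ suppIn (zeroAt k : Set (Fin ℓ → ℤ))) (h2 : f ∈ negPart Finset.univ) :
    f ∈ negPart (initPos ℓ) := by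
  rw [mem_negPart] at h2 ⊢
  have hlast : ∀ j : Fin ℓ, j ≤ k := fun j => by
    have := j.2
    rw [Fin.le_def]
    omega
  have hmem : f * rootProd (initPos ℓ) ∈ suppIn (zeroAt k : Set (Fin ℓ → ℤ)) := by
    refine mul_mem_suppIn (fun a ha b hb => (zeroAt k).add_mem ha hb) h1
      (rootProd_mem_suppIn _ _ ?_)
    intro i hi' j hj _
    rw [mem_initPos] at hi' hj
    rw [mem_zeroAt, rootVec_apply, if_neg (by rintro rfl; exact hk hi'),
      if_neg (by rintro rfl; exact hk hj), sub_zero]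
  have hsplit := rootProd_mul_prod (Finset.subset_univ (initPos ℓ))
  set s := ((Finset.univ : Finset (Fin ℓ)) ×ˢ Finset.univ).filter
      (fun p => p.1 < p.2) \ (initPos ℓ ×ˢ initPos ℓ).filter (fun p => p.1 < p.2) with hs
  have hs2 : ∀ p ∈ s, rootVec p.1 p.2 k < 0 := by
    intro p hp
    simp only [hs, Finset.mem_sdiff, Finset.mem_filter, Finset.mem_product, Finset.mem_univ,
      true_and, mem_initPos, not_and] at hp
    have h12 : p.1.1 < p.2.1 := hp.1
    have h3 := p.2.2
    have h4 : p.2 = k := by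
      apply le_antisymm (hlast _)
      rw [Fin.le_def]
      by_contra hc
      have := k.2
      exact hp.2 ⟨by omega, by omega⟩ hp.1
    rw [rootVec_apply, if_neg (by rintro rfl; exact hp.1.ne' h4), if_pos h4.symm]
    simp
  have hprod : ∀ t : Finset (Fin ℓ × Fin ℓ), (∀ p ∈ t, rootVec p.1 p.2 k < 0) →
      (∏ p ∈ t, (1 - mono (rootVec p.1 p.2)) - 1 : Laurent ℓ) ∈ suppIn {a | a k < 0} := by
    intro t
    induction t using Finset.induction_on with
    | empty => simp
    | insert p t hp ih =>
      intro ht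
      rw [Finset.prod_insert hp]
      have ih := ih fun p hp => ht p (Finset.mem_insert_of_mem hp)
      set D := ∏ p ∈ t, (1 - mono (rootVec p.1 p.2))
      have e : (1 - mono (rootVec p.1 p.2)) * D - 1 =
          (D - 1) - mono (rootVec p.1 p.2) * (D - 1) - mono (rootVec p.1 p.2) := by ring
      have hm : mono (rootVec p.1 p.2) ∈ suppIn {a | a k < 0} :=
        mono_mem_suppIn (ht p (Finset.mem_insert_self _ _))
      rw [e]
      refine Submodule.sub_mem _ (Submodule.sub_mem _ ih (mul_mem_suppIn ?_ hm ih)) hm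
      intro a ha b hb
      simp only [Set.mem_ofPred_eq, Pi.add_apply] at *
      omega
  intro a ha
  have hak : a k = 0 := by
    have := hmem a ha
    rwa [SetLike.mem_coe, mem_zeroAt] at this
  have hneg : f * rootProd (initPos ℓ) * (∏ p ∈ s, (1 - mono (rootVec p.1 p.2)) - 1) ∈
      suppIn {a | a k < 0} := by
    refine mul_mem_suppIn ?_ hmem (hprod s hs2)
    intro a ha b hb
    rw [SetLike.mem_coe, mem_zeroAt] at ha
    simp only [Set.mem_ofPred_eq, Pi.add_apply] at *
    omega
  have hcoeff : (f * rootProd Finset.univ).coeff a = (f * rootProd (initPos ℓ)).coeff a := by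
    have e : f * rootProd Finset.univ = f * rootProd (initPos ℓ) +
        f * rootProd (initPos ℓ) * (∏ p ∈ s, (1 - mono (rootVec p.1 p.2)) - 1) := by
      rw [hsplit]
      ring
    rw [e, AddMonoidAlgebra.coeff_add, Finsupp.add_apply,
      coeff_eq_zero_of_mem_suppIn hneg (a := a) (by simp [hak]), add_zero]
  obtain ⟨j, -, hj⟩ := h2 a (by rwa [hcoeff])
  refine ⟨j, ?_, hj⟩
  rw [mem_initPos]
  by_contra hc
  have : j = k := by
    have := j.2
    have := k.2
    rw [Fin.ext_iff]
    omega
  rw [this, hak] at hj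
  exact lt_irrefl _ hj

lemma finRotate_val {k : Fin ℓ} (h : k.1 + 1 < ℓ) : (finRotate ℓ k).1 = k.1 + 1 := by
  obtain ⟨n, rfl⟩ : ∃ n, ℓ = n + 1 := ⟨ℓ - 1, by omega⟩
  exact coe_finRotate_of_ne_last (by rw [ne_eq, Fin.ext_iff, Fin.val_last]; omega)

lemma finRotate_val_last {k : Fin ℓ} (h : ¬ k.1 + 1 < ℓ) : (finRotate ℓ k).1 = 0 := by
  have hk := k.2
  obtain ⟨n, rfl⟩ : ∃ n, ℓ = n + 1 := ⟨ℓ - 1, by omega⟩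
  have : k = Fin.last n := by
    rw [Fin.ext_iff, Fin.val_last]
    omega
  rw [this, finRotate_last]
  rfl

lemma finRotate_mem_tailPos {k : Fin ℓ} : finRotate ℓ k ∈ tailPos ℓ ↔ k ∈ initPos ℓ := by
  rw [mem_tailPos, mem_initPos]
  by_cases h : k.1 + 1 < ℓ
  · rw [finRotate_val h]
    omega
  · rw [finRotate_val_last h]
    omega

lemma finRotate_lt {i j : Fin ℓ} (hi' : i ∈ initPos ℓ) (hj : j ∈ initPos ℓ) :
    finRotate ℓ i < finRotate ℓ j ↔ i < j := by
  rw [mem_initPos] at hi' hj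
  rw [Fin.lt_def, finRotate_val hi', finRotate_val hj, Fin.lt_def]
  omega

lemma permL_rootProd : permL (finRotate ℓ) (rootProd (initPos ℓ)) = rootProd (tailPos ℓ) := by
  unfold rootProd
  rw [map_prod]
  refine Finset.prod_equiv ((finRotate ℓ).prodCongr (finRotate ℓ)) ?_ ?_
  · rintro ⟨i, j⟩
    simp only [Finset.mem_filter, Finset.mem_product, Equiv.prodCongr_apply, Prod.map,
      finRotate_mem_tailPos]
    constructor
    · rintro ⟨⟨h1, h2⟩, h3⟩
      exact ⟨⟨h1, h2⟩, (finRotate_lt h1 h2).2 h3⟩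
    · rintro ⟨⟨h1, h2⟩, h3⟩
      exact ⟨⟨h1, h2⟩, (finRotate_lt h1 h2).1 h3⟩
  · rintro ⟨i, j⟩ _
    rw [map_sub, map_one, permL_mono, rootVec_comp_symm]
    rfl

/-- Rotating the variables carries the condition on the positions before the last one to the
condition on the positions after the first one. -/
lemma permL_mem_negPart {f : Laurent ℓ} (h : f ∈ negPart (initPos ℓ)) :
    permL (finRotate ℓ) f ∈ negPart (tailPos ℓ) := by
  rw [mem_negPart] at h ⊢
  rw [← permL_rootProd, ← map_mul]
  refine permL_mem_suppIn _ ?_ h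
  rintro a ⟨j, hj, ha⟩
  exact ⟨finRotate ℓ j, finRotate_mem_tailPos.2 hj, ha⟩

end Geometric

/-! ### The rotation step -/

section Rotation

variable {ℓ : ℕ}

open PowerSeries

lemma hom_mem_coefIn {S : AddSubmonoid (Fin ℓ → ℤ)} (ψ : PolyRing ℓ →+* PowerSeries (Laurent ℓ))
    (h1 : ∀ c, ψ (MvPolynomial.C c) = toSeries ℓ (MvPolynomial.C c))
    (h2 : ∀ k, ψ (MvPolynomial.X k) ∈ coefIn (suppIn (S : Set (Fin ℓ → ℤ)))) (F : PolyRing ℓ) :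
    ψ F ∈ coefIn (suppIn (S : Set (Fin ℓ → ℤ))) := by
  induction F using MvPolynomial.induction_on with
  | C c =>
    rw [h1, toSeries_C]
    intro d
    rw [coeff_map, eq_intCast, ← zsmul_one]
    exact Submodule.smul_mem _ _ (one_mem_suppIn S.zero_mem)
  | add F G hF hG => rw [map_add]; exact Submodule.add_mem _ hF hG
  | mul_X F k hF =>
    rw [map_mul]
    exact mul_mem_coefIn (fun f hf g hg => mul_mem_suppIn (fun a ha b hb => S.add_mem ha hb) hf hg)
      hF (h2 k)

lemma xL_mem_suppIn {S : AddSubmonoid (Fin ℓ → ℤ)} {i : Fin ℓ} (h : Pi.single i 1 ∈ S) :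
    xL i ∈ suppIn (S : Set (Fin ℓ → ℤ)) := mono_mem_suppIn h

lemma dropLast_C (c : Polynomial ℤ) : dropLast ℓ (MvPolynomial.C c) = MvPolynomial.C c :=
  MvPolynomial.aeval_C _ _

lemma toSeries_mem_zeroAt {F : PolyRing ℓ} (hF : dropLast ℓ F = F) {k : Fin ℓ}
    (hk : ¬ k.1 + 1 < ℓ) : toSeries ℓ F ∈ coefIn (suppIn (zeroAt k : Set (Fin ℓ → ℤ))) := by
  rw [← hF]
  refine hom_mem_coefIn ((toSeries ℓ).comp (dropLast ℓ).toRingHom) ?_ ?_ F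
  · intro c
    simp
  · intro j
    simp only [RingHom.comp_apply, AlgHom.toRingHom_eq_coe, RingHom.coe_coe, dropLast_X]
    split_ifs with h
    · rw [toSeries_X]
      apply C_mem_coefIn
      apply xL_mem_suppIn
      rw [mem_zeroAt, Pi.single_eq_of_ne]
      rintro rfl
      exact hk h
    · rw [map_zero]
      exact Submodule.zero_mem _

lemma toSeries_Phi {F : PolyRing ℓ} (hF : dropLast ℓ F = F) :
    toSeries ℓ (Phi ℓ F) = permS (finRotate ℓ) (toSeries ℓ F) := by
  have : ((toSeries ℓ).comp (Phi ℓ).toRingHom).comp (dropLast ℓ).toRingHom =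
      ((permS (finRotate ℓ)).comp (toSeries ℓ)).comp (dropLast ℓ).toRingHom := by
    apply MvPolynomial.ringHom_ext
    · intro c
      simp only [RingHom.comp_apply, AlgHom.toRingHom_eq_coe, RingHom.coe_coe, dropLast_C, Phi_C,
        toSeries_C]
      ext1 d
      rw [permS, coeff_map, coeff_map]
      simp
    · intro k
      simp only [RingHom.comp_apply, AlgHom.toRingHom_eq_coe, RingHom.coe_coe, dropLast_X]
      split_ifs with h
      · rw [Phi_X_of_lt h, toSeries_X, toSeries_X, permS, map_C, permL_xL]
        congr 2
        rw [Fin.ext_iff, finRotate_val h]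
      · simp
  have := DFunLike.congr_fun this F
  simp only [RingHom.comp_apply, AlgHom.toRingHom_eq_coe, RingHom.coe_coe, hF] at this
  exact this

lemma dropLast_demazureP {i : Fin (ℓ - 1)} (h : i.1 + 2 < ℓ) (F : PolyRing ℓ) :
    dropLast ℓ (demazureP i F) = demazureP i (dropLast ℓ F) := by
  symm
  apply demazureP_eq_of
  have hs : dropLast ℓ (swapP i F) = swapP i (dropLast ℓ F) := by
    have : (dropLast ℓ).comp (swapP i) = (swapP i).comp (dropLast ℓ) := by
      apply MvPolynomial.algHom_ext
      intro k
      simp only [AlgHom.comp_apply, swapP_X, dropLast_X]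
      have e1 : (lo i).1 = i.1 := rfl
      have e2 : (hi i).1 = i.1 + 1 := rfl
      have hiff : (Equiv.swap (lo i) (hi i) k).1 + 1 < ℓ ↔ k.1 + 1 < ℓ := by
        rw [Equiv.swap_apply_def]
        split_ifs with h1 h2
        · subst h1; omega
        · subst h2; omega
        · rfl
      rw [apply_ite (swapP i), swapP_X, map_zero]
      simp only [hiff]
    exact DFunLike.congr_fun this F
  have := congrArg (dropLast ℓ) (demazureP_spec i F)
  rw [map_mul, map_sub, map_sub, map_mul, map_mul, hs, dropLast_X, dropLast_X,
    if_pos (by simp only [lo]; omega), if_pos (by simp only [hi]; omega)] at this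
  exact this

lemma dropLast_wordProd {u : List ℕ} (hu : ∀ i ∈ u, i + 2 < ℓ) {F : PolyRing ℓ}
    (hF : dropLast ℓ F = F) :
    dropLast ℓ (demazurePW ℓ (wordProd ℓ u) F) = demazurePW ℓ (wordProd ℓ u) F := by
  induction u with
  | nil => rwa [wordProd_nil, demazurePW_one]
  | cons i u ih =>
    have h := hu i List.mem_cons_self
    rw [wordProd_cons, demazurePW_mul, genN_of_lt (by omega), demazurePW_gen,
      dropLast_demazureP h, ih fun j hj => hu j (List.mem_cons_of_mem _ hj)]

lemma Phi_wordProd {u : List ℕ} (hu : ∀ i ∈ u, i + 2 < ℓ) (F : PolyRing ℓ) :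
    Phi ℓ (demazurePW ℓ (wordProd ℓ u) F) =
      demazurePW ℓ (wordProd ℓ (u.map (· + 1))) (Phi ℓ F) := by
  induction u with
  | nil => rw [List.map_nil, wordProd_nil, demazurePW_one, demazurePW_one]
  | cons i u ih =>
    have h := hu i List.mem_cons_self
    rw [List.map_cons, wordProd_cons, wordProd_cons, demazurePW_mul, demazurePW_mul,
      ← ih fun j hj => hu j (List.mem_cons_of_mem _ hj), genN_of_lt (by omega : i < ℓ - 1),
      genN_of_lt (by omega : i + 1 < ℓ - 1), demazurePW_gen, demazurePW_gen,
      Phi_demazureP (i := ⟨i, by omega⟩) (j := ⟨i + 1, by omega⟩) rfl]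

/-- After exchanging the last two variables of a polynomial without the last one, the image under
`Φ` does not involve the last variable. -/
lemma Phi_swapP_mem {i : Fin (ℓ - 1)} (hi' : i.1 + 2 = ℓ) {k : Fin ℓ} (hk : ¬ k.1 + 1 < ℓ)
    {F : PolyRing ℓ} (hF : dropLast ℓ F = F) :
    toSeries ℓ (Phi ℓ (swapP i F)) ∈ coefIn (suppIn (zeroAt k : Set (Fin ℓ → ℤ))) := by
  rw [← hF]
  refine hom_mem_coefIn ((toSeries ℓ).comp (((Phi ℓ).comp (swapP i)).comp (dropLast ℓ)).toRingHom)
    ?_ ?_ F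
  · intro c
    simp
  · intro j
    simp only [RingHom.comp_apply, AlgHom.toRingHom_eq_coe, RingHom.coe_coe, AlgHom.comp_apply,
      dropLast_X]
    have hx : ∀ j : Fin ℓ, j ≠ k → (C (xL j) : PowerSeries (Laurent ℓ)) ∈
        coefIn (suppIn (zeroAt k : Set (Fin ℓ → ℤ))) := by
      intro j hj
      apply C_mem_coefIn
      apply xL_mem_suppIn
      rw [mem_zeroAt, Pi.single_eq_of_ne hj.symm]
    split_ifs with h
    · rw [swapP_X]
      by_cases hl : j = lo i
      · subst hl
        rw [Equiv.swap_apply_left, Phi_X_of_not_lt (by simp only [hi]; omega), map_mul, toSeries_X,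
          toSeries_C_X]
        refine mul_mem_coefIn (fun f hf g hg =>
          mul_mem_suppIn (fun a ha b hb => (zeroAt k).add_mem ha hb) hf hg)
          (X_mem_coefIn (one_mem_suppIn (zeroAt k).zero_mem)) (hx _ ?_)
        rw [ne_eq, Fin.ext_iff]
        simp only
        omega
      · have hh : j ≠ hi i := by
          rintro rfl
          simp only [hi] at h
          omega
        have hl' : j.1 ≠ i.1 := fun e => hl (Fin.ext e)
        rw [Equiv.swap_apply_of_ne_of_ne hl hh, Phi_X_of_lt h, toSeries_X]
        apply hx
        rw [ne_eq, Fin.ext_iff]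
        simp only
        omega
    · simp

/-- The product of the `(1 - q x_1 / x_j)⁻¹` over the positions `j ≥ n`. -/
def rowProd (h : 0 < ℓ) (n : ℕ) : PowerSeries (Laurent ℓ) :=
  ∏ j ∈ Finset.univ.filter (fun j : Fin ℓ => n ≤ j.1), geom ⟨0, h⟩ j

lemma rowProd_of_ge (h : 0 < ℓ) {n : ℕ} (hn : ℓ ≤ n) : rowProd h n = 1 := by
  unfold rowProd
  rw [Finset.filter_false_of_mem, Finset.prod_empty]
  intro j _
  have := j.2
  omega

lemma rowProd_of_lt (h : 0 < ℓ) {n : ℕ} (hn : n < ℓ) :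
    rowProd h n = geom ⟨0, h⟩ ⟨n, hn⟩ * rowProd h (n + 1) := by
  unfold rowProd
  have : Finset.univ.filter (fun j : Fin ℓ => n ≤ j.1) =
      insert ⟨n, hn⟩ (Finset.univ.filter (fun j : Fin ℓ => n + 1 ≤ j.1)) := by
    ext j
    simp only [Finset.mem_filter, Finset.mem_univ, true_and, Finset.mem_insert, Fin.ext_iff]
    omega
  rw [this, Finset.prod_insert (by simp)]

lemma swapS_rowProd (h : 0 < ℓ) {n : ℕ} (hn : 1 ≤ n) {i : Fin (ℓ - 1)} (hi' : n ≤ i.1) :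
    swapS i (rowProd h n) = rowProd h n := by
  unfold rowProd
  rw [map_prod]
  have hval : ∀ j : Fin ℓ, n ≤ (Equiv.swap (lo i) (hi i) j).1 ↔ n ≤ j.1 := by
    intro j
    have e1 : (lo i).1 = i.1 := rfl
    have e2 : (hi i).1 = i.1 + 1 := rfl
    rw [Equiv.swap_apply_def]
    split_ifs with h1 h2
    · subst h1; omega
    · subst h2; omega
    · rfl
  refine Finset.prod_equiv (Equiv.swap (lo i) (hi i)) (fun j => by simp [hval]) ?_
  intro j _
  rw [swapS_geom, Equiv.swap_apply_of_ne_of_ne (a := lo i) (x := ⟨0, h⟩)]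
  · rw [ne_eq, Fin.ext_iff]; simp only [lo]; omega
  · rw [ne_eq, Fin.ext_iff]; simp only [hi]; omega

lemma rowProd_mem (h : 0 < ℓ) {n : ℕ} {k : Fin ℓ} (hk : 1 ≤ k.1) :
    rowProd h n ∈ coefIn (suppIn (nonposAt k : Set (Fin ℓ → ℤ))) := by
  apply prod_mem_coefIn
  intro j _
  apply geom_mem_coefIn
  rw [mem_nonposAt, rootVec_apply, if_neg]
  · split_ifs <;> simp
  · rw [Fin.ext_iff]; simp only; omega

lemma xL_mul_rootVec (i j : Fin ℓ) : xL j * mono (rootVec i j) = xL i := by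
  unfold xL
  rw [← mono_add, rootVec, add_sub_cancel]

/-- The action of `π_i` on a geometric series. -/
lemma demazureS_geom (h : 0 < ℓ) {i : Fin (ℓ - 1)} (hi' : 1 ≤ i.1) :
    demazureS (gen i) (geom ⟨0, h⟩ (hi i)) = geom ⟨0, h⟩ (lo i) * geom ⟨0, h⟩ (hi i) := by
  apply demazureS_gen_eq_of
  rw [swapS_geom, Equiv.swap_apply_right, Equiv.swap_apply_of_ne_of_ne]
  · have e1 := mul_geom (⟨0, h⟩ : Fin ℓ) (lo i)
    have e2 := mul_geom (⟨0, h⟩ : Fin ℓ) (hi i)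
    have e3 := congrArg (C (R := Laurent ℓ)) (xL_mul_rootVec (⟨0, h⟩ : Fin ℓ) (lo i))
    have e4 := congrArg (C (R := Laurent ℓ)) (xL_mul_rootVec (⟨0, h⟩ : Fin ℓ) (hi i))
    rw [map_mul] at e3 e4
    set u := geom (⟨0, h⟩ : Fin ℓ) (lo i)
    set v := geom (⟨0, h⟩ : Fin ℓ) (hi i)
    linear_combination C (xL (lo i)) * v * e1 - C (xL (hi i)) * u * e2
      + u * v * X * e3 - u * v * X * e4
  · rw [ne_eq, Fin.ext_iff]; simp only [lo]; omega
  · rw [ne_eq, Fin.ext_iff]; simp only [hi]; omega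

lemma demazureS_range'_geom (h : 0 < ℓ) (t : ℕ) {n : ℕ} (hn : 1 ≤ n) (ht : n + t + 1 = ℓ)
    {g : PowerSeries (Laurent ℓ)} (hg : ∀ i : Fin (ℓ - 1), n ≤ i.1 → swapS i g = g) {k : Fin ℓ}
    (hk : k.1 + 1 = ℓ) :
    demazureS (wordProd ℓ (List.range' n t)) (geom ⟨0, h⟩ k * g) = rowProd h n * g := by
  induction t generalizing n with
  | zero =>
    rw [List.range'_zero, wordProd_nil, demazureS_one, rowProd_of_lt h (by omega),
      rowProd_of_ge h (by omega), mul_one]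
    congr 2
    rw [Fin.ext_iff]
    simp only
    omega
  | succ t ih =>
    rw [List.range'_succ, wordProd_cons, demazureS_mul,
      ih (by omega) (by omega) (fun i hi' => hg i (by omega)), genN_of_lt (by omega : n < ℓ - 1),
      rowProd_of_lt h (by omega : n + 1 < ℓ), rowProd_of_lt h (by omega : n < ℓ),
      rowProd_of_lt h (by omega : n + 1 < ℓ)]
    have e : geom (⟨0, h⟩ : Fin ℓ) ⟨n + 1, by omega⟩ * rowProd h (n + 1 + 1) * g =
        (rowProd h (n + 1 + 1) * g) * geom (⟨0, h⟩ : Fin ℓ) ⟨n + 1, by omega⟩ := by ring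
    have hsym : swapS (⟨n, by omega⟩ : Fin (ℓ - 1)) (rowProd h (n + 1 + 1) * g) =
        rowProd h (n + 1 + 1) * g := by
      rw [map_mul, hg _ le_rfl]
      congr 1
      unfold rowProd
      rw [map_prod]
      apply Finset.prod_congr rfl
      intro j hj
      have hj' := (Finset.mem_filter.1 hj).2
      rw [swapS_geom, Equiv.swap_apply_of_ne_of_ne, Equiv.swap_apply_of_ne_of_ne] <;>
      · rw [ne_eq, Fin.ext_iff]
        simp only [lo, hi]
        omega
    rw [e, demazureS_gen_mul hsym]
    have := demazureS_geom h (i := ⟨n, by omega⟩) hn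
    rw [show (⟨n + 1, by omega⟩ : Fin ℓ) = hi (⟨n, by omega⟩ : Fin (ℓ - 1)) from rfl, this]
    change rowProd h (n + 1 + 1) * g * (geom ⟨0, h⟩ ⟨n, by omega⟩ * _) = _
    ring

/-- Applying the last Demazure operator and then `Φ`. -/
lemma toSeries_Phi_demazureP_last (h : 0 < ℓ) {i : Fin (ℓ - 1)} (hi' : i.1 + 2 = ℓ)
    (F : PolyRing ℓ) :
    toSeries ℓ (Phi ℓ (demazureP i F)) = geom ⟨0, h⟩ (hi i) * (toSeries ℓ (Phi ℓ F) -
      X * C (mono (rootVec ⟨0, h⟩ (hi i))) * toSeries ℓ (Phi ℓ (swapP i F))) := by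
  have e0 := congrArg (fun G => toSeries ℓ (Phi ℓ G)) (demazureP_spec i F)
  have elo : Phi ℓ (MvPolynomial.X (lo i)) = MvPolynomial.X (hi i) := by
    rw [Phi_X_of_lt (by simp only [lo]; omega)]
    rfl
  have ehi : Phi ℓ (MvPolynomial.X (hi i)) =
      MvPolynomial.C Polynomial.X * MvPolynomial.X (⟨0, h⟩ : Fin ℓ) :=
    Phi_X_of_not_lt (by simp only [hi]; omega)
  simp only [map_mul, map_sub, elo, ehi, toSeries_X, toSeries_C_X] at e0
  have e1 := mul_geom (⟨0, h⟩ : Fin ℓ) (hi i)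
  have e2 : (C (mono (-Pi.single (hi i) 1)) * C (xL (hi i)) : PowerSeries (Laurent ℓ)) = 1 := by
    rw [← map_mul, xL, ← mono_add, neg_add_cancel]
    exact map_one _
  have e3 : (C (mono (-Pi.single (hi i) 1)) * C (xL ⟨0, h⟩) : PowerSeries (Laurent ℓ)) =
      C (mono (rootVec ⟨0, h⟩ (hi i))) := by
    rw [← map_mul, xL, ← mono_add, rootVec, neg_add_eq_sub]
  set y : PowerSeries (Laurent ℓ) := C (mono (-Pi.single (hi i) 1))
  set K := geom (⟨0, h⟩ : Fin ℓ) (hi i)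
  set P := toSeries ℓ (Phi ℓ (demazureP i F))
  set Q := toSeries ℓ (Phi ℓ F)
  set R := toSeries ℓ (Phi ℓ (swapP i F))
  linear_combination (-P) * e1 + K * y * e0 + (K * Q - K * P) * e2 + (K * X * P - K * X * R) * e3

end Rotation

section RotationStep

variable {ℓ : ℕ}

open PowerSeries

lemma C_xL_mul_rowProd_mul_mem (h : 0 < ℓ) (n : ℕ) {f : PowerSeries (Laurent ℓ)}
    (hf : f ∈ coefIn (negPart (tailPos ℓ))) :
    C (xL ⟨0, h⟩) * rowProd h n * f ∈ coefIn (negPart (tailPos ℓ)) := by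
  refine mul_mem_coefIn (P := suppIn {a | ∀ j ∈ tailPos ℓ, a j ≤ 0})
    (fun g hg f hf => mul_mem_negPart hf hg) ?_ hf
  have hmem : ∀ k ∈ tailPos ℓ, C (xL ⟨0, h⟩) * rowProd h n ∈
      coefIn (suppIn (nonposAt k : Set (Fin ℓ → ℤ))) := by
    intro k hk
    rw [mem_tailPos] at hk
    refine mul_mem_coefIn (fun f hf g hg =>
      mul_mem_suppIn (fun a ha b hb => (nonposAt k).add_mem ha hb) hf hg) ?_ (rowProd_mem h hk)
    apply C_mem_coefIn
    apply xL_mem_suppIn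
    rw [mem_nonposAt, Pi.single_eq_of_ne]
    rw [ne_eq, Fin.ext_iff]
    simp only
    omega
  intro d a ha j hj
  have := hmem j hj d a ha
  rwa [SetLike.mem_coe, mem_nonposAt] at this

lemma swapP_of_absorb {w : ZeroHecke ℓ} {i : Fin (ℓ - 1)} (h : genN ℓ i.1 * w = w)
    (F : PolyRing ℓ) : swapP i (demazurePW ℓ w F) = demazurePW ℓ w F := by
  apply swapP_of_demazureP_eq
  rw [← demazurePW_gen, ← demazurePW_mul, ← genN_val, h]

/-- The core of the rotation step. Modulo the kernel of truncation, a polynomial `F` not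
involving the last variable satisfies `π_{n+1} ⋯ π_{ℓ-1} (K_ℓ Φ F) = Φ (π_n ⋯ π_{ℓ-1} F)`
where `K_ℓ = (1 - q x_1 / x_ℓ)⁻¹`: by the definition of `Φ` the difference comes from a series in
which every exponent of `x_ℓ` is negative. -/
lemma rowProd_mul_toSeries_Phi (h : 0 < ℓ) {k t : ℕ} (ht : k + t + 2 = ℓ) {F : PolyRing ℓ}
    (hF : dropLast ℓ F = F)
    (hinv : ∀ i : Fin (ℓ - 1), k + 1 ≤ i.1 → swapP i (Phi ℓ F) = Phi ℓ F) :
    rowProd h (k + 1) * toSeries ℓ (Phi ℓ F) -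
      toSeries ℓ (Phi ℓ (demazurePW ℓ (wordProd ℓ (List.range' k (t + 1))) F)) ∈
        coefIn (negPart (tailPos ℓ)) := by
  have hlt : k + t < ℓ - 1 := by omega
  set i : Fin (ℓ - 1) := ⟨k + t, hlt⟩ with hi_def
  have hi' : i.1 + 2 = ℓ := ht
  have hlast : (hi i).1 + 1 = ℓ := ht
  have e1 : wordProd ℓ (List.range' k (t + 1)) = wordProd ℓ (List.range' k t) * gen i := by
    rw [List.range'_1_concat, wordProd_append, wordProd_cons, wordProd_nil, mul_one,
      genN_of_lt hlt]
  have e2 : (List.range' k t).map (· + 1) = List.range' (k + 1) t := by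
    simp only [List.range'_eq_map_range, List.map_map]
    apply List.map_congr_left
    intro s _
    simp only [Function.comp_apply]
    omega
  rw [e1, demazurePW_mul, demazurePW_gen, Phi_wordProd, e2, toSeries_demazurePW,
    toSeries_Phi_demazureP_last h hi', mul_sub, demazureS_sub,
    demazureS_range'_geom h t (by omega) (by omega) _ hlast, sub_sub_cancel]
  · apply demazureS_wordProd_mem_negPart
    · intro j hj
      have := (List.mem_range'_1.1 hj).1
      rw [mem_tailPos, mem_tailPos]
      simp only [lo, hi]
      omega
    · have hle : suppIn {a | a (hi i) < 0} ≤ negPart (tailPos ℓ) := by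
        intro f hf
        refine mem_negPart_of_neg_at_max (k := hi i) ?_ ?_ hf
        · rw [mem_tailPos]
          omega
        · intro j _
          have := j.2
          rw [Fin.le_def]
          omega
      apply coefIn_mono hle
      have hR := Phi_swapP_mem hi' (k := hi i) (by omega) hF
      have hn0 : hi i ≠ ⟨0, h⟩ := by
        rw [ne_eq, Fin.ext_iff]
        simp only
        omega
      have hroot : rootVec ⟨0, h⟩ (hi i) (hi i) = -1 := by
        rw [rootVec_apply, if_neg hn0, if_pos rfl]
        rfl
      have hX : (X * C (mono (rootVec ⟨0, h⟩ (hi i))) : PowerSeries (Laurent ℓ)) ∈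
          coefIn (suppIn {a | a (hi i) < 0}) := by
        refine mul_mem_coefIn (P := suppIn (zeroAt (hi i) : Set (Fin ℓ → ℤ)))
          (Q := suppIn {a | a (hi i) < 0}) ?_
          (X_mem_coefIn (one_mem_suppIn (zeroAt (hi i)).zero_mem))
          (C_mem_coefIn (mono_mem_suppIn ?_))
        · intro f hf g hg
          refine mul_mem_suppIn ?_ hf hg
          intro a ha b hb
          rw [SetLike.mem_coe, mem_zeroAt] at ha
          simp only [Set.mem_ofPred_eq, Pi.add_apply] at *
          omega
        · simp [hroot]
      have hK : geom ⟨0, h⟩ (hi i) ∈ coefIn (suppIn (nonposAt (hi i) : Set (Fin ℓ → ℤ))) := by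
        apply geom_mem_coefIn
        rw [mem_nonposAt, hroot]
        norm_num
      refine mul_mem_coefIn (fun f hf g hg => mul_mem_suppIn ?_ hf hg) hK
        (mul_mem_coefIn (fun f hf g hg => mul_mem_suppIn (u := {a | a (hi i) < 0}) ?_ hf hg) hX hR)
      · intro a ha b hb
        rw [SetLike.mem_coe, mem_nonposAt] at ha
        simp only [Set.mem_ofPred_eq, Pi.add_apply] at *
        omega
      · intro a ha b hb
        rw [SetLike.mem_coe, mem_zeroAt] at hb
        simp only [Set.mem_ofPred_eq, Pi.add_apply] at *
        omega
  · intro j hj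
    rw [swapS_toSeries, hinv j hj]
  · intro j hj
    have := (List.mem_range'_1.1 hj).2
    omega

/-- The rotation step: if `A` is congruent to the polynomial `F` modulo the kernel of truncation,
then the series obtained from `A` by rotating the variables and adding the row of the first
variable is congruent, after symmetrization, to `x_1 Φ` of the symmetrization of `F`. -/
lemma rotation_step (h : 0 < ℓ) (k : ℕ) {A : PowerSeries (Laurent ℓ)} {F : PolyRing ℓ}
    (hF : dropLast ℓ F = F) (hA : A - toSeries ℓ F ∈ coefIn (negPart Finset.univ))
    (hA0 : ∀ j : Fin ℓ, ¬ j.1 + 1 < ℓ → A ∈ coefIn (suppIn (zeroAt j : Set (Fin ℓ → ℤ)))) :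
    demazureS (wordProd ℓ (longWord (k + 1) (ℓ - (k + 1))))
        (C (xL ⟨0, h⟩) * rowProd h (k + 1) * permS (finRotate ℓ) A) -
      toSeries ℓ (rotP h (demazurePW ℓ (wordProd ℓ (longWord k (ℓ - k))) F)) ∈
        coefIn (negPart Finset.univ) := by
  apply coefIn_mono negPart_tailPos_le
  have hν : permS (finRotate ℓ) (A - toSeries ℓ F) ∈ coefIn (negPart (tailPos ℓ)) := by
    have hlast : ¬ (ℓ - 1) + 1 < ℓ := by omega
    have h0 := Submodule.sub_mem _ (hA0 ⟨ℓ - 1, by omega⟩ hlast)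
      (toSeries_mem_zeroAt hF (k := ⟨ℓ - 1, by omega⟩) hlast)
    intro d
    rw [permS, coeff_map]
    exact permL_mem_negPart (mem_negPart_initPos (k := ⟨ℓ - 1, by omega⟩) hlast (h0 d) (hA d))
  have hsplit : permS (finRotate ℓ) A =
      toSeries ℓ (Phi ℓ F) + permS (finRotate ℓ) (A - toSeries ℓ F) := by
    rw [map_sub, ← toSeries_Phi hF]
    ring
  set ν := permS (finRotate ℓ) (A - toSeries ℓ F)
  have hsym : ∀ i : Fin (ℓ - 1), i.1 ∈ longWord (k + 1) (ℓ - (k + 1)) →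
      swapS i (C (xL ⟨0, h⟩) * rowProd h (k + 1)) = C (xL ⟨0, h⟩) * rowProd h (k + 1) := by
    intro i hi'
    have := (mem_longWord hi').1
    rw [map_mul, swapS_rowProd h (by omega) this, swapS_C, swapL, permL_xL,
      Equiv.swap_apply_of_ne_of_ne]
    · rw [ne_eq, Fin.ext_iff]; simp only [lo]; omega
    · rw [ne_eq, Fin.ext_iff]; simp only [hi]; omega
  rw [hsplit, demazureS_wordProd_mul hsym, demazureS_add, mul_add, rotP, map_mul, toSeries_X]
  have hν' := C_xL_mul_rowProd_mul_mem h (k + 1) (demazureS_wordProd_mem_negPart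
    (u := longWord (k + 1) (ℓ - (k + 1))) (fun i hi' => by
      have := (mem_longWord hi').1
      rw [mem_tailPos, mem_tailPos]
      simp only [lo, hi]
      omega) hν)
  set ω := wordProd ℓ (longWord (k + 1) (ℓ - (k + 1)))
  suffices hmain : C (xL ⟨0, h⟩) * (rowProd h (k + 1) * demazureS ω (toSeries ℓ (Phi ℓ F)) -
      toSeries ℓ (Phi ℓ (demazurePW ℓ (wordProd ℓ (longWord k (ℓ - k))) F))) ∈
        coefIn (negPart (tailPos ℓ)) by
    convert Submodule.add_mem _ hmain hν' using 1
    ring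
  have hx : ∀ f ∈ coefIn (negPart (tailPos ℓ)),
      C (xL ⟨0, h⟩) * f ∈ coefIn (negPart (tailPos ℓ)) := by
    intro f hf
    have := C_xL_mul_rowProd_mul_mem h ℓ hf
    rwa [rowProd_of_ge h le_rfl, mul_one] at this
  apply hx
  by_cases hk : k + 1 < ℓ
  · obtain ⟨t, rfl⟩ : ∃ t, ℓ = k + (t + 1) + 1 := ⟨ℓ - k - 2, by omega⟩
    have e1 : k + (t + 1) + 1 - (k + 1) = t + 1 := by omega
    have e2 : k + (t + 1) + 1 - k = t + 1 + 1 := by omega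
    have e3 : longWord k (t + 1 + 1) = List.range' k (t + 1) ++ longWord k (t + 1) := rfl
    have hu : ∀ i ∈ longWord k (t + 1), i + 2 < k + (t + 1) + 1 := fun i hi' => by
      have := mem_longWord hi'
      omega
    have hω : ω = wordProd _ ((longWord k (t + 1)).map (· + 1)) := by
      rw [← longWord_succ_left]
      simp only [ω, e1]
    rw [hω, ← toSeries_demazurePW, ← Phi_wordProd hu, e2, e3, wordProd_append, demazurePW_mul]
    apply rowProd_mul_toSeries_Phi h (by omega) (dropLast_wordProd hu hF)
    intro i hi'
    have hi2 := i.2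
    rw [Phi_wordProd hu, ← longWord_succ_left]
    apply swapP_of_absorb
    apply genN_mul_longWord <;> omega
  · have e1 : longWord (k + 1) (ℓ - (k + 1)) = [] := by
      rw [show ℓ - (k + 1) = 0 by omega]
      rfl
    have e2 : longWord k (ℓ - k) = [] := by
      rcases (by omega : ℓ - k = 0 ∨ ℓ - k = 1) with e | e <;> rw [e] <;> rfl
    have hω : ω = 1 := by
      simp only [ω, e1, wordProd_nil]
    rw [hω, e2, demazureS_one, wordProd_nil, demazurePW_one, rowProd_of_ge h (by omega), one_mul,
      sub_self]
    exact Submodule.zero_mem _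

/-! ### Catalan series of staircase type -/

/-- The series `∏ (1 - q x_i / x_j)⁻¹ x_1 ⋯ x_m` over the pairs `i < j` with `r i ≤ j`. -/
def stairSeries (ℓ : ℕ) (r : ℕ → ℕ) (m : ℕ) : PowerSeries (Laurent ℓ) :=
  (∏ p ∈ Finset.univ.filter (fun p : Fin ℓ × Fin ℓ => p.1 < p.2 ∧ r p.1.1 ≤ p.2.1),
    geom p.1 p.2) * C (mono (onesZeros ℓ m))

/-- The factors of `stairSeries` not involving the last variable. -/
def innerSeries (ℓ : ℕ) (r : ℕ → ℕ) (m : ℕ) : PowerSeries (Laurent ℓ) :=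
  (∏ p ∈ Finset.univ.filter
    (fun p : Fin ℓ × Fin ℓ => (p.1 < p.2 ∧ r p.1.1 ≤ p.2.1) ∧ p.2.1 + 1 < ℓ),
    geom p.1 p.2) * C (mono (onesZeros ℓ m))

lemma stairSeries_zero_sub_one (r : ℕ → ℕ) :
    stairSeries ℓ r 0 - 1 ∈ coefIn (negPart Finset.univ) := by
  have e : (mono (onesZeros ℓ 0) : Laurent ℓ) = 1 := by
    have : onesZeros ℓ 0 = 0 := by
      funext k
      simp [onesZeros]
    rw [this]
    rfl
  rw [stairSeries, e, map_one, mul_one]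
  intro d
  cases d with
  | zero =>
    rw [map_sub, constantCoeff_prod_geom, coeff_zero_one, sub_self]
    exact Submodule.zero_mem _
  | succ d =>
    rw [map_sub, coeff_one, if_neg (Nat.succ_ne_zero d), sub_zero]
    apply mem_negPart_of_height_neg
    refine suppIn_mono ?_ (coeff_prod_geom_mem _ (fun p hp => (Finset.mem_filter.1 hp).2.1) _)
    intro a ha
    simp only [Set.mem_ofPred_eq] at *
    push_cast at ha
    omega

lemma stairSeries_bounded (r : ℕ → ℕ) (m : ℕ) :
    ∃ D, ∀ d, D ≤ d → coeff d (stairSeries ℓ r m) ∈ negPart Finset.univ := by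
  refine ⟨(height ℓ (onesZeros ℓ m)).toNat + 1, fun d hd => ?_⟩
  rw [stairSeries, coeff_mul_C]
  apply mem_negPart_of_height_neg
  refine mul_mem_suppIn ?_
    (coeff_prod_geom_mem _ (fun p hp => (Finset.mem_filter.1 hp).2.1) d)
    (mono_mem_suppIn (s := {onesZeros ℓ m}) rfl)
  rintro a ha b hb
  rw [Set.mem_singleton_iff] at hb
  subst hb
  simp only [Set.mem_ofPred_eq, map_add] at *
  omega

lemma onesZeros_mem_zeroAt {m : ℕ} (hm : m < ℓ) {k : Fin ℓ} (hk : ¬ k.1 + 1 < ℓ) :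
    onesZeros ℓ m ∈ zeroAt k := by
  rw [mem_zeroAt, onesZeros, if_neg]
  omega

lemma stairSeries_mem_nonposAt (r : ℕ → ℕ) {m : ℕ} (hm : m < ℓ) {k : Fin ℓ} (hk : ¬ k.1 + 1 < ℓ) :
    stairSeries ℓ r m ∈ coefIn (suppIn (nonposAt k : Set (Fin ℓ → ℤ))) := by
  refine mul_mem_coefIn (fun f hf g hg =>
    mul_mem_suppIn (fun a ha b hb => (nonposAt k).add_mem ha hb) hf hg) ?_ ?_
  · apply prod_mem_coefIn
    intro p hp
    apply geom_mem_coefIn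
    rw [mem_nonposAt]
    refine rootVec_last_nonpos (fun j => ?_) (Finset.mem_filter.1 hp).2.1
    have := j.2
    rw [Fin.le_def]
    omega
  · apply C_mem_coefIn
    apply mono_mem_suppIn
    rw [SetLike.mem_coe, mem_nonposAt, mem_zeroAt.1 (onesZeros_mem_zeroAt hm hk)]

lemma innerSeries_mem_zeroAt (r : ℕ → ℕ) {m : ℕ} (hm : m < ℓ) {k : Fin ℓ} (hk : ¬ k.1 + 1 < ℓ) :
    innerSeries ℓ r m ∈ coefIn (suppIn (zeroAt k : Set (Fin ℓ → ℤ))) := by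
  refine mul_mem_coefIn (fun f hf g hg =>
    mul_mem_suppIn (fun a ha b hb => (zeroAt k).add_mem ha hb) hf hg) ?_
    (C_mem_coefIn (mono_mem_suppIn (onesZeros_mem_zeroAt hm hk)))
  apply prod_mem_coefIn
  intro p hp
  obtain ⟨-, ⟨h1, -⟩, h2⟩ := Finset.mem_filter.1 hp
  have h1' : p.1.1 < p.2.1 := h1
  apply geom_mem_coefIn
  rw [mem_zeroAt, rootVec_apply, if_neg, if_neg, sub_zero]
  · rintro rfl; exact hk h2
  · rintro rfl; omega

lemma stairSeries_sub_innerSeries (r : ℕ → ℕ) {m : ℕ} (hm : m < ℓ) :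
    stairSeries ℓ r m - innerSeries ℓ r m ∈ coefIn (negPart Finset.univ) := by
  set k : Fin ℓ := ⟨ℓ - 1, by omega⟩ with hkdef
  have hk : ¬ k.1 + 1 < ℓ := by simp only [hkdef]; omega
  have hmax : ∀ j : Fin ℓ, j ≤ k := fun j => by
    have := j.2
    rw [Fin.le_def]
    omega
  set s := Finset.univ.filter (fun p : Fin ℓ × Fin ℓ => p.1 < p.2 ∧ r p.1.1 ≤ p.2.1) with hs
  have hsplit : stairSeries ℓ r m - innerSeries ℓ r m = innerSeries ℓ r m *
      (∏ p ∈ s.filter (fun p => ¬ p.2.1 + 1 < ℓ), geom p.1 p.2 - 1) := by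
    rw [stairSeries, innerSeries, ← hs, ← Finset.prod_filter_mul_prod_filter_not s
      (fun p => p.2.1 + 1 < ℓ), hs, Finset.filter_filter]
    ring
  rw [hsplit]
  apply coefIn_mono (P := suppIn {a | a k < 0})
    (fun f hf => mem_negPart_of_neg_at_max (Finset.mem_univ k) (fun j _ => hmax j) hf)
  have hadd : ∀ f ∈ (suppIn {a | a k < 0} : Submodule ℤ (Laurent ℓ)),
      ∀ g ∈ (suppIn (nonposAt k : Set (Fin ℓ → ℤ)) : Submodule ℤ (Laurent ℓ)),
      f * g ∈ (suppIn {a | a k < 0} : Submodule ℤ (Laurent ℓ)) := by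
    intro f hf g hg
    refine mul_mem_suppIn ?_ hf hg
    intro a ha b hb
    rw [SetLike.mem_coe, mem_nonposAt] at hb
    simp only [Set.mem_ofPred_eq, Pi.add_apply] at *
    omega
  have hprod : ∀ t : Finset (Fin ℓ × Fin ℓ), (∀ p ∈ t, p.1 < p.2 ∧ p.2 = k) →
      (∏ p ∈ t, geom p.1 p.2 - 1) ∈ coefIn (suppIn {a | a k < 0}) := by
    intro t
    induction t using Finset.induction_on with
    | empty => intro _; rw [Finset.prod_empty, sub_self]; exact Submodule.zero_mem _
    | insert p t hp ih =>
      intro ht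
      rw [Finset.prod_insert hp]
      have ih := ih fun p hp => ht p (Finset.mem_insert_of_mem hp)
      obtain ⟨h1, h2⟩ := ht p (Finset.mem_insert_self _ _)
      have hroot : rootVec p.1 p.2 k = -1 := by
        rw [rootVec_apply, if_neg (fun e => h1.ne (e.symm.trans h2.symm)), if_pos h2.symm]
        rfl
      have hnp : geom p.1 p.2 ∈ coefIn (suppIn (nonposAt k : Set (Fin ℓ → ℤ))) := by
        apply geom_mem_coefIn
        rw [mem_nonposAt, hroot]
        norm_num
      have e : geom p.1 p.2 * ∏ p ∈ t, geom p.1 p.2 - 1 =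
          (∏ p ∈ t, geom p.1 p.2 - 1) * geom p.1 p.2 +
            C (mono (rootVec p.1 p.2)) * (X * geom p.1 p.2) := by
        linear_combination geom_sub_one p.1 p.2
      rw [e]
      refine Submodule.add_mem _ (mul_mem_coefIn hadd ih hnp) (mul_mem_coefIn hadd
        (C_mem_coefIn (mono_mem_suppIn (by simp [hroot]))) (mul_mem_coefIn (fun f hf g hg =>
        mul_mem_suppIn (fun a ha b hb => (nonposAt k).add_mem ha hb) hf hg)
        (X_mem_coefIn (one_mem_suppIn (nonposAt k).zero_mem)) hnp))
  rw [mul_comm]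
  refine mul_mem_coefIn hadd (hprod _ ?_) (coefIn_mono (suppIn_mono ?_)
    (innerSeries_mem_zeroAt r hm hk))
  · intro p hp
    obtain ⟨h1, h2⟩ := Finset.mem_filter.1 hp
    refine ⟨(Finset.mem_filter.1 h1).2.1, ?_⟩
    have := p.2.2
    rw [Fin.ext_iff]
    simp only [hkdef]
    omega
  · intro a ha
    rw [SetLike.mem_coe, mem_zeroAt] at ha
    rw [SetLike.mem_coe, mem_nonposAt, ha]

/-- Removing the first row and the first column from a staircase. -/
lemma stairSeries_succ (h : 0 < ℓ) {r : ℕ → ℕ} (hr : ∀ i, i < r i) {m : ℕ} (hm : m < ℓ) :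
    stairSeries ℓ r (m + 1) = C (xL ⟨0, h⟩) * rowProd h (r 0) *
      permS (finRotate ℓ) (innerSeries ℓ (fun i => r (i + 1) - 1) m) := by
  have hmono : (mono (onesZeros ℓ (m + 1)) : Laurent ℓ) =
      xL ⟨0, h⟩ * permL (finRotate ℓ) (mono (onesZeros ℓ m)) := by
    rw [permL_mono, xL, ← mono_add]
    congr 1
    funext k
    obtain ⟨j, rfl⟩ := (finRotate ℓ).surjective k
    simp only [Pi.add_apply, Function.comp_apply, Equiv.symm_apply_apply, onesZeros,
      Pi.single_apply, Fin.ext_iff]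
    by_cases hj : j.1 + 1 < ℓ
    · rw [finRotate_val hj]
      simp
    · rw [finRotate_val_last hj]
      have : ¬ j.1 < m := by omega
      simp [this]
  set s := Finset.univ.filter (fun p : Fin ℓ × Fin ℓ => p.1 < p.2 ∧ r p.1.1 ≤ p.2.1) with hs
  have h0 : ∏ p ∈ s.filter (fun p => p.1.1 = 0), geom p.1 p.2 = rowProd h (r 0) := by
    unfold rowProd
    refine Finset.prod_bij' (fun p _ => p.2) (fun j _ => (⟨0, h⟩, j)) ?_ ?_ ?_ ?_ ?_
    · intro p hp
      simp only [hs, Finset.mem_filter, Finset.mem_univ, true_and] at hp ⊢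
      rw [← hp.2]
      exact hp.1.2
    · intro j hj
      simp only [hs, Finset.mem_filter, Finset.mem_univ, true_and, and_true] at hj ⊢
      refine ⟨?_, hj⟩
      rw [Fin.lt_def]
      exact (hr 0).trans_le hj
    · rintro ⟨i, j⟩ hp
      have := (Finset.mem_filter.1 hp).2
      simp only [Prod.mk.injEq, and_true]
      exact Fin.ext this.symm
    · intro j _
      rfl
    · rintro ⟨i, j⟩ hp
      have := (Finset.mem_filter.1 hp).2
      congr 1
      exact Fin.ext this
  have h1 : ∏ p ∈ s.filter (fun p => ¬ p.1.1 = 0), geom p.1 p.2 =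
      ∏ p ∈ Finset.univ.filter (fun p : Fin ℓ × Fin ℓ =>
        (p.1 < p.2 ∧ r (p.1.1 + 1) - 1 ≤ p.2.1) ∧ p.2.1 + 1 < ℓ),
        permS (finRotate ℓ) (geom p.1 p.2) := by
    symm
    refine Finset.prod_equiv ((finRotate ℓ).prodCongr (finRotate ℓ)) ?_ ?_
    · rintro ⟨i, j⟩
      have hi2 := i.2
      have hj2 := j.2
      have hri := hr (i.1 + 1)
      simp only [hs, Finset.mem_filter, Finset.mem_univ, true_and, Equiv.prodCongr_apply, Prod.map]
      rw [Fin.lt_def, Fin.lt_def]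
      by_cases hj : j.1 + 1 < ℓ
      · by_cases hi' : i.1 + 1 < ℓ
        · rw [finRotate_val hi', finRotate_val hj]
          omega
        · rw [finRotate_val_last hi']
          omega
      · rw [finRotate_val_last hj]
        omega
    · rintro ⟨i, j⟩ _
      rw [permS_geom]
      rfl
  rw [stairSeries, innerSeries, map_mul, map_prod, ← h1, ← h0, hmono,
    ← Finset.prod_filter_mul_prod_filter_not s (fun p => p.1.1 = 0), map_mul]
  rw [permS, map_C]
  ring

/-- The exponent of the nonsymmetric Macdonald polynomial attached to a staircase. -/
def stairExp (ℓ : ℕ) : (ℕ → ℕ) → ℕ → Fin ℓ → ℕ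
  | _, 0 => 0
  | r, m + 1 => rotate (heckeAct ℓ ℕ (wordProd ℓ (longWord (r 0 - 1) (ℓ - (r 0 - 1))))
      (stairExp ℓ (fun i => r (i + 1) - 1) m))

/-- Modulo the kernel of truncation, the Catalan series of a staircase is a nonsymmetric Macdonald
polynomial, once symmetrized in the positions beyond the first row. -/
lemma stairSeries_congr {m : ℕ} (hm : m ≤ ℓ) {r : ℕ → ℕ} (hr : ∀ i, i < r i) (hmono : Monotone r)
    {w : ZeroHecke ℓ} (hw : ∀ i, r 0 ≤ i → w * genN ℓ i = w) :
    demazureS w (stairSeries ℓ r m) - toSeries ℓ (demazurePW ℓ w (macdonaldE (stairExp ℓ r m))) ∈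
      coefIn (negPart Finset.univ) := by
  induction m generalizing r w with
  | zero =>
    rw [stairExp, macdonaldE_zero, toSeries_demazurePW, ← demazureS_sub, map_one]
    exact demazureS_mem_negPart w (stairSeries_zero_sub_one r)
  | succ m ih =>
    have h : 0 < ℓ := by omega
    set r' : ℕ → ℕ := fun i => r (i + 1) - 1 with hr'def
    have hr' : ∀ i, i < r' i := fun i => by
      have := hr (i + 1)
      simp only [hr'def]
      omega
    have hmono' : Monotone r' := fun i j hij => by
      have := hmono (Nat.add_le_add_right hij 1)
      simp only [hr'def]
      omega
    obtain ⟨D, hD⟩ := stairSeries_bounded (ℓ := ℓ) r' m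
    obtain ⟨F, hF, hA⟩ := exists_truncation (A := stairSeries ℓ r' m)
      (fun k hk => stairSeries_mem_nonposAt r' (by omega) hk) D hD
    -- `W` absorbs the generators that the induction hypothesis asks for.
    set W := wordProd ℓ (longWord (r 0 - 1) (ℓ - (r 0 - 1))) with hW
    have hr0 := hr 0
    have hWabs : ∀ i, r' 0 ≤ i → W * genN ℓ i = W := by
      intro i hi'
      by_cases hlt : i < ℓ - 1
      · have := hmono (Nat.zero_le 1)
        simp only [hr'def, zero_add] at hi'
        apply longWord_mul_genN <;> omega
      · rw [genN_of_ge (not_lt.1 hlt), mul_one]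
    -- Both sides are congruent to the symmetrized series of the smaller staircase, and two congruent
    -- polynomials are equal.
    have hG : demazurePW ℓ W F = macdonaldE (heckeAct ℓ ℕ W (stairExp ℓ r' m)) := by
      rw [macdonaldE_heckeAct]
      apply toSeries_eq_of_sub_mem
      have h1 := ih (by omega) hr' hmono' hWabs
      have h2 := demazureS_mem_negPart W hA
      rw [demazureS_sub, ← toSeries_demazurePW] at h2
      convert Submodule.sub_mem _ h1 h2 using 1
      ring
    have hinner : innerSeries ℓ r' m - toSeries ℓ F ∈ coefIn (negPart Finset.univ) := by
      convert Submodule.sub_mem _ hA (stairSeries_sub_innerSeries r' (by omega : m < ℓ)) using 1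
      ring
    have hstep := rotation_step h (r 0 - 1) hF hinner
      (fun j hj => innerSeries_mem_zeroAt r' (by omega) hj)
    have e0 : r 0 - 1 + 1 = r 0 := by omega
    rw [e0, ← stairSeries_succ h hr (by omega), ← hW, hG, ← macdonaldE_rotate] at hstep
    have habs : w * wordProd ℓ (longWord (r 0) (ℓ - r 0)) = w :=
      mul_wordProd_of_absorb fun i hi' => hw i (mem_longWord hi').1
    have := demazureS_mem_negPart w hstep
    rw [demazureS_sub, ← demazureS_mul, habs, ← toSeries_demazurePW] at this
    exact this

end RotationStep

/-! ### Staircases from partitions -/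

section Combinatorics

variable {ℓ : ℕ}

/-- One step of the recursion for `stairExp`. -/
def stairStep (ℓ a : ℕ) (c : Fin ℓ → ℕ) : Fin ℓ → ℕ :=
  rotate (heckeAct ℓ ℕ (wordProd ℓ (longWord (a - 1) (ℓ - (a - 1)))) c)

lemma stairExp_eq_foldr (L : List ℕ) :
    stairExp ℓ (fun i => i + L.getD i 1) L.length = L.foldr (stairStep ℓ) 0 := by
  induction L with
  | nil => rfl
  | cons a L ih =>
    rw [List.length_cons, stairExp, List.foldr_cons, ← ih, stairStep]
    have : (fun i => i + 1 + (a :: L).getD (i + 1) 1 - 1) = fun i => i + L.getD i 1 := by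
      funext i
      rw [List.getD_cons_succ]
      omega
    rw [this]
    simp

/-- The tuple equal to `g` before `k`, with entry `v` at `p` and zero elsewhere. -/
def movedTuple (ℓ : ℕ) (g : ℕ → ℕ) (v k p : ℕ) : Fin ℓ → ℕ := fun i =>
  if i.1 < k then g i.1 else if i.1 = p then v else 0

lemma heckeStep_movedTuple (g : ℕ → ℕ) (v : ℕ) {k p : ℕ} (hp : k ≤ p) (h : p < ℓ - 1) :
    heckeStep ⟨p, h⟩ (movedTuple ℓ g v k p) = movedTuple ℓ g v k (p + 1) := by
  funext j
  simp only [heckeStep_apply, movedTuple, lo, hi]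
  grind

lemma heckeStep_movedTuple_of_lt (g : ℕ → ℕ) (v : ℕ) {k p i : ℕ} (hi' : k ≤ i) (hip : i + 1 < p)
    (h : i < ℓ - 1) : heckeStep ⟨i, h⟩ (movedTuple ℓ g v k p) = movedTuple ℓ g v k p := by
  funext j
  simp only [heckeStep_apply, movedTuple, lo, hi]
  grind

lemma heckeAct_range'_movedTuple (g : ℕ → ℕ) (v : ℕ) {k p t : ℕ} (h : k + t < p) (hp : p < ℓ) :
    heckeAct ℓ ℕ (wordProd ℓ (List.range' k t)) (movedTuple ℓ g v k p) = movedTuple ℓ g v k p := by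
  induction t with
  | zero => rw [List.range'_zero, wordProd_nil, heckeAct_one]
  | succ t ih =>
    rw [List.range'_1_concat, wordProd_append, wordProd_cons, wordProd_nil, mul_one, heckeAct_mul,
      genN_of_lt (by omega), heckeAct_gen, heckeStep_movedTuple_of_lt g v (by omega) (by omega),
      ih (by omega)]

lemma heckeAct_longWord_movedTuple (g : ℕ → ℕ) (v : ℕ) {k n : ℕ} (h : k + n < ℓ) :
    heckeAct ℓ ℕ (wordProd ℓ (longWord k (n + 1))) (movedTuple ℓ g v k k) =
      movedTuple ℓ g v k (k + n) := by
  induction n with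
  | zero => exact heckeAct_one _
  | succ n ih =>
    have e : longWord k (n + 1 + 1) = List.range' k (n + 1) ++ longWord k (n + 1) := rfl
    rw [e, List.range'_1_concat, wordProd_append, wordProd_append, wordProd_cons, wordProd_nil,
      mul_one, heckeAct_mul, heckeAct_mul, ih (by omega), genN_of_lt (by omega), heckeAct_gen,
      heckeStep_movedTuple g v (by omega), heckeAct_range'_movedTuple g v (by omega) (by omega)]
    rfl

/-- The effect of `stairStep` on a tuple with at most `a` nonzero entries. -/
def cycleStep (a : ℕ) (g : ℕ → ℕ) : ℕ → ℕ := fun i =>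
  if i = 0 then g (a - 1) + 1 else if i < a then g (i - 1) else 0

lemma stairStep_eq {a : ℕ} {g : ℕ → ℕ} (ha : 1 ≤ a) (haℓ : a ≤ ℓ) (hg : ∀ x, a ≤ x → g x = 0) :
    stairStep ℓ a (fun i => g i.1) = fun i => cycleStep a g i.1 := by
  have e1 : (fun i : Fin ℓ => g i.1) = movedTuple ℓ g (g (a - 1)) (a - 1) (a - 1) := by
    funext i
    unfold movedTuple
    split_ifs with h1 h2
    · rfl
    · rw [h2]
    · exact hg _ (by omega)
  have e2 : ℓ - (a - 1) = (ℓ - a) + 1 := by omega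
  rw [stairStep, e1, e2, heckeAct_longWord_movedTuple _ _ (by omega)]
  funext i
  have := i.2
  simp only [rotate, movedTuple, cycleStep]
  grind

/-- The steps `b + n, …, b + 1` prepend `n` ones. -/
lemma foldr_desc {b : ℕ} {g : ℕ → ℕ} (hg : ∀ x, b ≤ x → g x = 0) {n : ℕ} (h : b + n ≤ ℓ) :
    ((List.range n).map (fun t => b + n - t)).foldr (stairStep ℓ) (fun i => g i.1) =
      fun i => if i.1 < n then 1 else g (i.1 - n) := by
  induction n with
  | zero => simp
  | succ n ih =>
    have e : (List.range (n + 1)).map (fun t => b + (n + 1) - t) =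
        (b + (n + 1)) :: (List.range n).map (fun t => b + n - t) := by
      rw [List.range_succ_eq_map]
      simp only [List.map_cons, List.map_map, Nat.sub_zero, List.cons.injEq, true_and]
      apply List.map_congr_left
      intro t _
      simp only [Function.comp_apply]
      omega
    rw [e, List.foldr_cons, ih (by omega),
      stairStep_eq (g := fun x => if x < n then 1 else g (x - n)) (by omega) h (by
        intro x hx
        rw [if_neg (by omega), hg _ (by omega)])]
    funext i
    have h1 := hg b le_rfl
    have h2 := hg (i.1 - (n + 1))
    simp only [cycleStep]
    by_cases hi0 : i.1 = 0
    · simp [hi0, h1]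
    · by_cases hb : i.1 < b + (n + 1)
      · by_cases hn : i.1 < n + 1
        · rw [if_neg hi0, if_pos hb, if_pos (by omega), if_pos hn]
        · rw [if_neg hi0, if_pos hb, if_neg (by omega), if_neg hn]
          congr 1
          omega
      · rw [if_neg hi0, if_neg hb, if_neg (by omega), h2 (by omega)]

/-- Repeating `u` times the step `a` turns the first `a` positions by `u` steps and adds one to the
entries that leave at the right. -/
lemma foldr_replicate {a : ℕ} {g : ℕ → ℕ} (ha : 1 ≤ a) (haℓ : a ≤ ℓ)
    (hg : ∀ x, a ≤ x → g x = 0) {u : ℕ} (hu : u ≤ a) :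
    (List.replicate u a).foldr (stairStep ℓ) (fun i => g i.1) =
      fun i => if i.1 < u then g (a - u + i.1) + 1 else if i.1 < a then g (i.1 - u) else 0 := by
  induction u with
  | zero =>
    funext i
    by_cases h : i.1 < a
    · simp [h]
    · simp [h, hg _ (not_lt.1 h)]
  | succ u ih =>
    rw [List.replicate_succ, List.foldr_cons, ih (by omega),
      stairStep_eq (g := fun x => if x < u then g (a - u + x) + 1
        else if x < a then g (x - u) else 0) ha haℓ (by
        intro x hx
        rw [if_neg (by omega), if_neg (by omega)])]
    funext i
    simp only [cycleStep]
    by_cases hi0 : i.1 = 0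
    · rw [if_pos hi0, if_neg (by omega), if_pos (by omega), if_pos (by omega), hi0]
      congr 2
      omega
    · rw [if_neg hi0]
      by_cases hlt : i.1 < a
      · rw [if_pos hlt]
        by_cases h1 : i.1 < u + 1
        · rw [if_pos (by omega), if_pos h1]
          congr 2
          omega
        · rw [if_neg (by omega), if_pos (by omega), if_neg h1, if_pos hlt]
          congr 1
          omega
      · rw [if_neg hlt, if_neg (by omega), if_neg hlt]

/-- The `i`-th part of the conjugate of the partition `η`. -/
def conjPart (η : List ℕ) (i : ℕ) : ℕ := η.countP fun a => i < a

lemma conjPart_cons (a : ℕ) (η : List ℕ) (i : ℕ) :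
    conjPart (a :: η) i = conjPart η i + if i < a then 1 else 0 := by
  simp [conjPart, List.countP_cons]

lemma conjPart_eq_zero {b : ℕ} {η : List ℕ} (h : ∀ x ∈ η, x ≤ b) {i : ℕ} (hi' : b ≤ i) :
    conjPart η i = 0 := by
  rw [conjPart, List.countP_eq_zero]
  intro x hx
  have := h x hx
  simp only [decide_eq_true_eq]
  omega

/-- The block of a part `a` with next part `b` acts on the conjugate of the remaining parts, which
has at most `b` nonzero entries: the steps `a, …, b + 1` prepend `a - b` ones, and the steps `a`,
repeated `b` times, bring the old entries back to the front, each increased by one. -/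
lemma foldr_nrSeq (a : ℕ) (l : List ℕ) (hs : (a :: l).Pairwise (· ≥ ·)) (hpos : ∀ x ∈ a :: l, 1 ≤ x)
    (haℓ : a ≤ ℓ) :
    (nrSeq (a :: l) ++ [1]).foldr (stairStep ℓ) 0 = fun i => conjPart (a :: l) i.1 := by
  induction l generalizing a with
  | nil =>
    have ha := hpos a List.mem_cons_self
    have e : nrSeq [a] ++ [1] = (List.range a).map (fun t => 0 + a - t) := by
      obtain ⟨n, rfl⟩ : ∃ n, a = n + 1 := ⟨a - 1, by omega⟩
      rw [List.range_succ, List.map_append, nrSeq]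
      simp
    have := foldr_desc (ℓ := ℓ) (b := 0) (g := fun _ => 0) (fun _ _ => rfl) (n := a) (by omega)
    rw [e]
    refine this.trans ?_
    funext i
    simp [conjPart]
  | cons b l ih =>
    have hab : b ≤ a := (List.pairwise_cons.1 hs).1 b List.mem_cons_self
    have hs' := (List.pairwise_cons.1 hs).2
    have hb := hpos b (List.mem_cons_of_mem _ List.mem_cons_self)
    obtain ⟨n, rfl⟩ := Nat.exists_eq_add_of_le hab
    have hle : ∀ x ∈ b :: l, x ≤ b := by
      intro x hx
      rcases List.mem_cons.1 hx with rfl | hx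
      · exact le_rfl
      · exact (List.pairwise_cons.1 hs').1 x hx
    have hzero : ∀ x, b ≤ x → conjPart (b :: l) x = 0 := fun x hx => conjPart_eq_zero hle hx
    have h2 : nrSeq ((b + n) :: b :: l) ++ [1] = List.replicate b (b + n) ++
        ((List.range n).map (fun t => b + n - t) ++ (nrSeq (b :: l) ++ [1])) := by
      simp [nrSeq]
    rw [h2, List.foldr_append, List.foldr_append,
      ih b hs' (fun x hx => hpos x (List.mem_cons_of_mem _ hx)) (by omega),
      foldr_desc hzero haℓ, foldr_replicate (g := fun x => if x < n then 1
        else conjPart (b :: l) (x - n)) (by omega) haℓ (by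
        intro x hx
        rw [if_neg (by omega), hzero _ (by omega)]) (by omega)]
    funext i
    rw [conjPart_cons (b + n)]
    by_cases h1 : i.1 < b
    · rw [if_pos h1, if_neg (by omega), if_pos (by omega)]
      congr 2
      omega
    · rw [if_neg h1, hzero i.1 (by omega)]
      by_cases h3 : i.1 < b + n
      · rw [if_pos h3, if_pos h3, if_pos (by omega)]
      · rw [if_neg h3, if_neg h3]

lemma length_nrSeq (a : ℕ) (l : List ℕ) (hs : (a :: l).Pairwise (· ≥ ·))
    (hpos : ∀ x ∈ a :: l, 1 ≤ x) : (nrSeq (a :: l)).length + 1 = (a :: l).sum := by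
  induction l generalizing a with
  | nil =>
    have := hpos a List.mem_cons_self
    simp only [nrSeq, List.length_map, List.length_range, List.sum_cons, List.sum_nil]
    omega
  | cons b l ih =>
    have hab : b ≤ a := (List.pairwise_cons.1 hs).1 b List.mem_cons_self
    have := ih b (List.pairwise_cons.1 hs).2 (fun x hx => hpos x (List.mem_cons_of_mem _ hx))
    simp only [nrSeq, List.length_append, List.length_replicate, List.length_map,
      List.length_range]
    rw [List.sum_cons]
    omega

lemma one_le_of_mem_nrSeq (η : List ℕ) (hpos : ∀ x ∈ η, 1 ≤ x) : ∀ x ∈ nrSeq η, 1 ≤ x := by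
  induction η with
  | nil => simp [nrSeq]
  | cons a l ih =>
    cases l with
    | nil =>
      intro x hx
      simp only [nrSeq, List.mem_map, List.mem_range] at hx
      obtain ⟨t, h1, h2⟩ := hx
      omega
    | cons b l =>
      intro x hx
      simp only [nrSeq, List.mem_append, List.mem_map, List.mem_range] at hx
      rcases hx with (hx | ⟨t, h1, h2⟩) | hx
      · rw [(List.mem_replicate.1 hx).2]
        exact hpos a List.mem_cons_self
      · omega
      · exact ih (fun x hx => hpos x (List.mem_cons_of_mem _ hx)) x hx

lemma one_le_nrEntry (η : List ℕ) (hpos : ∀ x ∈ η, 1 ≤ x) (i : ℕ) : 1 ≤ nrEntry η i := by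
  unfold nrEntry
  by_cases h : i < (nrSeq η).length
  · rw [List.getD_eq_getElem _ _ h]
    exact one_le_of_mem_nrSeq η hpos _ (List.getElem_mem h)
  · rw [List.getD_eq_default _ _ (not_lt.1 h)]

lemma nrEntry_of_sum_le {η : List ℕ} (hs : η.Pairwise (· ≥ ·)) (hpos : ∀ x ∈ η, 1 ≤ x) {i : ℕ}
    (h : η.sum ≤ i + 1) : nrEntry η i = 1 := by
  apply List.getD_eq_default
  cases η with
  | nil => simp [nrSeq]
  | cons a l =>
    have := length_nrSeq a l hs hpos
    omega

/-- The Macdonald exponent attached to the root ideal `Δ'(η)` is the conjugate of `η`. -/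
lemma stairExp_nrEntry {η : List ℕ} (hs : η.Pairwise (· ≥ ·)) (hpos : ∀ x ∈ η, 1 ≤ x)
    (hle : ∀ x ∈ η, x ≤ ℓ) :
    stairExp ℓ (fun i => i + nrEntry η i) η.sum = fun i => conjPart η i.1 := by
  cases η with
  | nil => rfl
  | cons a l =>
    have h1 : (fun i => i + nrEntry (a :: l) i) =
        fun i => i + (nrSeq (a :: l) ++ [1]).getD i 1 := by
      funext i
      congr 1
      unfold nrEntry
      rcases lt_trichotomy i (nrSeq (a :: l)).length with h | h | h
      · rw [List.getD_append _ _ _ _ h]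
      · rw [List.getD_append_right _ _ _ _ h.ge, List.getD_eq_default _ _ h.ge, h]
        simp
      · rw [List.getD_append_right _ _ _ _ h.le, List.getD_eq_default _ _ h.le,
          List.getD_eq_default _ _ (by simp; omega)]
    have h2 : (a :: l).sum = (nrSeq (a :: l) ++ [1]).length := by
      rw [← length_nrSeq a l hs hpos]
      simp
    rw [h1, h2, stairExp_eq_foldr, foldr_nrSeq a l hs hpos (hle a List.mem_cons_self)]

/-- The pairs `(i, j)` with `j ≥ |η|` already satisfy `i + n_i ≤ j`: the left side is weakly
increasing in `i`, and `n_i = 1` for `i ≥ |η| - 1`. -/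
lemma catalanSeries_deltaPrime {η : List ℕ} (hs : η.Pairwise (· ≥ ·)) (hpos : ∀ x ∈ η, 1 ≤ x)
    (m : ℕ) : catalanSeries (deltaPrime ℓ η) (onesZeros ℓ m) =
      stairSeries ℓ (fun i => i + nrEntry η i) m := by
  rw [catalanSeries, stairSeries]
  congr 1
  have : (deltaPrime ℓ η).roots = Finset.univ.filter (fun p : Fin ℓ × Fin ℓ => p.1 < p.2 ∧
      p.1.1 + nrEntry η p.1.1 ≤ p.2.1) := by
    apply Finset.filter_congr
    rintro ⟨i, j⟩ _
    simp only
    refine and_congr_right fun hij => ⟨fun h => h.elim (fun hj => ?_) id, Or.inr⟩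
    have hij' : i.1 < j.1 := hij
    by_cases hi' : η.sum ≤ i.1
    · rw [nrEntry_of_sum_le hs hpos (by omega)]
      omega
    · have h1 := nrEntry_mono η (by omega : i.1 ≤ η.sum - 1)
      simp only at h1
      rw [nrEntry_of_sum_le hs hpos (by omega : η.sum ≤ η.sum - 1 + 1)] at h1
      omega
  rw [this]
  rfl

/-! ### The conjugate partition of a weight -/

lemma dec_eq_comp (α : Fin ℓ → ℕ) : dec α = α ∘ (Fin.revPerm.trans (Tuple.sort α)) := rfl

lemma lt_card_iff {d : Fin ℓ → ℕ} (hd : Antitone d) (i : Fin ℓ) (j : ℕ) :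
    i.1 < (Finset.univ.filter fun k : Fin ℓ => j < d k).card ↔ j < d i := by
  constructor
  · intro h
    by_contra hc
    have hsub : (Finset.univ.filter fun k : Fin ℓ => j < d k) ⊆ Finset.Iio i := by
      intro k hk
      have hk' := (Finset.mem_filter.1 hk).2
      rw [Finset.mem_Iio]
      by_contra hik
      have := hd (not_lt.1 hik)
      omega
    have := Finset.card_le_card hsub
    rw [Fin.card_Iio] at this
    omega
  · intro h
    have hsub : Finset.Iic i ⊆ (Finset.univ.filter fun k : Fin ℓ => j < d k) := by
      intro k hk
      refine Finset.mem_filter.2 ⟨Finset.mem_univ _, h.trans_le (hd (Finset.mem_Iic.1 hk))⟩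
    have := Finset.card_le_card hsub
    rw [Fin.card_Iic] at this
    omega

lemma conj_pairwise (α : Fin ℓ → ℕ) : (conj α).Pairwise (· ≥ ·) := by
  rw [conj, List.pairwise_map]
  refine List.pairwise_lt_range.imp fun {i j} hij => Finset.card_le_card ?_
  intro k hk
  rw [Finset.mem_filter] at hk ⊢
  exact ⟨hk.1, hij.trans hk.2⟩

lemma one_le_of_mem_conj (α : Fin ℓ → ℕ) : ∀ x ∈ conj α, 1 ≤ x := by
  intro x hx
  obtain ⟨j, hj, rfl⟩ := List.mem_map.1 hx
  obtain ⟨k, hk, hlt⟩ := (Finset.lt_sup_iff).1 (List.mem_range.1 hj)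
  exact Finset.card_pos.2 ⟨k, Finset.mem_filter.2 ⟨hk, hlt⟩⟩

lemma le_of_mem_conj (α : Fin ℓ → ℕ) : ∀ x ∈ conj α, x ≤ ℓ := by
  intro x hx
  obtain ⟨j, -, rfl⟩ := List.mem_map.1 hx
  exact (Finset.card_le_univ _).trans (Fintype.card_fin ℓ).le

lemma countP_lt_range (M d : ℕ) (h : d ≤ M) : (List.range M).countP (fun j => j < d) = d := by
  obtain ⟨t, rfl⟩ := Nat.exists_eq_add_of_le h
  rw [List.range_add, List.countP_append, List.countP_eq_length.2, List.countP_eq_zero.2,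
    List.length_range, add_zero]
  · intro a ha
    obtain ⟨b, -, rfl⟩ := List.mem_map.1 ha
    simp
  · intro a ha
    simpa using ha

lemma conjPart_conj (α : Fin ℓ → ℕ) (i : Fin ℓ) : conjPart (conj α) i.1 = dec α i := by
  rw [conjPart, conj, List.countP_map,
    ← countP_lt_range (Finset.univ.sup (dec α)) (dec α i) (Finset.le_sup (Finset.mem_univ i))]
  congr 1
  funext j
  simp only [Function.comp_apply, lt_card_iff (dec_antitone α)]

lemma sum_conj (α : Fin ℓ → ℕ) : (conj α).sum = ∑ i, α i := by
  have h1 : (conj α).sum = ∑ j ∈ Finset.range (Finset.univ.sup (dec α)),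
      (Finset.univ.filter fun i : Fin ℓ => j < dec α i).card := by
    rw [conj, Finset.sum_range, ← List.sum_ofFn]
    congr 1
    apply List.ext_getElem <;> simp
  have h2 : ∑ i, α i = ∑ i, dec α i := by
    rw [dec_eq_comp]
    exact (Equiv.sum_comp (Fin.revPerm.trans (Tuple.sort α)) α).symm
  rw [h1, h2]
  simp only [Finset.card_filter]
  rw [Finset.sum_comm]
  apply Finset.sum_congr rfl
  intro i _
  rw [← Finset.card_filter]
  have : (Finset.range (Finset.univ.sup (dec α))).filter (fun j => j < dec α i) =
      Finset.range (dec α i) := by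
    ext j
    have := Finset.le_sup (f := dec α) (Finset.mem_univ i)
    simp only [Finset.mem_filter, Finset.mem_range]
    omega
  rw [this, Finset.card_range]

lemma conj_eq (α : Fin ℓ → ℕ) : conj α = (List.range (Finset.univ.sup α)).map fun j =>
    (Finset.univ.filter fun i : Fin ℓ => j < α i).card := by
  have h1 : Finset.univ.sup (dec α) = Finset.univ.sup α := by
    apply le_antisymm
    · exact Finset.sup_le fun i _ => Finset.le_sup (f := α) (Finset.mem_univ _)
    · refine Finset.sup_le fun i _ => ?_
      obtain ⟨k, rfl⟩ := (Fin.revPerm.trans (Tuple.sort α)).surjective i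
      exact Finset.le_sup (f := dec α) (Finset.mem_univ k)
  rw [conj, h1]
  apply List.map_congr_left
  intro j _
  refine Finset.card_equiv (Fin.revPerm.trans (Tuple.sort α)) fun k => ?_
  simp only [Finset.mem_filter, Finset.mem_univ, true_and]
  rfl

/-- The first row of `Δ'(η)` is long enough: beyond it, the entries of `α⁺` vanish. -/
lemma dec_eq_zero_of_nrEntry_le (α : Fin ℓ → ℕ) {k : Fin ℓ} (h : nrEntry (conj α) 0 ≤ k.1) :
    dec α k = 0 := by
  by_contra hne
  have hlt := (lt_card_iff (dec_antitone α) k 0).2 (Nat.pos_of_ne_zero hne)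
  have hM : 0 < Finset.univ.sup (dec α) :=
    (Nat.pos_of_ne_zero hne).trans_le (Finset.le_sup (Finset.mem_univ k))
  obtain ⟨M, hM'⟩ : ∃ M, Finset.univ.sup (dec α) = M + 1 := ⟨_, (Nat.succ_pred_eq_of_pos hM).symm⟩
  have e : ∃ l, conj α = (Finset.univ.filter fun i : Fin ℓ => 0 < dec α i).card :: l := by
    rw [conj, hM', List.range_succ_eq_map, List.map_cons]
    exact ⟨_, rfl⟩
  obtain ⟨l, hl⟩ := e
  have := (nrSeq_good (Finset.univ.filter fun i : Fin ℓ => 0 < dec α i).card l).2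
  rw [hl, nrEntry] at h
  omega

lemma card_pos_le_nrEntry (α : Fin ℓ → ℕ) {k : Fin ℓ} (h : dec α k ≠ 0) :
    k.1 < nrEntry (conj α) 0 := by
  by_contra hc
  exact h (dec_eq_zero_of_nrEntry_le α (not_lt.1 hc))

lemma lt_sum_of_dec_ne_zero (α : Fin ℓ → ℕ) {k : Fin ℓ} (h : dec α k ≠ 0) :
    k.1 < (conj α).sum := by
  have h2 : ∑ i, α i = ∑ i, dec α i := by
    rw [dec_eq_comp]
    exact (Equiv.sum_comp (Fin.revPerm.trans (Tuple.sort α)) α).symm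
  rw [sum_conj, h2]
  have h3 : ∑ i ∈ Finset.Iic k, 1 ≤ ∑ i ∈ Finset.Iic k, dec α i := by
    refine Finset.sum_le_sum fun i hi' => ?_
    have := dec_antitone α (Finset.mem_Iic.1 hi')
    omega
  have h4 : ∑ i ∈ Finset.Iic k, dec α i ≤ ∑ i, dec α i :=
    Finset.sum_le_sum_of_subset (Finset.subset_univ _)
  rw [Finset.sum_const, Fin.card_Iic, smul_eq_mul, mul_one] at h3
  omega

lemma isTame_deltaPrime (α : Fin ℓ → ℕ) {z : ZeroHecke ℓ} (hz : IsLongestTo α z) :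
    IsTame (deltaPrime ℓ (conj α)) z := by
  intro i hi'
  apply hz.mul_gen
  have hlo : dec α (lo i) = 0 := by
    by_contra hne
    have h1 := card_pos_le_nrEntry α hne
    have h2 := lt_sum_of_dec_ne_zero α hne
    have h3 : Finset.Iic (lo i) ⊆ Finset.univ.filter fun j : Fin ℓ =>
        (⟨0, by have := i.2; omega⟩ : Fin ℓ) ≤ j ∧
          ((⟨0, by have := i.2; omega⟩ : Fin ℓ), j) ∉ (deltaPrime ℓ (conj α)).roots := by
      intro j hj
      have hj' : j ≤ lo i := Finset.mem_Iic.1 hj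
      rw [Fin.le_def] at hj'
      refine Finset.mem_filter.2 ⟨Finset.mem_univ _, Nat.zero_le _, fun hmem => ?_⟩
      obtain ⟨-, -, h4⟩ := Finset.mem_filter.1 hmem
      simp only at h4
      omega
    have h4 := Finset.card_le_card h3
    rw [Fin.card_Iic] at h4
    have e : (lo i).1 = i.1 := rfl
    unfold nr at hi'
    omega
  have hle := dec_antitone α (lo_lt_hi i).le
  omega

end Combinatorics

/-! ### Adding zero entries to the weight -/

section Stability

open MvPolynomial

variable {ℓ m : ℕ}

lemma specialize_X (k : Fin m) :
    specialize m ℓ (X k) = if h : k.1 < ℓ then X ⟨k.1, h⟩ else 0 := aeval_X _ _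

lemma specialize_demazureP {i : Fin (ℓ - 1)} {j : Fin (m - 1)} (h : i.1 = j.1) (F : PolyRing m) :
    specialize m ℓ (demazureP j F) = demazureP i (specialize m ℓ F) := by
  symm
  apply demazureP_eq_of
  have hi2 := i.2
  have e1 : (lo j).1 = i.1 := h.symm
  have e2 : (hi j).1 = i.1 + 1 := by simp [hi, h]
  have xlo : specialize m ℓ (X (lo j)) = X (lo i) := by
    rw [specialize_X, dif_pos (by omega)]
    congr 1
    exact Fin.ext e1
  have xhi : specialize m ℓ (X (hi j)) = X (hi i) := by
    rw [specialize_X, dif_pos (by omega)]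
    congr 1
    exact Fin.ext e2
  have hs : specialize m ℓ (swapP j F) = swapP i (specialize m ℓ F) := by
    have : (specialize m ℓ).comp (swapP j) = (swapP i).comp (specialize m ℓ) := by
      apply algHom_ext
      intro k
      simp only [AlgHom.comp_apply, swapP_X]
      by_cases h1 : k = lo j
      · rw [h1, Equiv.swap_apply_left, xlo, xhi, swapP_X, Equiv.swap_apply_left]
      · by_cases h2 : k = hi j
        · rw [h2, Equiv.swap_apply_right, xlo, xhi, swapP_X, Equiv.swap_apply_right]
        · have h1' : k.1 ≠ i.1 := fun e => h1 (Fin.ext (e.trans e1.symm))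
          have h2' : k.1 ≠ i.1 + 1 := fun e => h2 (Fin.ext (e.trans e2.symm))
          rw [Equiv.swap_apply_of_ne_of_ne h1 h2, specialize_X]
          split_ifs with hk
          · rw [swapP_X, Equiv.swap_apply_of_ne_of_ne]
            · rw [ne_eq, Fin.ext_iff]; exact h1'
            · rw [ne_eq, Fin.ext_iff]; exact h2'
          · rw [map_zero]
    exact DFunLike.congr_fun this F
  have := congrArg (specialize m ℓ) (demazureP_spec j F)
  rwa [map_mul, map_sub, map_sub, map_mul, map_mul, hs, xlo, xhi] at this

/-- When the second of the variables exchanged by `π_j` is specialized to `0`, the operator acts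
trivially. -/
lemma specialize_demazureP_of_le {j : Fin (m - 1)} (h : ℓ ≤ j.1 + 1) (F : PolyRing m) :
    specialize m ℓ (demazureP j F) = specialize m ℓ F := by
  set ε : PolyRing m →ₐ[Polynomial ℤ] PolyRing m := aeval fun k => if k = hi j then 0 else X k
  have hε : ∀ k, ε (X k) = if k = hi j then 0 else X k := fun k => aeval_X _ _
  have hcomp : ∀ G, specialize m ℓ (ε G) = specialize m ℓ G := by
    intro G
    have : (specialize m ℓ).comp ε = specialize m ℓ := by
      apply algHom_ext
      intro k
      rw [AlgHom.comp_apply, hε]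
      split_ifs with hk
      · rw [map_zero, specialize_X, dif_neg]
        rw [hk]
        simp only [hi]
        omega
      · rfl
    exact DFunLike.congr_fun this G
  have e := congrArg ε (demazureP_spec j F)
  rw [map_mul, map_sub, map_sub, map_mul, map_mul, hε, hε, if_neg (lo_ne_hi j), if_pos rfl,
    sub_zero, zero_mul, sub_zero] at e
  rw [← hcomp, mul_left_cancel₀ (X_ne_zero _) e, hcomp]

lemma specialize_wordProd {u : List ℕ} (hu : ∀ i ∈ u, ℓ ≤ i + 1) (F : PolyRing m) :
    specialize m ℓ (demazurePW m (wordProd m u) F) = specialize m ℓ F := by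
  induction u with
  | nil => rw [wordProd_nil, demazurePW_one]
  | cons i u ih =>
    have ih := ih fun j hj => hu j (List.mem_cons_of_mem _ hj)
    rw [wordProd_cons, demazurePW_mul]
    by_cases hi' : i < m - 1
    · rw [genN_of_lt hi', demazurePW_gen, specialize_demazureP_of_le (hu i List.mem_cons_self), ih]
    · rw [genN_of_ge (not_lt.1 hi'), demazurePW_one, ih]

/-- The substitution `x_i ↦ x_{i+1}` for `i < ℓ`, `x_{p+1} ↦ q x_1`, all other variables going to
`0`. For `p = ℓ - 1` it is the specialization followed by `Φ`, for `p = m - 1` it is `Φ` followed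
by the specialization. -/
def rotSpecialize (m : ℕ) (hℓ : 0 < ℓ) (p : ℕ) : PolyRing m →ₐ[Polynomial ℤ] PolyRing ℓ :=
  aeval fun k : Fin m => if h : k.1 + 1 < ℓ then X ⟨k.1 + 1, h⟩
    else if k.1 = p then C Polynomial.X * X ⟨0, hℓ⟩ else 0

lemma rotSpecialize_X (hℓ : 0 < ℓ) (p : ℕ) (k : Fin m) :
    rotSpecialize m hℓ p (X k) = if h : k.1 + 1 < ℓ then X ⟨k.1 + 1, h⟩
      else if k.1 = p then C Polynomial.X * X ⟨0, hℓ⟩ else 0 := aeval_X _ _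

lemma rotSpecialize_first (hℓ : 0 < ℓ) (G : PolyRing m) :
    rotSpecialize m hℓ (ℓ - 1) G = Phi ℓ (specialize m ℓ G) := by
  have : rotSpecialize m hℓ (ℓ - 1) = (Phi ℓ).comp (specialize m ℓ) := by
    apply algHom_ext
    intro k
    rw [AlgHom.comp_apply, rotSpecialize_X, specialize_X]
    by_cases h1 : k.1 < ℓ
    · rw [dif_pos h1]
      by_cases h2 : k.1 + 1 < ℓ
      · rw [dif_pos h2, Phi_X_of_lt h2]
      · rw [dif_neg h2, Phi_X_of_not_lt h2, if_pos (by omega)]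
    · rw [dif_neg h1, dif_neg (by omega), if_neg (by omega), map_zero]
  exact DFunLike.congr_fun this G

lemma rotSpecialize_last (hℓ : 0 < ℓ) (hm : ℓ ≤ m) (G : PolyRing m) :
    rotSpecialize m hℓ (m - 1) G = specialize m ℓ (Phi m G) := by
  have : rotSpecialize m hℓ (m - 1) = (specialize m ℓ).comp (Phi m) := by
    apply algHom_ext
    intro k
    have hk := k.2
    rw [AlgHom.comp_apply, rotSpecialize_X]
    by_cases h1 : k.1 + 1 < m
    · rw [Phi_X_of_lt h1, specialize_X]
      by_cases h2 : k.1 + 1 < ℓ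
      · rw [dif_pos h2, dif_pos h2]
      · rw [dif_neg h2, dif_neg h2, if_neg (by omega)]
    · have hC : specialize m ℓ (C Polynomial.X) = C Polynomial.X := aeval_C _ _
      rw [Phi_X_of_not_lt h1, map_mul, hC, specialize_X, dif_pos hℓ, dif_neg (by omega),
        if_pos (by omega)]
  exact DFunLike.congr_fun this G

lemma rotSpecialize_swapP (hℓ : 0 < ℓ) {j : Fin (m - 1)} (h : ℓ ≤ j.1 + 1) (G : PolyRing m) :
    rotSpecialize m hℓ j.1 (swapP j G) = rotSpecialize m hℓ (j.1 + 1) G := by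
  have : (rotSpecialize m hℓ j.1).comp (swapP j) = rotSpecialize m hℓ (j.1 + 1) := by
    apply algHom_ext
    intro k
    rw [AlgHom.comp_apply, swapP_X, rotSpecialize_X, rotSpecialize_X]
    have e1 : (lo j).1 = j.1 := rfl
    have e2 : (hi j).1 = j.1 + 1 := rfl
    by_cases h1 : k = lo j
    · rw [h1, Equiv.swap_apply_left, dif_neg (by omega), dif_neg (by omega), if_neg (by omega),
        if_neg (by omega)]
    · by_cases h2 : k = hi j
      · rw [h2, Equiv.swap_apply_right, dif_neg (by omega), dif_neg (by omega), if_pos e1,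
          if_pos e2]
      · have h1' : k.1 ≠ j.1 := fun e => h1 (Fin.ext e)
        have h2' : k.1 ≠ j.1 + 1 := fun e => h2 (Fin.ext e)
        rw [Equiv.swap_apply_of_ne_of_ne h1 h2, if_neg h1', if_neg h2']
  exact DFunLike.congr_fun this G

/-- A polynomial symmetric in `x_ℓ, …, x_m` may be specialized before or after `Φ`. -/
lemma specialize_Phi (hℓ : 0 < ℓ) (hm : ℓ ≤ m) {G : PolyRing m}
    (hG : ∀ j : Fin (m - 1), ℓ ≤ j.1 + 1 → swapP j G = G) :
    specialize m ℓ (Phi m G) = Phi ℓ (specialize m ℓ G) := by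
  rw [← rotSpecialize_last hℓ hm, ← rotSpecialize_first hℓ]
  have : ∀ t, ℓ + t ≤ m → rotSpecialize m hℓ (ℓ - 1 + t) G = rotSpecialize m hℓ (ℓ - 1) G := by
    intro t
    induction t with
    | zero => intro _; rfl
    | succ t ih =>
      intro ht
      have h := rotSpecialize_swapP hℓ (j := ⟨ℓ - 1 + t, by omega⟩) (by simp only; omega) G
      rw [hG _ (by simp only; omega)] at h
      rw [← ih (by omega)]
      exact h.symm
  have := this (m - ℓ) (by omega)
  rwa [show ℓ - 1 + (m - ℓ) = m - 1 by omega] at this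

lemma padZeros_heckeStep {i : Fin (ℓ - 1)} {j : Fin (m - 1)} (h : i.1 = j.1) (α : Fin ℓ → ℕ) :
    padZeros m (heckeStep i α) = heckeStep j (padZeros m α) := by
  funext k
  have hi2 := i.2
  simp only [padZeros, heckeStep_apply, lo, hi, ← h]
  grind

/-- Rotating before adding zeros amounts to moving the last entry across the zeros and then
rotating. -/
lemma padZeros_rotate (hℓ : 0 < ℓ) (hm : ℓ ≤ m) (α : Fin ℓ → ℕ) :
    padZeros m (rotate α) = stairStep m ℓ (padZeros m α) := by
  set g : ℕ → ℕ := fun x => if h : x < ℓ then α ⟨x, h⟩ else 0 with hg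
  have e : padZeros m α = fun k => g k.1 := rfl
  rw [e, stairStep_eq hℓ hm fun x hx => dif_neg (by omega)]
  funext k
  simp only [padZeros, rotate, cycleStep, hg]
  grind

/-- Adding zeros at the end of the weight: the nonsymmetric Macdonald polynomials are stable. The
specializations of the polynomials in `m` variables satisfy the recurrence in `ℓ` variables. -/
lemma specialize_macdonaldE (hm : ℓ ≤ m) (α : Fin ℓ → ℕ) :
    specialize m ℓ (macdonaldE (padZeros m α)) = macdonaldE α := by
  have hE : KnopSahi ℓ fun α => specialize m ℓ (macdonaldE (padZeros m α)) := by
    constructor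
    · have : padZeros m (0 : Fin ℓ → ℕ) = 0 := by
        funext k
        simp [padZeros]
      rw [this, macdonaldE_zero, map_one]
    · intro i α
      have hi2 := i.2
      have hij : i.1 = (⟨i.1, by omega⟩ : Fin (m - 1)).1 := rfl
      rw [padZeros_heckeStep hij, (knopSahi_macdonaldE m).step]
      exact specialize_demazureP hij _
    · intro h α
      have h' : 0 < m := by omega
      rw [padZeros_rotate h hm, stairStep, macdonaldE_rotate h', macdonaldE_heckeAct, rotP, map_mul,
        specialize_X, dif_pos h, specialize_Phi h hm, specialize_wordProd]
      · intro i hi'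
        have := (mem_longWord hi').1
        omega
      · intro j hj
        have hj2 := j.2
        apply swapP_of_absorb
        apply genN_mul_longWord <;> omega
  exact congrFun hE.eq_macdonaldE α

lemma sum_dite_lt (hm : ℓ ≤ m) {M : Type*} [AddCommMonoid M] (f : Fin ℓ → M) :
    ∑ k : Fin m, (if h : k.1 < ℓ then f ⟨k.1, h⟩ else 0) = ∑ k, f k := by
  obtain ⟨t, rfl⟩ := Nat.exists_eq_add_of_le hm
  rw [Fin.sum_univ_add]
  simp

lemma sum_padZeros (hm : ℓ ≤ m) (α : Fin ℓ → ℕ) : ∑ k, padZeros m α k = ∑ k, α k :=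
  sum_dite_lt hm α

lemma conj_padZeros (hm : ℓ ≤ m) (α : Fin ℓ → ℕ) : conj (padZeros m α) = conj α := by
  have hsup : Finset.univ.sup (padZeros m α) = Finset.univ.sup α := by
    apply le_antisymm
    · refine Finset.sup_le fun k _ => ?_
      unfold padZeros
      split_ifs with h
      · exact Finset.le_sup (f := α) (Finset.mem_univ _)
      · exact Nat.zero_le _
    · refine Finset.sup_le fun k _ => ?_
      have := Finset.le_sup (f := padZeros m α) (Finset.mem_univ ⟨k.1, k.2.trans_le hm⟩)
      simpa [padZeros] using this
  rw [conj_eq, conj_eq, hsup]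
  apply List.map_congr_left
  intro j _
  rw [Finset.card_filter, Finset.card_filter, ← sum_dite_lt hm]
  apply Finset.sum_congr rfl
  intro k _
  unfold padZeros
  split_ifs <;> first | rfl | omega

end Stability

/-! ### Nonsymmetric Catalan functions are nonsymmetric Macdonald polynomials -/

/-- The case of at least as many variables as the size of the weight. -/
lemma toSeries_macdonaldE_eq_catalan {ℓ m : ℕ} (α : Fin ℓ → ℕ) (hsum : m = ∑ i, α i) (hm : m ≤ ℓ)
    {z : ZeroHecke ℓ} (hz : IsLongestTo α z) :
    toSeries ℓ (macdonaldE α) = catalan (deltaPrime ℓ (conj α)) (onesZeros ℓ m) z := by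
  have hs := conj_pairwise α
  have hpos := one_le_of_mem_conj α
  have hcongr := stairSeries_congr hm (r := fun i => i + nrEntry (conj α) i)
    (fun i => by have := one_le_nrEntry _ hpos i; omega) (nrEntry_mono _) (w := z) (by
      intro i hi'
      by_cases hlt : i < ℓ - 1
      · rw [genN_of_lt hlt]
        apply hz.mul_gen
        simp only [zero_add] at hi'
        rw [dec_eq_zero_of_nrEntry_le α (k := lo ⟨i, hlt⟩) hi',
          dec_eq_zero_of_nrEntry_le α (k := hi ⟨i, hlt⟩) (hi'.trans (Nat.le_succ i))]
      · rw [genN_of_ge (not_lt.1 hlt), mul_one])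
  have hexp : stairExp ℓ (fun i => i + nrEntry (conj α) i) m = dec α := by
    rw [hsum, ← sum_conj, stairExp_nrEntry hs hpos (le_of_mem_conj α)]
    funext i
    exact conjPart_conj α i
  rw [hexp, ← macdonaldE_heckeAct, hz.1, ← catalanSeries_deltaPrime hs hpos] at hcongr
  ext1 d
  rw [catalan, PowerSeries.coeff_mk, ← poly_demazureW, ← coeff_demazureS]
  symm
  apply poly_eq_of_sub_mem (toSeries_mem_posPart _ d)
  rw [← map_sub]
  exact hcongr d

end

end NSMacdonald

theorem theoremt (ℓ : ℕ) :
    (∀ E : (Fin ℓ → ℕ) → NSMacdonald.PolyRing ℓ,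
      NSMacdonald.KnopSahi ℓ E ↔ E = NSMacdonald.macdonaldE) ∧
    ∀ (α : Fin ℓ → ℕ) (m : ℕ), m = ∑ i, α i →
      (m ≤ ℓ → ∃ z : NSMacdonald.ZeroHecke ℓ,
        (∀ z' : NSMacdonald.ZeroHecke ℓ, NSMacdonald.IsLongestTo α z' ↔ z' = z) ∧
        NSMacdonald.IsTame (NSMacdonald.deltaPrime ℓ (NSMacdonald.conj α)) z ∧
        NSMacdonald.toSeries ℓ (NSMacdonald.macdonaldE α) =
          NSMacdonald.catalan (NSMacdonald.deltaPrime ℓ (NSMacdonald.conj α))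
            (NSMacdonald.onesZeros ℓ m) z) ∧
      (ℓ < m → ∃ z : NSMacdonald.ZeroHecke m,
        (∀ z' : NSMacdonald.ZeroHecke m,
          NSMacdonald.IsLongestTo (NSMacdonald.padZeros m α) z' ↔ z' = z) ∧
        NSMacdonald.IsTame (NSMacdonald.deltaPrime m (NSMacdonald.conj α)) z ∧
        ∃ P : NSMacdonald.PolyRing m,
          NSMacdonald.toSeries m P =
            NSMacdonald.catalan (NSMacdonald.deltaPrime m (NSMacdonald.conj α))
              (NSMacdonald.onesZeros m m) z ∧
          NSMacdonald.macdonaldE α = NSMacdonald.specialize m ℓ P) := by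
  refine ⟨fun E => ⟨fun h => h.eq_macdonaldE, ?_⟩, fun α m hsum => ⟨fun hm => ?_, fun hm => ?_⟩⟩
  · rintro rfl
    exact NSMacdonald.knopSahi_macdonaldE ℓ
  · have hz := (NSMacdonald.isLongestTo_iff α _).2 rfl
    exact ⟨_, NSMacdonald.isLongestTo_iff _, NSMacdonald.isTame_deltaPrime α hz,
      NSMacdonald.toSeries_macdonaldE_eq_catalan α hsum hm hz⟩
  · have hz := (NSMacdonald.isLongestTo_iff (NSMacdonald.padZeros m α) _).2 rfl
    have hconj := NSMacdonald.conj_padZeros hm.le α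
    refine ⟨_, NSMacdonald.isLongestTo_iff _, ?_,
      NSMacdonald.macdonaldE (NSMacdonald.padZeros m α), ?_,
      (NSMacdonald.specialize_macdonaldE hm.le α).symm⟩
    · rw [← hconj]
      exact NSMacdonald.isTame_deltaPrime _ hz
    · rw [← hconj]
      exact NSMacdonald.toSeries_macdonaldE_eq_catalan _
        (hsum.trans (NSMacdonald.sum_padZeros hm.le α).symm) le_rfl hz
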